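/- Let $\mathbb X=\{1,2,3,\dots\}$, let $\log$ be the logarithm to base $2$, and put $0\log(1/0)=0$. Let $\rho:\mathbb X\times\mathbb X\to[0,\infty)$ satisfy $\rho(x,x)=0$ and $\rho(x,y)>0$ for $x\ne y$. Assume that $\rho$ is unbounded and consistent with the Euclidean distance: for every $K>0$ there is $\epsilon>0$ such that $\rho(i,j)\ge K$ whenever $|i-j|\ge\epsilon$. For $x^n,y^n\in\mathbb X^n$ put $\rho_n(x^n,y^n)=\frac1n\sum_{i=1}^n\rho(x_i,y_i)$. A $D$-semifaithful code of length $n$ at distortion $d>0$ is a triple $\xi_n=(\phi_n,\mathcal C_n,\mathcal D_n)$ of a quantizer $\phi_n:\mathbb X^n\to\mathbb X^n$ with image $\mathcal B_n$, such that $\rho_n(x^n,\phi_n(x^n))\le d$ for all $x^n$ and $\phi_n(y^n)=y^n$ for all $y^n\in\mathcal B_n$, a prefix-free encoder $\mathcal C_n$ from $\mathcal B_n$ to nonempty binary words, and a decoder $\mathcal D_n$ with $\mathcal D_n(\mathcal C_n(y^n))=y^n$ for all $y^n\in\mathcal B_n$. Its rate under a law $P$ on $\mathbb X^n$ is $R(\xi_n,P)=\frac1n\mathbb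 E_{X^n\sim P}[\text{length of }\mathcal C_n(\phi_n(X^n))]$. Let $\mathcal Q_n(d)$ be the set of partitions $\pi$ of $\mathbb X^n$ such that every cell $A\in\pi$ contains some $y^n$ with $\sup_{x^n\in A}\rho_n(x^n,y^n)\le d$, and let $$\mathcal R_n(d,P)=\inf_{\pi\in\mathcal Q_n(d)}\frac1n\sum_{A\in\pi}P(A)\log\frac1{P(A)}.$$ For $f:\mathbb X\to[0,\infty)$ let $\Lambda_f$ be the set of probability distributions $\mu$ on $\mathbb X$ with $\mu(x)\le f(x)$ for all $x$. Put $\tau_f=\min\{k\ge1:\sum_{x\ge k}f(x)\le1\}$, and let $\tilde\mu_f(x)=f(x)$ for $x\ge\tau_f$, $\tilde\mu_f(\tau_f-1)=1-\sum_{x\ge\tau_f}f(x)$ (if $\tau_f\ge2$), and $\tilde\mu_f(x)=0$ for $x<\tau_f-1$. Let $\mathcal T_k=\{k,k+1,\dots\}$ and $u_f(n)=\min\{k\ge1:\tilde\mu_f(\mathcal T_{k+1})<1/n\}$. **Theorem.** Assume that every $\mu\in\Lambda_f$ has finite Shannon entropy and that $$\limsup_{k\to\infty}\frac{\sum_{i\ge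 k}f(i)\log(1/f(i))}{\tilde\mu_f(\mathcal T_k)\log(1/\tilde\mu_f(\mathcal T_k))}<\infty$$ (with $0/0=0$). Then there are constants $C_0,C_1,C_2$, depending only on $f$ and $\rho$, such that for every $d>0$ there are $D$-semifaithful codes $\xi_n$ of length $n$ at distortion $d$, $n\ge1$, with $$\sup_{\mu\in\Lambda_f}\bigl[R(\xi_n,\mu^n)-\mathcal R_n(d,\mu^n)\bigr]\le C_0\frac{u_f(n)\log n}{n}+C_1\frac{\log n}{n}+\frac{C_2}{n}\qquad\text{for all }n\ge1,$$ where $\mu^n$ is the law of $n$ independent letters with distribution $\mu$. -/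

import Mathlib

open scoped ENNReal NNReal Topology
open Filter MeasureTheory

noncomputable section

namespace Semifaithful

/-- Blocks of length `n` over the alphabet `{1, 2, 3, …}`. -/
abbrev Block (n : ℕ) : Type := Fin n → ℕ+

/-- The alphabet carries the discrete σ-algebra. -/
instance instMeasurableSpacePNat : MeasurableSpace ℕ+ := ⊤

instance instDiscreteMeasurableSpacePNat : DiscreteMeasurableSpace ℕ+ :=
  ⟨fun _ => MeasurableSpace.measurableSet_top⟩

/-! ### Distortion functions -/

/-- A single-letter distortion: nonnegative, and zero exactly on the diagonal. -/
structure IsDistortion (ρ : ℕ+ → ℕ+ → ℝ) : Prop where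
  nonneg : ∀ x y, 0 ≤ ρ x y
  self : ∀ x, ρ x x = 0
  pos : ∀ x y, x ≠ y → 0 < ρ x y

/-- `ρ` is unbounded and consistent with the Euclidean distance: for every level `K` there is a
radius `ε` such that letters at distance at least `ε` have distortion at least `K`. -/
def IsUnboundedConsistent (ρ : ℕ+ → ℕ+ → ℝ) : Prop :=
  (∀ K : ℝ, ∃ i j, K < ρ i j) ∧
    ∀ K : ℝ, 0 < K → ∃ ε : ℝ, 0 < ε ∧
      ∀ i j : ℕ+, ¬ |((i : ℕ) : ℝ) - ((j : ℕ) : ℝ)| < ε → K ≤ ρ i j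

/-- The per-letter average distortion between two blocks. -/
def blockDistortion (ρ : ℕ+ → ℕ+ → ℝ) {n : ℕ} (x y : Block n) : ℝ :=
  (1 / (n : ℝ)) * ∑ i, ρ (x i) (y i)

/-! ### Codes -/

/-- A `D`-semifaithful code of block length `n` operating at distortion `d`. The set of prototypes
is the range of the quantizer. -/
structure Code (ρ : ℕ+ → ℕ+ → ℝ) (d : ℝ) (n : ℕ) where
  /-- the quantizer -/
  quantizer : Block n → Block n
  /-- the binary encoder of the prototypes -/
  encode : Set.range quantizer → List Bool
  /-- the binary decoder -/
  decode : List Bool → Set.range quantizer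
  /-- the distortion constraint, for every source block -/
  distortion_le : ∀ x, blockDistortion ρ x (quantizer x) ≤ d
  /-- every prototype lies in its own quantization cell -/
  quantizer_prototype : ∀ y ∈ Set.range quantizer, quantizer y = y
  /-- codewords have at least one bit -/
  encode_ne_nil : ∀ y, encode y ≠ []
  /-- no codeword is a prefix of another codeword -/
  prefix_free : ∀ y y', encode y <+: encode y' → y = y'
  /-- the decoder inverts the encoder -/
  decode_encode : ∀ y, decode (encode y) = y

/-- The number of bits that the code spends on the source block `x`. -/
def Code.length {ρ : ℕ+ → ℕ+ → ℝ} {d : ℝ} {n : ℕ} (ξ : Code ρ d n) (x : Block n) : ℕ :=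
  (ξ.encode ⟨ξ.quantizer x, Set.mem_range_self x⟩).length

/-- The law of a block of `n` independent letters with marginal `μ`. -/
def iidLaw (μ : PMF ℕ+) (n : ℕ) : Measure (Block n) :=
  Measure.pi fun _ => μ.toMeasure

/-- The rate of a code, in bits per letter, for the block law `P`. -/
def Code.rate {ρ : ℕ+ → ℕ+ → ℝ} {d : ℝ} {n : ℕ} (ξ : Code ρ d n) (P : Measure (Block n)) : ℝ≥0∞ :=
  (∫⁻ x, (ξ.length x : ℝ≥0∞) ∂P) / (n : ℝ≥0∞)

/-! ### Entropy and the benchmark rate -/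

/-- `p log₂ (1/p)`, with value `0` at `p = 0`. -/
def infoTerm (p : ℝ) : ℝ := p * Real.logb 2 (1 / p)

/-- The Shannon entropy (in bits) of a distribution on the alphabet. -/
def entropy (μ : PMF ℕ+) : ℝ≥0∞ :=
  ∑' x, ENNReal.ofReal (infoTerm (μ x).toReal)

/-- The entropy (in bits) of a block law restricted to the σ-algebra of the partition `π`. -/
def partitionEntropy {n : ℕ} (P : Measure (Block n)) (π : Set (Set (Block n))) : ℝ≥0∞ :=
  ∑' A : π, ENNReal.ofReal (infoTerm (P.real (A : Set (Block n))))

/-- The partitions of the set of blocks in which every cell contains a point that is within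
distortion `d` of the whole cell. -/
def coveringPartitions (ρ : ℕ+ → ℕ+ → ℝ) (d : ℝ) (n : ℕ) : Set (Set (Set (Block n))) :=
  {π | Setoid.IsPartition π ∧ ∀ A ∈ π, ∃ y ∈ A, ∀ x ∈ A, blockDistortion ρ x y ≤ d}

/-- The least entropy per letter over the partitions with distortion `d`. -/
def benchmarkRate (ρ : ℕ+ → ℕ+ → ℝ) (d : ℝ) {n : ℕ} (P : Measure (Block n)) : ℝ≥0∞ :=
  (⨅ π ∈ coveringPartitions ρ d n, partitionEntropy P π) / (n : ℝ≥0∞)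

/-! ### Envelope families -/

/-- The distributions whose mass function is dominated by `f`. -/
def envelopeFamily (f : ℕ+ → ℝ≥0) : Set (PMF ℕ+) :=
  {μ | ∀ x, μ x ≤ (f x : ℝ≥0∞)}

/-- The distributions of finite entropy. -/
def finiteEntropy : Set (PMF ℕ+) :=
  {μ | entropy μ < ∞}

/-- `τ_f`, the least `k ≥ 1` with `∑_{x ≥ k} f x ≤ 1`; the sum is taken in `[0, ∞]`. -/
def envelopeThreshold (f : ℕ+ → ℝ≥0) : ℕ :=
  sInf {k : ℕ | 1 ≤ k ∧ ∑' x : {x : ℕ+ // k ≤ (x : ℕ)}, (f x : ℝ≥0∞) ≤ 1}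

/-- The mass function of the envelope distribution: the tail of `f` from `τ_f` on, the remaining
mass at `τ_f - 1`, and nothing below. -/
def envelopeMass (f : ℕ+ → ℝ≥0) (x : ℕ+) : ℝ :=
  if envelopeThreshold f ≤ (x : ℕ) then (f x : ℝ)
  else if (x : ℕ) + 1 = envelopeThreshold f then
    1 - ∑' y : {y : ℕ+ // envelopeThreshold f ≤ (y : ℕ)}, (f y : ℝ)
  else 0

/-- The mass that the envelope distribution gives to `{k, k + 1, …}`. -/
def envelopeTail (f : ℕ+ → ℝ≥0) (k : ℕ) : ℝ :=
  ∑' x : {x : ℕ+ // k ≤ (x : ℕ)}, envelopeMass f x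

/-- `u_f(n)`, the least `k ≥ 1` such that the envelope distribution gives mass less than `1 / n`
to `{k + 1, k + 2, …}`. -/
def envelopeQuantile (f : ℕ+ → ℝ≥0) (n : ℕ) : ℕ :=
  sInf {k : ℕ | 1 ≤ k ∧ envelopeTail f (k + 1) < 1 / (n : ℝ)}

/-- The tail-regularity condition: the ratio of `∑_{i ≥ k} f(i) log (1 / f(i))` to
`p_k log (1 / p_k)`, with `p_k` the envelope mass of `{k, k + 1, …}`, has a finite limsup. -/
def TailRegular (f : ℕ+ → ℝ≥0) : Prop :=
  limsup (fun k : ℕ =>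
    (((∑' i : {i : ℕ+ // k ≤ (i : ℕ)}, infoTerm (f i)) / infoTerm (envelopeTail f k) : ℝ) : EReal))
    atTop < ⊤

/-- The worst-case redundancy over the family `Λ` of a code of block length `n`. -/
def worstRedundancy {ρ : ℕ+ → ℕ+ → ℝ} {d : ℝ} {n : ℕ} (ξ : Code ρ d n) (Λ : Set (PMF ℕ+)) :
    EReal :=
  ⨆ μ ∈ Λ, (((ξ.rate (iidLaw μ n) : ℝ≥0∞) : EReal) -
    ((benchmarkRate ρ d (iidLaw μ n) : ℝ≥0∞) : EReal))

end Semifaithful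

end

namespace Semifaithful

/-! The law of a memoryless source is constant on type classes. Hence, by Gibbs' inequality on each
class (`sum_classInfo_le`), the entropy of a covering partition is at least the average, over
classes, of its entropy under the uniform law on the class. It therefore suffices to find one code
whose mean length on every class is at most the class entropy of an arbitrary covering plus a small
cost (`rate_le_of_class_bound`). Describing the type is cheap: `u + 1` uniform fields of `log (n +
1)` bits, and the letters above `u` listed with weights `θ` that follow the tail of `f`. With `u`
the envelope quantile the expected number of such letters is at most 1, and tail regularity bounds
their expected description by a multiple of `log n + 1` (`exists_tail_weights`).

The difficulty is the requirement that every prototype be quantized to itself. Near-optimal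
coverings `φ` are chosen separately on each class, and `φ x` usually lies in another class, where
`φ` moves it. The cure is a set of prototypes that is dense enough for every block to find one
nearby, yet sparse enough that describing a prototype `x` as an edit of `φ x`, at a cost of order `D
log n` bits with `D` the Hamming distance of `x` and `φ x`, is affordable on average.

Sparsity comes from a linear hash over `𝔽₂`. A block at distance `D` is a prototype when about `log
D / 8` coordinates vanish in each of nine channels. Permuting positions translates the hash freely,
so level `k` has density at most `2 ^ (-9k)` in every class (`card_vanishes_le`), which beats `D < 2
^ (8k + 8)`. Blocks with small `D`, with `D` small against the number of tail letters, or with an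
irregular pair `(x, φ x)` are also made prototypes. Irregular pairs are rare once the positions have
been permuted suitably in each class (`exists_regular_quantizer`).

Density comes from a short walk. If `x` is not a prototype, restore in `φ x` the costliest letter of
`x` and at most 18 further letters, so that the hash vanishes up to level `log D / 4`. The result
`v` is a prototype unless its own distance exceeds `D ^ 2`. In that case exchanges towards `φ v` at
cheap positions cost only of order `t / D ^ 2`, with `t = n d`, against a saved distortion of order
`t / D`, and the step repeats (`exists_prototype`). Since distances square, the possible endpoints,
given `φ x` and the type of `x`, are polynomially many in `n` (`card_candidates_le`), so naming one
costs `O(log n)` bits.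

All these descriptions are mixed into one subprobability on prototypes, and Shannon–Fano–Elias
coding turns it into a prefix code (`exists_code_of_kernel`). -/

/-! ### Prefix codes with prescribed weights -/

/-- The `L`-bit binary expansion of `k`, most significant bit first. -/
def binaryWord (L k : ℕ) : List Bool := (List.range L).map fun t => k.testBit (L - 1 - t)

theorem binaryWord_length (L k : ℕ) : (binaryWord L k).length = L := by simp [binaryWord]

/-- A word stands for a dyadic interval, and a prefix relation between words is an inclusion of
intervals, read off bit by bit. -/
theorem shiftRight_of_binaryWord_prefix {L L' k k' : ℕ} (hk : k < 2 ^ L) (hk' : k' < 2 ^ L')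
    (h : binaryWord L k <+: binaryWord L' k') : L ≤ L' ∧ k = k' / 2 ^ (L' - L) := by
  have hL : L ≤ L' := by simpa [binaryWord_length] using h.length_le
  refine ⟨hL, ?_⟩
  apply Nat.eq_of_testBit_eq
  intro s
  rw [Nat.testBit_div_two_pow]
  by_cases hs : s < L
  · have := h.getElem (i := L - 1 - s) (by rw [binaryWord_length]; omega)
    simp only [binaryWord, List.getElem_map, List.getElem_range] at this
    rw [show L - 1 - (L - 1 - s) = s by omega,
      show L' - 1 - (L - 1 - s) = s + (L' - L) by omega] at this
    exact this
  · rw [Nat.testBit_eq_false_of_lt, Nat.testBit_eq_false_of_lt]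
    · exact hk'.trans_le (Nat.pow_le_pow_right (by norm_num) (by omega))
    · exact hk.trans_le (Nat.pow_le_pow_right (by norm_num) (by omega))

/-- Converse of Kraft's inequality for countably many words: Shannon–Fano–Elias coding. -/
theorem exists_prefix_code {ι : Type*} [Countable ι] (W : ι → ℝ) (hW : ∀ i, 0 < W i)
    (hs : Summable W) (h1 : ∑' i, W i ≤ 1) :
    ∃ enc : ι → List Bool, (∀ i, enc i ≠ []) ∧ (∀ i j, enc i <+: enc j → i = j) ∧
      ∀ i, ((enc i).length : ℝ) ≤ Real.logb 2 (1 / W i) + 2 := by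
  classical
  obtain ⟨e, he⟩ := exists_injective_nat ι
  set F : ι → ℝ := fun i => ∑' j, if e j < e i then W j else 0 with hF
  have hsF : ∀ i, Summable fun j => if e j < e i then W j else 0 := fun i =>
    Summable.of_nonneg_of_le (fun j => by split_ifs <;> simp [(hW j).le])
      (fun j => by split_ifs <;> simp [(hW j).le]) hs
  have hF0 : ∀ i, 0 ≤ F i := fun i => tsum_nonneg fun j => by split_ifs <;> simp [(hW j).le]
  have hFW : ∀ i, F i + W i = ∑' j, ((if e j < e i then W j else 0) + if j = i then W j else 0) := by
    intro i
    rw [Summable.tsum_add (hsF i) (summable_of_ne_finset_zero (s := {i}) (by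
      intro b hb; simp at hb; simp [hb])), tsum_ite_eq]
  have hsG : ∀ i, Summable fun j =>
      ((if e j < e i then W j else 0) + if j = i then W j else 0) := fun i =>
    (hsF i).add (summable_of_ne_finset_zero (s := {i}) (by intro b hb; simp at hb; simp [hb]))
  have hFlt : ∀ i j, e i < e j → F i + W i ≤ F j := by
    intro i j hij
    rw [hFW]
    refine (hsG i).tsum_le_tsum (fun l => ?_) (hsF j)
    by_cases h : l = i
    · subst h; simp [hij]
    · simp only [h, if_false, add_zero]
      split_ifs with h1 h2 <;> first | rfl | omega | simp [(hW l).le]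
  have hFle : ∀ i, F i + W i ≤ 1 := by
    intro i
    rw [hFW]
    refine ((hsG i).tsum_le_tsum (fun l => ?_) hs).trans h1
    by_cases h : l = i
    · subst h; simp
    · simp only [h, if_false, add_zero]
      split_ifs <;> simp [(hW l).le]
  -- The extra bit makes `W i` at least two dyadic steps long, so rounding `F i` up to `k i / 2 ^ L
  -- i` leaves the whole step inside the interval `[F i, F i + W i)`. These intervals are disjoint.
  set L : ι → ℕ := fun i => ⌈Real.logb 2 (1 / W i)⌉₊ + 1 with hL
  have hlog0 : ∀ i, 0 ≤ Real.logb 2 (1 / W i) := fun i =>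
    Real.logb_nonneg (by norm_num) (by
      rw [le_div_iff₀ (hW i)]; linarith [hFle i, hF0 i])
  have hLW : ∀ i, 2 ≤ W i * 2 ^ L i := by
    intro i
    have h := Nat.le_ceil (Real.logb 2 (1 / W i))
    have h2 : 1 / W i ≤ (2 : ℝ) ^ ⌈Real.logb 2 (1 / W i)⌉₊ := by
      have := Real.rpow_le_rpow_of_exponent_le (x := 2) (by norm_num) h
      rwa [Real.rpow_logb (by norm_num) (by norm_num) (by have := hW i; positivity),
        Real.rpow_natCast] at this
    rw [div_le_iff₀ (hW i)] at h2
    simp only [hL, pow_succ]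
    nlinarith
  set k : ι → ℕ := fun i => ⌈F i * 2 ^ L i⌉₊ with hk
  have hpow : ∀ i, (0 : ℝ) < 2 ^ L i := fun i => by positivity
  have hk1 : ∀ i, F i * 2 ^ L i ≤ k i := fun i => Nat.le_ceil _
  have hk2 : ∀ i, (k i : ℝ) + 1 < (F i + W i) * 2 ^ L i := by
    intro i
    have := Nat.ceil_lt_add_one (mul_nonneg (hF0 i) (hpow i).le)
    have h2 := hLW i
    simp only [hk]
    nlinarith
  have hk3 : ∀ i, k i < 2 ^ L i := by
    intro i
    have h2 : (k i : ℝ) < 2 ^ L i := by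
      have := mul_le_mul_of_nonneg_right (hFle i) (hpow i).le
      linarith [hk2 i]
    exact_mod_cast h2
  refine ⟨fun i => binaryWord (L i) (k i), fun i h => ?_, fun i j h => ?_, fun i => ?_⟩
  · have := congrArg List.length h
    rw [binaryWord_length] at this
    simp [hL] at this
  · obtain ⟨hle, hdiv⟩ := shiftRight_of_binaryWord_prefix (hk3 i) (hk3 j) h
    -- Both intervals are compared on the finer grid of `j`. Nested dyadic intervals would force the
    -- disjoint intervals of `i` and `j` to overlap.
    have hp : (2 : ℝ) ^ L j = 2 ^ L i * 2 ^ (L j - L i) := by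
      rw [← pow_add]; congr 1; omega
    have hd : (0 : ℝ) < 2 ^ (L j - L i) := by positivity
    have a1 : (k i : ℝ) * 2 ^ (L j - L i) ≤ k j := by
      have := Nat.div_mul_le_self (k j) (2 ^ (L j - L i))
      rw [← hdiv] at this
      exact_mod_cast this
    have a2 : (k j : ℝ) < (k i + 1) * 2 ^ (L j - L i) := by
      have := Nat.lt_div_mul_add (a := k j) (b := 2 ^ (L j - L i)) (by positivity)
      rw [← hdiv] at this
      have h2 : k j < (k i + 1) * 2 ^ (L j - L i) := by linarith
      exact_mod_cast h2
    apply he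
    rcases lt_trichotomy (e i) (e j) with hlt | heq | hlt
    · exfalso
      have b1 := hFlt i j hlt
      have b2 := hk2 i
      have b3 := hk1 j
      rw [hp] at b3
      have b4 : (F i + W i) * (2 ^ L i * 2 ^ (L j - L i)) ≤ F j * (2 ^ L i * 2 ^ (L j - L i)) :=
        mul_le_mul_of_nonneg_right b1 (by positivity)
      have b5 : ((k i : ℝ) + 1) * 2 ^ (L j - L i) < (F i + W i) * 2 ^ L i * 2 ^ (L j - L i) :=
        mul_lt_mul_of_pos_right b2 hd
      nlinarith
    · exact heq
    · exfalso
      have b1 := hFlt j i hlt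
      have b2 := hk2 j
      have b3 := hk1 i
      rw [hp] at b2
      have b4 : (F j + W j) * (2 ^ L i * 2 ^ (L j - L i)) ≤ F i * (2 ^ L i * 2 ^ (L j - L i)) :=
        mul_le_mul_of_nonneg_right b1 (by positivity)
      have b5 : (F i * 2 ^ L i) * 2 ^ (L j - L i) ≤ k i * 2 ^ (L j - L i) :=
        mul_le_mul_of_nonneg_right b3 hd.le
      nlinarith
  · rw [binaryWord_length]
    simp only [hL]
    push_cast
    linarith [Nat.ceil_lt_add_one (hlog0 i)]

/-! ### Summability of the envelope -/

/-- Divergence allows each new block to avoid all earlier ones and to have at least the square of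
their masses. Starting from mass 4, this gives doubly exponential growth. -/
theorem exists_large_blocks {α : Type*} (g : α → ℝ≥0∞) (hg : ∀ x, g x ≠ ∞) (hsum : ∑' x, g x = ∞) :
    ∃ B : ℕ → Finset α, (∀ k, 2 ^ 2 ^ (k + 1) ≤ ∑ x ∈ B k, g x) ∧
      ∀ j k, j < k → Disjoint (B j) (B k) := by
  classical
  have key : ∀ (U : Finset α) (c : ℝ≥0∞), c ≠ ∞ → ∃ B : Finset α, Disjoint U B ∧ c ≤ ∑ x ∈ B, g x := by
    intro U c hc
    have hU : ∑ x ∈ U, g x ≠ ∞ := ENNReal.sum_ne_top.2 fun x _ => hg x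
    have h1 : c + ∑ x ∈ U, g x < ∑' x, g x := by
      rw [hsum]; exact (ENNReal.add_ne_top.2 ⟨hc, hU⟩).lt_top
    rw [ENNReal.tsum_eq_iSup_sum] at h1
    obtain ⟨s, hs⟩ := lt_iSup_iff.1 h1
    refine ⟨s \ U, Finset.disjoint_sdiff, ?_⟩
    have h2 : ∑ x ∈ s, g x ≤ ∑ x ∈ s \ U, g x + ∑ x ∈ U, g x := by
      rw [← Finset.sum_union Finset.sdiff_disjoint]
      exact Finset.sum_le_sum_of_subset (by intro x hx; simp; tauto)
    exact (ENNReal.add_le_add_iff_right hU).1 (hs.le.trans h2)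
  obtain ⟨B, hB1, hB2⟩ := exists_seq_of_forall_finset_exists
    (fun B : Finset α => 4 ≤ ∑ x ∈ B, g x)
    (fun B B' => Disjoint B B' ∧ (∑ x ∈ B, g x) ^ 2 ≤ ∑ x ∈ B', g x) (by
      intro s _
      have hfin : ∀ B : Finset α, (∑ x ∈ B, g x) ^ 2 ≠ ∞ := fun B =>
        ENNReal.pow_ne_top (ENNReal.sum_ne_top.2 fun x _ => hg x)
      obtain ⟨B', hd, hc⟩ := key (s.sup id) (4 + ∑ B ∈ s, (∑ x ∈ B, g x) ^ 2)
        (ENNReal.add_ne_top.2 ⟨by simp, ENNReal.sum_ne_top.2 fun B _ => hfin B⟩)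
      refine ⟨B', le_self_add.trans hc, fun B hB => ⟨?_, ?_⟩⟩
      · exact hd.mono_left (Finset.le_sup (f := id) hB)
      · refine le_trans ?_ (le_add_self.trans hc)
        exact Finset.single_le_sum (f := fun B => (∑ x ∈ B, g x) ^ 2) (fun _ _ => zero_le) hB)
  refine ⟨B, fun k => ?_, fun j k h => (hB2 j k h).1⟩
  induction k with
  | zero => simpa using (by norm_num : (2 : ℝ≥0∞) ^ 2 = 4) ▸ hB1 0
  | succ k ih =>
    refine le_trans ?_ (hB2 k (k + 1) (Nat.lt_succ_self k)).2
    calc (2 : ℝ≥0∞) ^ 2 ^ (k + 1 + 1) = (2 ^ 2 ^ (k + 1)) ^ 2 := by rw [← pow_mul, ← pow_succ]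
      _ ≤ _ := by gcongr

theorem le_logb_inv_of_le {p : ℝ} (hp : 0 < p) {m : ℕ} (h : p * 2 ^ m ≤ 1) :
    (m : ℝ) ≤ Real.logb 2 (1 / p) := by
  rw [Real.le_logb_iff_rpow_le (by norm_num) (by positivity), Real.rpow_natCast,
    le_div_iff₀ hp]
  linarith

/-- An envelope of infinite mass dominates a distribution of infinite entropy. -/
theorem tsum_envelope_ne_top (f : ℕ+ → ℝ≥0) (hent : envelopeFamily f ⊆ finiteEntropy) :
    ∑' x, (f x : ℝ≥0∞) ≠ ∞ := by
  classical
  intro hf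
  -- Truncation at 1 keeps the sum infinite and bounds single masses, so that a heavy block must
  -- have many letters.
  set g : ℕ+ → ℝ≥0∞ := fun x => ((min (f x) 1 : ℝ≥0) : ℝ≥0∞) with hgdef
  have hg1 : ∀ x, g x ≤ 1 := fun x => by simp [hgdef]
  have hgf : ∀ x, g x ≤ f x := fun x => by simp [hgdef]
  have hgt : ∀ x, g x ≠ ∞ := fun x => by simp [hgdef]
  have hg : ∑' x, g x = ∞ := by
    by_contra hne
    have hcof : {x | (1 : ℝ≥0∞) ≤ g x}.Finite := ENNReal.finite_const_le_of_tsum_ne_top hne (by simp)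
    apply absurd hf
    have : ∑' x, (f x : ℝ≥0∞) ≤ ∑' x, (g x + if x ∈ hcof.toFinset then (f x : ℝ≥0∞) else 0) := by
      refine ENNReal.tsum_le_tsum fun x => ?_
      by_cases hx : x ∈ hcof.toFinset
      · simp [hx]
      · rw [if_neg hx, add_zero]
        have hx' : ¬ (1 : ℝ≥0∞) ≤ g x := by simpa using hx
        have hlt : f x < 1 := by
          by_contra hcon
          apply hx'
          simp only [not_lt] at hcon
          simp [hgdef, hcon]
        simp [hgdef, hlt.le]
    refine ne_top_of_le_ne_top ?_ this
    rw [ENNReal.tsum_add]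
    refine ENNReal.add_ne_top.2 ⟨hne, ?_⟩
    rw [tsum_eq_sum (s := hcof.toFinset) (by intro b hb; simp only [hb, if_false])]
    refine ENNReal.sum_ne_top.2 fun x _ => ?_
    split_ifs
    simp
  obtain ⟨B, hB, hdis⟩ := exists_large_blocks g hgt hg
  set G : ℕ → ℝ≥0∞ := fun k => ∑ x ∈ B k, g x with hG
  have hGt : ∀ k, G k ≠ ∞ := fun k => ENNReal.sum_ne_top.2 fun x _ => hgt x
  have hG1 : ∀ k, 1 ≤ G k := fun k => (one_le_pow₀ (by norm_num)).trans (hB k)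
  have hG0 : ∀ k, G k ≠ 0 := fun k h => by simpa [h] using hG1 k
  have huniq : ∀ x j k, x ∈ B j → x ∈ B k → j = k := by
    intro x j k hj hk
    rcases lt_trichotomy j k with h | h | h
    · exact absurd hk (Finset.disjoint_left.1 (hdis _ _ h) hj)
    · exact h
    · exact absurd hj (Finset.disjoint_left.1 (hdis _ _ h) hk)
  -- Block `k` is scaled down to mass `2 ^ (-(k + 1))`; these masses sum to one.
  set c : ℕ → ℝ≥0∞ := fun k => 2⁻¹ ^ (k + 1) / G k with hc
  have hc1 : ∀ k, c k ≤ 2⁻¹ ^ (k + 1) := fun k => ENNReal.div_le_of_le_mul (by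
    calc (2⁻¹ : ℝ≥0∞) ^ (k + 1) = 2⁻¹ ^ (k + 1) * 1 := (mul_one _).symm
      _ ≤ _ := by gcongr; exact hG1 k)
  have hc1' : ∀ k, c k ≤ 1 := fun k => (hc1 k).trans (pow_le_one₀ (by simp) (by simp))
  set h : ℕ+ → ℝ≥0∞ := fun x => ∑' k, if x ∈ B k then c k * g x else 0 with hh
  have hval : ∀ k, ∀ x ∈ B k, h x = c k * g x := by
    intro k x hx
    simp only [hh]
    rw [tsum_eq_single k]
    · simp [hx]
    · intro j hj
      rw [if_neg]
      exact fun hxj => hj (huniq x j k hxj hx)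
  have hle : ∀ x, h x ≤ f x := by
    intro x
    by_cases hx : ∃ k, x ∈ B k
    · obtain ⟨k, hk⟩ := hx
      rw [hval k x hk]
      calc c k * g x ≤ 1 * g x := by gcongr; exact hc1' k
        _ ≤ f x := by rw [one_mul]; exact hgf x
    · have : h x = 0 := by
        simp only [hh]
        simp only [not_exists] at hx
        simp [hx]
      simp [this]
  have hsum : ∑' x, h x = 1 := by
    simp only [hh]
    rw [ENNReal.tsum_comm]
    have : ∀ k, ∑' x, (if x ∈ B k then c k * g x else 0) = 2⁻¹ ^ (k + 1) := by
      intro k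
      rw [tsum_eq_sum (s := B k) (by intro b hb; simp [hb])]
      rw [Finset.sum_congr rfl (fun x hx => if_pos hx), ← Finset.mul_sum]
      simp only [hc]
      exact ENNReal.div_mul_cancel (hG0 k) (hGt k)
    simp_rw [this, pow_succ, ENNReal.tsum_mul_right, ENNReal.tsum_geometric]
    rw [ENNReal.one_sub_inv_two, inv_inv, ENNReal.mul_inv_cancel (by simp) (by simp)]
  set μ : PMF ℕ+ := ⟨h, hsum ▸ ENNReal.summable.hasSum⟩ with hμ
  have hμm : μ ∈ envelopeFamily f := hle
  have hfin := hent hμm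
  change entropy μ < ∞ at hfin
  refine absurd hfin ?_
  rw [not_lt, top_le_iff]
  -- After scaling, a letter of block `k` has mass at most `2 ^ (-2 ^ (k + 1))`, hence
  -- self-information at least `2 ^ (k + 1)`. This cancels the mass of the block, so every block
  -- contributes at least one bit.
  have hblock : ∀ k, 1 ≤ ∑ x ∈ B k, ENNReal.ofReal (infoTerm (μ x).toReal) := by
    intro k
    have hterm : ∀ x ∈ B k, h x * 2 ^ (k + 1) ≤ ENNReal.ofReal (infoTerm (μ x).toReal) := by
      intro x hx
      change _ ≤ ENNReal.ofReal (infoTerm (h x).toReal)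
      have hxt : h x ≠ ∞ := ne_top_of_le_ne_top (by simp) (hle x)
      by_cases h0 : h x = 0
      · simp [h0]
      have hpos : 0 < (h x).toReal := ENNReal.toReal_pos h0 hxt
      have hb : h x * 2 ^ 2 ^ (k + 1) ≤ 1 := by
        rw [hval k x hx]
        calc c k * g x * 2 ^ 2 ^ (k + 1) ≤ c k * 1 * G k := by
              gcongr
              · exact hg1 x
              · exact hB k
          _ = 2⁻¹ ^ (k + 1) := by
              simp only [hc, mul_one]; exact ENNReal.div_mul_cancel (hG0 k) (hGt k)
          _ ≤ 1 := pow_le_one₀ (by simp) (by simp)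
      have hb' : (h x).toReal * 2 ^ 2 ^ (k + 1) ≤ 1 := by
        have := ENNReal.toReal_mono (by simp) hb
        simpa using this
      have hl := le_logb_inv_of_le hpos hb'
      rw [← ENNReal.ofReal_toReal (ENNReal.mul_ne_top hxt (by simp : (2 : ℝ≥0∞) ^ (k + 1) ≠ ∞))]
      apply ENNReal.ofReal_le_ofReal
      simp only [ENNReal.toReal_mul, ENNReal.toReal_pow, ENNReal.toReal_ofNat, infoTerm]
      push_cast at hl
      exact mul_le_mul_of_nonneg_left hl hpos.le
    calc (1 : ℝ≥0∞) = (2⁻¹ * 2) ^ (k + 1) := by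
          rw [ENNReal.inv_mul_cancel (by simp) (by simp), one_pow]
      _ = (∑ x ∈ B k, h x) * 2 ^ (k + 1) := by
          rw [mul_pow, Finset.sum_congr rfl (hval k), ← Finset.mul_sum]
          congr 1
          exact (ENNReal.div_mul_cancel (hG0 k) (hGt k)).symm
      _ ≤ _ := by rw [Finset.sum_mul]; exact Finset.sum_le_sum hterm
  have hinj : Function.Injective (fun q : Σ k, B k => (q.2 : ℕ+)) := by
    rintro ⟨j, x, hx⟩ ⟨k, y, hy⟩ hxy
    simp only at hxy
    subst hxy
    obtain rfl := huniq x j k hx hy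
    rfl
  have := ENNReal.tsum_comp_le_tsum_of_injective hinj
    (fun x => ENNReal.ofReal (infoTerm (μ x).toReal))
  unfold entropy
  rw [← top_le_iff]
  refine le_trans ?_ this
  rw [ENNReal.tsum_sigma']
  calc (∞ : ℝ≥0∞) = ∑' _ : ℕ, 1 := by simp
    _ ≤ _ := by
      refine ENNReal.tsum_le_tsum fun k => ?_
      simp only
      rw [Finset.tsum_subtype (B k) (fun x => ENNReal.ofReal (infoTerm (μ x).toReal))]
      exact hblock k

theorem tail_tsum_eq {α : Type*} [AddCommMonoid α] [TopologicalSpace α] (g : ℕ+ → α) (k : ℕ) :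
    ∑' x : {x : ℕ+ // k ≤ (x : ℕ)}, g x = ∑' x : ℕ+, if k ≤ (x : ℕ) then g x else 0 := by
  rw [show (∑' x : {x : ℕ+ // k ≤ (x : ℕ)}, g x) = ∑' x : {x : ℕ+ | k ≤ (x : ℕ)}, g x from rfl,
    tsum_subtype]
  refine tsum_congr fun x => ?_
  by_cases h : k ≤ (x : ℕ)
  · rw [Set.indicator_of_mem (by exact h), if_pos h]
  · rw [Set.indicator_of_notMem (by exact h), if_neg h]

theorem summable_tail {g : ℕ+ → ℝ} (hg : ∀ x, 0 ≤ g x) (hs : Summable g) (k : ℕ) :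
    Summable fun x : ℕ+ => if k ≤ (x : ℕ) then g x else 0 :=
  Summable.of_nonneg_of_le (fun x => by split_ifs <;> simp [hg x])
    (fun x => by split_ifs <;> simp [hg x]) hs

theorem tail_mono {g : ℕ+ → ℝ} (hg : ∀ x, 0 ≤ g x) (hs : Summable g) {j k : ℕ} (h : j ≤ k) :
    (∑' x : ℕ+, if k ≤ (x : ℕ) then g x else 0) ≤ ∑' x : ℕ+, if j ≤ (x : ℕ) then g x else 0 := by
  refine (summable_tail hg hs k).tsum_le_tsum (fun x => ?_) (summable_tail hg hs j)
  split_ifs with h1 h2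
  · rfl
  · omega
  · exact hg x
  · rfl

theorem tendsto_tail {g : ℕ+ → ℝ} (hg : ∀ x, 0 ≤ g x) (hs : Summable g) :
    Tendsto (fun k : ℕ => ∑' x : ℕ+, if k ≤ (x : ℕ) then g x else 0) atTop (𝓝 0) := by
  rw [Metric.tendsto_atTop]
  intro ε hε
  have h := tendsto_tsum_compl_atTop_zero g
  rw [Metric.tendsto_atTop] at h
  obtain ⟨s, hs'⟩ := h ε hε
  refine ⟨s.sup (fun x : ℕ+ => (x : ℕ)) + 1, fun k hk => ?_⟩
  have h0 : 0 ≤ ∑' x : ℕ+, if k ≤ (x : ℕ) then g x else 0 :=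
    tsum_nonneg fun x => by split_ifs <;> simp [hg x]
  have h1 := hs' s le_rfl
  rw [Real.dist_eq, sub_zero] at h1 ⊢
  rw [abs_of_nonneg h0]
  refine lt_of_le_of_lt ?_ (lt_of_le_of_lt (le_abs_self _) h1)
  rw [show (∑' b : {x // x ∉ s}, g b) = ∑' b : ((s : Set ℕ+)ᶜ : Set ℕ+), g b from rfl, tsum_subtype]
  refine (summable_tail hg hs k).tsum_le_tsum (fun x => ?_) (hs.indicator _)
  by_cases hx : x ∈ s
  · have : (x : ℕ) ≤ s.sup (fun x : ℕ+ => (x : ℕ)) := Finset.le_sup (f := fun x : ℕ+ => (x : ℕ)) hx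
    rw [if_neg (by omega)]
    exact Set.indicator_nonneg (fun x _ => hg x) x
  · rw [Set.indicator_of_mem (by simpa using hx)]
    split_ifs
    · rfl
    · exact hg x

theorem tsum_add_single {g : ℕ+ → ℝ} (hs : Summable g) (a : ℕ+) (c : ℝ) :
    ∑' x, (g x + if x = a then c else 0) = ∑' x, g x + c :=
  (hs.hasSum.add (hasSum_ite_eq a c)).tsum_eq

/-! ### The envelope threshold and the envelope distribution -/

section Threshold

variable {f : ℕ+ → ℝ≥0}

theorem ennreal_tail_le_one_iff (hs : Summable fun x => (f x : ℝ)) (k : ℕ) :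
    ∑' x : {x : ℕ+ // k ≤ (x : ℕ)}, (f x : ℝ≥0∞) ≤ 1 ↔
      (∑' x : ℕ+, if k ≤ (x : ℕ) then (f x : ℝ) else 0) ≤ 1 := by
  have hs' : Summable f := NNReal.summable_coe.1 hs
  have h2 : Summable fun x : {x : ℕ+ // k ≤ (x : ℕ)} => f x :=
    NNReal.summable_comp_injective hs' Subtype.val_injective
  rw [← ENNReal.coe_tsum h2, ← tail_tsum_eq (fun x => (f x : ℝ)), ← NNReal.coe_tsum]
  norm_cast

theorem envelopeThreshold_spec (hs : Summable fun x => (f x : ℝ)) :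
    1 ≤ envelopeThreshold f ∧
      (∑' x : ℕ+, if envelopeThreshold f ≤ (x : ℕ) then (f x : ℝ) else 0) ≤ 1 := by
  have hne : {k : ℕ | 1 ≤ k ∧ ∑' x : {x : ℕ+ // k ≤ (x : ℕ)}, (f x : ℝ≥0∞) ≤ 1}.Nonempty := by
    have h := (tendsto_tail (fun x => NNReal.coe_nonneg (f x)) hs).eventually (gt_mem_nhds (zero_lt_one))
    obtain ⟨k, hk1, hk2⟩ := (h.and (eventually_ge_atTop 1)).exists
    exact ⟨k, hk2, (ennreal_tail_le_one_iff hs k).2 hk1.le⟩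
  have := Nat.sInf_mem hne
  exact ⟨this.1, (ennreal_tail_le_one_iff hs _).1 this.2⟩

theorem one_lt_tail_of_lt_envelopeThreshold (hs : Summable fun x => (f x : ℝ)) {k : ℕ} (hk : 1 ≤ k)
    (h : k < envelopeThreshold f) : 1 < ∑' x : ℕ+, if k ≤ (x : ℕ) then (f x : ℝ) else 0 := by
  have := Nat.notMem_of_lt_sInf h
  simp only [Set.mem_ofPred_eq, not_and, not_le] at this
  by_contra hcon
  exact absurd ((ennreal_tail_le_one_iff hs k).2 (not_lt.1 hcon)) (not_le.2 (this hk))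

theorem envelopeMass_eq (f : ℕ+ → ℝ≥0) (x : ℕ+) : envelopeMass f x =
    (if envelopeThreshold f ≤ (x : ℕ) then (f x : ℝ) else 0) +
      if (x : ℕ) + 1 = envelopeThreshold f then
        1 - ∑' y : ℕ+, if envelopeThreshold f ≤ (y : ℕ) then (f y : ℝ) else 0 else 0 := by
  unfold envelopeMass
  rw [tail_tsum_eq (fun y => (f y : ℝ))]
  split_ifs with h1 h2
  · omega
  · simp
  · simp
  · simp

theorem envelopeTail_of_le {k : ℕ} (h : envelopeThreshold f ≤ k) :
    envelopeTail f k = ∑' x : ℕ+, if k ≤ (x : ℕ) then (f x : ℝ) else 0 := by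
  unfold envelopeTail
  rw [tail_tsum_eq]
  refine tsum_congr fun x => ?_
  split_ifs with hx
  · rw [envelopeMass, if_pos (h.trans hx)]
  · rfl

/-- All the mass sits at `τ - 1` and above. In consequence a tail below `1 / n ≤ 1` can only begin
at `τ` or later, where the envelope mass is `f` itself. -/
theorem envelopeTail_of_lt (hs : Summable fun x => (f x : ℝ)) {k : ℕ} (hk : 1 ≤ k)
    (h : k < envelopeThreshold f) : envelopeTail f k = 1 := by
  unfold envelopeTail
  rw [tail_tsum_eq]
  set τ := envelopeThreshold f with hτ
  set x₀ : ℕ+ := ⟨τ - 1, by omega⟩ with hx₀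
  have hx₀' : (x₀ : ℕ) = τ - 1 := rfl
  have : ∀ x : ℕ+, (if k ≤ (x : ℕ) then envelopeMass f x else 0) =
      (if τ ≤ (x : ℕ) then (f x : ℝ) else 0) +
        if x = x₀ then 1 - ∑' y : ℕ+, (if τ ≤ (y : ℕ) then (f y : ℝ) else 0) else 0 := by
    intro x
    rw [envelopeMass_eq, ← hτ]
    by_cases hx : x = x₀
    · subst hx
      rw [if_pos (by omega), if_pos rfl, if_neg (by omega), if_pos (by omega)]
    · have hx' : (x : ℕ) ≠ τ - 1 := fun h => hx (PNat.eq (h.trans hx₀'.symm))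
      rw [if_neg hx, if_neg (show ¬ ((x : ℕ) + 1 = τ) by omega)]
      split_ifs <;> first | rfl | (exfalso; omega) | simp
  simp_rw [this]
  rw [tsum_add_single (summable_tail (fun x => NNReal.coe_nonneg (f x)) hs τ)]
  ring

/-- The envelope distribution, when the envelope has mass at least one. -/
theorem exists_envelope_distribution (hs : Summable fun x => (f x : ℝ))
    (h1 : 1 ≤ ∑' x, (f x : ℝ)) :
    ∃ μ ∈ envelopeFamily f, ∀ x : ℕ+, envelopeThreshold f ≤ (x : ℕ) → μ x = f x := by
  obtain ⟨hτ1, hτ⟩ := envelopeThreshold_spec hs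
  have hmass0 : ∀ x, 0 ≤ envelopeMass f x := by
    intro x
    rw [envelopeMass_eq]
    refine add_nonneg (by split_ifs <;> simp) ?_
    split_ifs
    · linarith
    · rfl
  have hall : ∀ g : ℕ+ → ℝ, ∀ x : ℕ+, (if 1 ≤ (x : ℕ) then g x else 0) = g x := fun g x =>
    if_pos x.2
  have hsum : Summable (envelopeMass f) ∧ ∑' x, envelopeMass f x = 1 := by
    rcases hτ1.eq_or_lt with h | h
    · have hm : envelopeMass f = fun x => (f x : ℝ) := by
        funext x
        rw [envelopeMass, ← h, if_pos (show 1 ≤ (x : ℕ) from x.2)]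
      rw [hm]
      rw [← h] at hτ
      simp only [hall (fun x => (f x : ℝ))] at hτ
      exact ⟨hs, le_antisymm hτ h1⟩
    · have ht := envelopeTail_of_lt hs le_rfl h
      unfold envelopeTail at ht
      rw [tail_tsum_eq] at ht
      simp only [hall] at ht
      refine ⟨?_, ht⟩
      by_contra hcon
      rw [tsum_eq_zero_of_not_summable hcon] at ht
      exact zero_ne_one ht
  have hle : ∀ x, envelopeMass f x ≤ f x := by
    intro x
    rw [envelopeMass_eq]
    by_cases hx : envelopeThreshold f ≤ (x : ℕ)
    · rw [if_pos hx, if_neg (by omega), add_zero]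
    rw [if_neg hx, zero_add]
    split_ifs with hx2
    · have hlt := one_lt_tail_of_lt_envelopeThreshold hs (k := (x : ℕ)) x.2 (by omega)
      have hsplit : (∑' y : ℕ+, if (x : ℕ) ≤ (y : ℕ) then (f y : ℝ) else 0) =
          (∑' y : ℕ+, if envelopeThreshold f ≤ (y : ℕ) then (f y : ℝ) else 0) + f x := by
        rw [← tsum_add_single (summable_tail (fun x => NNReal.coe_nonneg (f x)) hs _) x]
        refine tsum_congr fun y => ?_
        by_cases hy : y = x
        · subst hy; simp [hx]
        · have : (y : ℕ) ≠ x := fun h => hy (PNat.eq h)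
          rw [if_neg hy, add_zero]
          exact if_congr (by omega) rfl rfl
      linarith
    · exact (f x).2
  set μ : PMF ℕ+ := ⟨fun x => ENNReal.ofReal (envelopeMass f x), by
    have := ENNReal.ofReal_tsum_of_nonneg hmass0 hsum.1
    rw [hsum.2, ENNReal.ofReal_one] at this
    rw [this]
    exact ENNReal.summable.hasSum⟩ with hμ
  refine ⟨μ, fun x => ?_, fun x hx => ?_⟩
  · change ENNReal.ofReal (envelopeMass f x) ≤ _
    rw [← ENNReal.ofReal_coe_nnreal]
    exact ENNReal.ofReal_le_ofReal (hle x)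
  · change ENNReal.ofReal (envelopeMass f x) = _
    rw [envelopeMass, if_pos hx, ENNReal.ofReal_coe_nnreal]

end Threshold

/-! ### Information content of the tail -/

theorem infoTerm_nonneg {p : ℝ} (h0 : 0 ≤ p) (h1 : p ≤ 1) : 0 ≤ infoTerm p := by
  rcases h0.eq_or_lt with h | h
  · simp [infoTerm, ← h]
  · exact mul_nonneg h0 (Real.logb_nonneg (by norm_num) (by rw [le_div_iff₀ h]; linarith))

theorem infoTerm_pos {p : ℝ} (h0 : 0 < p) (h1 : p < 1) : 0 < infoTerm p :=
  mul_pos h0 (Real.logb_pos (by norm_num) (by rw [lt_div_iff₀ h0]; linarith))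

theorem infoTerm_le_two {p : ℝ} (h0 : 0 < p) : infoTerm p ≤ 2 := by
  unfold infoTerm
  rw [Real.logb, mul_div_assoc', div_le_iff₀ (Real.log_pos (by norm_num))]
  have h2 := Real.log_le_sub_one_of_pos (show 0 < 1 / p by positivity)
  have h3 : p * Real.log (1 / p) ≤ 1 - p := by
    calc p * Real.log (1 / p) ≤ p * (1 / p - 1) := mul_le_mul_of_nonneg_left h2 h0.le
      _ = 1 - p := by field_simp
  linarith [Real.log_two_gt_d9]

/-- Write `log (1 / p) = log n + log (1 / (n p))`; the first part is weighted by `n p < 1`, and the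
second is `infoTerm (n p)`, which is bounded. -/
theorem mul_infoTerm_le {n : ℕ} (hn : 1 ≤ n) {p : ℝ} (h0 : 0 ≤ p) (h1 : p < 1 / n) :
    n * infoTerm p ≤ Real.logb 2 n + 2 := by
  have hn' : (1 : ℝ) ≤ n := by exact_mod_cast hn
  have hl : 0 ≤ Real.logb 2 n := Real.logb_nonneg (by norm_num) hn'
  rcases h0.eq_or_lt with h | h
  · subst h; simp [infoTerm]; linarith
  have hnp : n * p < 1 := by rw [lt_div_iff₀ (by linarith)] at h1; linarith
  have hnp0 : 0 < n * p := by positivity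
  have h2 := infoTerm_le_two hnp0
  have : (n : ℝ) * infoTerm p = n * p * Real.logb 2 n + infoTerm (n * p) := by
    unfold infoTerm
    rw [show (1 / p : ℝ) = n * (1 / (n * p)) by field_simp,
      Real.logb_mul (by positivity) (by positivity)]
    ring
  rw [this]
  nlinarith

/-- The envelope distribution belongs to the family and equals `f` from the threshold on, so its
finite entropy dominates the series. -/
theorem summable_infoTerm_tail {f : ℕ+ → ℝ≥0} (hs : Summable fun x => (f x : ℝ))
    (h1 : 1 ≤ ∑' x, (f x : ℝ)) (hent : envelopeFamily f ⊆ finiteEntropy) :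
    Summable fun x : ℕ+ => if envelopeThreshold f ≤ (x : ℕ) then infoTerm (f x) else 0 := by
  obtain ⟨μ, hμ, hμf⟩ := exists_envelope_distribution hs h1
  have hfin := hent hμ
  change entropy μ < ∞ at hfin
  have hμ1 : ∀ x, (μ x).toReal ≤ 1 := fun x => by
    simpa using ENNReal.toReal_mono (by simp) (μ.coe_le_one x)
  refine Summable.of_nonneg_of_le (fun x => ?_) (fun x => ?_)
    (ENNReal.summable_toReal hfin.ne)
  · split_ifs with h
    · have := hμ1 x
      rw [hμf x h] at this
      exact infoTerm_nonneg (f x).coe_nonneg this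
    · rfl
  · split_ifs with h
    · rw [hμf x h]
      simp only [ENNReal.coe_toReal]
      rw [ENNReal.toReal_ofReal]
      have := hμ1 x
      rw [hμf x h] at this
      exact infoTerm_nonneg (f x).coe_nonneg this
    · exact ENNReal.toReal_nonneg

/-- The tail-regularity condition as a uniform bound. -/
theorem exists_infoTerm_tail_le {f : ℕ+ → ℝ≥0} (hs : Summable fun x => (f x : ℝ))
    (h1 : 1 ≤ ∑' x, (f x : ℝ)) (hent : envelopeFamily f ⊆ finiteEntropy) (htail : TailRegular f) :
    ∃ C : ℝ, 0 ≤ C ∧ ∀ k : ℕ, envelopeThreshold f ≤ k →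
      (∑' x : ℕ+, if k ≤ (x : ℕ) then infoTerm (f x) else 0) ≤
        C * (infoTerm (envelopeTail f k) + envelopeTail f k) := by
  obtain ⟨hτ1, hτ⟩ := envelopeThreshold_spec hs
  set τ := envelopeThreshold f with hτdef
  have hf0 : ∀ x, 0 ≤ (f x : ℝ) := fun x => (f x).coe_nonneg
  set p : ℕ → ℝ := fun k => ∑' x : ℕ+, if k ≤ (x : ℕ) then (f x : ℝ) else 0 with hp
  have hp0 : ∀ k, 0 ≤ p k := fun k => tsum_nonneg fun x => by split_ifs <;> simp
  have hfp : ∀ k (x : ℕ+), k ≤ (x : ℕ) → (f x : ℝ) ≤ p k := by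
    intro k x hx
    have := (summable_tail hf0 hs k).le_tsum x (fun y _ => by split_ifs <;> simp)
    rwa [if_pos hx] at this
  have hf1 : ∀ x : ℕ+, τ ≤ (x : ℕ) → (f x : ℝ) ≤ 1 := fun x hx => (hfp τ x hx).trans hτ
  set g : ℕ+ → ℝ := fun x => if τ ≤ (x : ℕ) then infoTerm (f x) else 0 with hg
  have hgs : Summable g := summable_infoTerm_tail hs h1 hent
  have hg0 : ∀ x, 0 ≤ g x := fun x => by
    simp only [hg]
    split_ifs with h
    · exact infoTerm_nonneg (hf0 x) (hf1 x h)
    · rfl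
  set G : ℕ → ℝ := fun k => ∑' x : ℕ+, if k ≤ (x : ℕ) then infoTerm (f x) else 0 with hG
  have hGg : ∀ k, τ ≤ k → G k = ∑' x : ℕ+, if k ≤ (x : ℕ) then g x else 0 := by
    intro k hk
    refine tsum_congr fun x => ?_
    simp only [hg]
    split_ifs with h2 h3
    · rfl
    · omega
    · rfl
  have hpt : ∀ k, τ ≤ k → envelopeTail f k = p k := fun k hk => envelopeTail_of_le hk
  have hGτ : ∀ k, τ ≤ k → G k ≤ G τ := fun k hk => by
    rw [hGg k hk, hGg τ le_rfl]; exact tail_mono hg0 hgs hk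
  have hG0 : 0 ≤ G τ := by
    rw [hGg τ le_rfl]
    exact tsum_nonneg fun x => by split_ifs <;> simp [hg0 x]
  have hGz : ∀ k, τ ≤ k → p k = 0 → G k = 0 := by
    intro k hk h0
    simp only [hG]
    convert tsum_zero with x
    split_ifs with hx
    · have : (f x : ℝ) = 0 := le_antisymm (h0 ▸ hfp k x hx) (hf0 x)
      simp [this, infoTerm]
    · rfl
  obtain ⟨c, hc1, -⟩ : ∃ c : ℝ, limsup (fun k : ℕ =>
      (((∑' i : {i : ℕ+ // k ≤ (i : ℕ)}, infoTerm (f i)) / infoTerm (envelopeTail f k) : ℝ) : EReal))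
      atTop < (c : EReal) ∧ (c : EReal) < ⊤ := EReal.lt_iff_exists_real_btwn.1 htail
  have hev := eventually_lt_of_limsup_lt hc1
  have hp1 : ∀ᶠ k in atTop, p k < 1 := (tendsto_tail hf0 hs).eventually (gt_mem_nhds zero_lt_one)
  obtain ⟨K, hK⟩ := eventually_atTop.1 (hev.and (hp1.and (eventually_ge_atTop τ)))
  -- The limsup governs `k ≥ K`. The finitely many earlier `k` are absorbed by the linear term of
  -- the bound, which is needed because `infoTerm` vanishes where the tail mass is 1.
  refine ⟨max c 0 + ∑ k ∈ Finset.range K, G τ / p k, add_nonneg (le_max_right _ _)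
    (Finset.sum_nonneg fun k _ => div_nonneg hG0 (hp0 k)), fun k hk => ?_⟩
  rw [hpt k hk]
  change G k ≤ _
  have hpk1 : p k ≤ 1 := (tail_mono hf0 hs hk).trans hτ
  have hinf := infoTerm_nonneg (hp0 k) hpk1
  rcases (hp0 k).eq_or_lt with h0 | h0
  · rw [hGz k hk h0.symm, ← h0]; simp [infoTerm]
  have hS : 0 ≤ ∑ k ∈ Finset.range K, G τ / p k :=
    Finset.sum_nonneg fun k _ => div_nonneg hG0 (hp0 k)
  have hm : 0 ≤ max c 0 := le_max_right _ _
  by_cases hkK : K ≤ k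
  · obtain ⟨a1, a2, a3⟩ := hK k hkK
    rw [EReal.coe_lt_coe_iff, tail_tsum_eq (fun i => infoTerm (f i)), hpt k hk,
      div_lt_iff₀ (infoTerm_pos h0 a2)] at a1
    calc G k ≤ c * infoTerm (p k) := a1.le
      _ ≤ max c 0 * infoTerm (p k) := mul_le_mul_of_nonneg_right (le_max_left _ _) hinf
      _ ≤ _ := by
        apply mul_le_mul _ _ hinf (add_nonneg hm hS)
        · linarith
        · linarith
  · have hmem : k ∈ Finset.range K := Finset.mem_range.2 (not_le.1 hkK)
    have := Finset.single_le_sum (f := fun k => G τ / p k)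
      (fun k _ => div_nonneg hG0 (hp0 k)) hmem
    calc G k ≤ G τ / p k * p k := by rw [div_mul_cancel₀ _ h0.ne']; exact hGτ k hk
      _ ≤ (max c 0 + ∑ k ∈ Finset.range K, G τ / p k) * p k :=
        mul_le_mul_of_nonneg_right (by linarith) h0.le
      _ ≤ _ := by
        apply mul_le_mul_of_nonneg_left _ (add_nonneg hm hS)
        linarith

/-! ### Description weights for letters above the quantile -/

theorem hasSum_two_inv_pow_pnat : HasSum (fun a : ℕ+ => ((1 : ℝ) / 2) ^ (a : ℕ)) 1 := by
  have h := hasSum_geometric_two' 1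
  rw [← Equiv.pnatEquivNat.symm.hasSum_iff]
  convert h using 1
  funext n
  simp [pow_succ]
  ring

/-- What the coding theorem uses of the envelope: a subprobability `θ` with which the letters above
the quantile `u` can be described, and the bounds on the expected cost of doing so. -/
theorem exists_tail_weights {f : ℕ+ → ℝ≥0} (hne : (envelopeFamily f).Nonempty)
    (hent : envelopeFamily f ⊆ finiteEntropy) (htail : TailRegular f) :
    ∃ (θ : ℕ+ → ℝ) (C : ℝ), 0 ≤ C ∧ (∀ a, 0 < θ a) ∧ Summable θ ∧ ∑' a, θ a ≤ 1 ∧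
      ∀ n : ℕ, 1 ≤ n → 1 ≤ envelopeQuantile f n ∧ ∀ μ ∈ envelopeFamily f,
        n * (∑' a : ℕ+, if envelopeQuantile f n < (a : ℕ) then μ a else 0) ≤ 1 ∧
        n * (∑' a : ℕ+, if envelopeQuantile f n < (a : ℕ) then
            μ a * ENNReal.ofReal (Real.logb 2 (1 / θ a)) else 0) ≤
          ENNReal.ofReal (C * (Real.logb 2 n + 1)) := by
  have hs : Summable fun x => (f x : ℝ) :=
    NNReal.summable_coe.2 (ENNReal.tsum_coe_ne_top_iff_summable.1 (tsum_envelope_ne_top f hent))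
  have hf0 : ∀ x, 0 ≤ (f x : ℝ) := fun x => (f x).coe_nonneg
  have h1 : 1 ≤ ∑' x, (f x : ℝ) := by
    obtain ⟨μ, hμ⟩ := hne
    have h2 : ∑' x, μ x ≤ ∑' x, (f x : ℝ≥0∞) := ENNReal.tsum_le_tsum hμ
    rw [μ.tsum_coe, ← ENNReal.coe_tsum (NNReal.summable_coe.1 hs)] at h2
    rw [← NNReal.coe_tsum]
    exact_mod_cast h2
  obtain ⟨hτ1, hτ⟩ := envelopeThreshold_spec hs
  obtain ⟨C, hC0, hC⟩ := exists_infoTerm_tail_le hs h1 hent htail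
  set τ := envelopeThreshold f with hτdef
  have hg2 := hasSum_two_inv_pow_pnat
  -- The geometric half keeps every weight positive; the envelope half makes the weight at least `f
  -- a / 2` in the tail, at a price of one bit.
  set θ : ℕ+ → ℝ := fun a => 1 / 2 * (1 / 2) ^ (a : ℕ) + 1 / 2 * if τ ≤ (a : ℕ) then (f a : ℝ) else 0
    with hθ
  have hθs : HasSum θ (1 / 2 * 1 + 1 / 2 * ∑' x : ℕ+, if τ ≤ (x : ℕ) then (f x : ℝ) else 0) :=
    (hg2.mul_left _).add ((summable_tail hf0 hs τ).hasSum.mul_left _)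
  have hθ0 : ∀ a, 0 < θ a := fun a => by
    simp only [hθ]
    split_ifs
    · have := hf0 a; positivity
    · positivity
  refine ⟨θ, 3 * C + 1, by positivity, hθ0, hθs.summable, ?_, fun n hn => ?_⟩
  · rw [hθs.tsum_eq]; linarith
  have hn0 : (0 : ℝ) < n := by exact_mod_cast hn
  have hmem : envelopeQuantile f n ∈ {k : ℕ | 1 ≤ k ∧ envelopeTail f (k + 1) < 1 / (n : ℝ)} := by
    apply Nat.sInf_mem
    have h := (tendsto_tail hf0 hs).eventually (gt_mem_nhds (show (0 : ℝ) < 1 / n by positivity))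
    obtain ⟨K, hK⟩ := eventually_atTop.1 h
    refine ⟨max K τ, le_trans hτ1 (le_max_right _ _), ?_⟩
    rw [envelopeTail_of_le (le_trans (le_max_right K τ) (Nat.le_succ _))]
    exact hK _ (le_trans (le_max_left _ _) (Nat.le_succ _))
  obtain ⟨hu1, hu2⟩ := hmem
  set u := envelopeQuantile f n with hu
  -- Below the threshold the tail equals 1 and cannot be less than `1 / n`.
  have huτ : τ ≤ u + 1 := by
    by_contra hcon
    rw [envelopeTail_of_lt hs (by omega) (not_le.1 hcon), lt_div_iff₀ hn0] at hu2
    have : (1 : ℝ) ≤ n := by exact_mod_cast hn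
    linarith
  have hCu := hC (u + 1) huτ
  set p := envelopeTail f (u + 1) with hp
  have hpe : p = ∑' x : ℕ+, if u + 1 ≤ (x : ℕ) then (f x : ℝ) else 0 := envelopeTail_of_le huτ
  have hp0 : 0 ≤ p := by
    rw [hpe]; exact tsum_nonneg fun x => by split_ifs <;> simp
  have hnp : n * p ≤ 1 := by
    rw [lt_div_iff₀ hn0] at hu2; linarith
  have hsp := summable_tail hf0 hs (u + 1)
  have hf1 : ∀ x : ℕ+, u + 1 ≤ (x : ℕ) → (f x : ℝ) ≤ 1 := by
    intro x hx
    have := (summable_tail hf0 hs τ).le_tsum x (fun y _ => by split_ifs <;> simp)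
    rw [if_pos (huτ.trans hx)] at this
    linarith
  refine ⟨hu1, fun μ hμ => ⟨?_, ?_⟩⟩
  · have hle : (∑' a : ℕ+, if u < (a : ℕ) then μ a else 0) ≤ ENNReal.ofReal p := by
      rw [hpe, ENNReal.ofReal_tsum_of_nonneg (fun x => by split_ifs <;> simp) hsp]
      refine ENNReal.tsum_le_tsum fun a => ?_
      by_cases ha : u < (a : ℕ)
      · rw [if_pos ha, if_pos (show u + 1 ≤ (a : ℕ) from ha), ENNReal.ofReal_coe_nnreal]
        exact hμ a
      · rw [if_neg ha]; exact zero_le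
    calc (n : ℝ≥0∞) * _ ≤ n * ENNReal.ofReal p := by gcongr
      _ = ENNReal.ofReal (n * p) := by
        rw [ENNReal.ofReal_mul hn0.le, ENNReal.ofReal_natCast]
      _ ≤ 1 := by rw [← ENNReal.ofReal_one]; exact ENNReal.ofReal_le_ofReal hnp
  · have hgs := summable_infoTerm_tail hs h1 hent
    have hsi : Summable fun x : ℕ+ => if u + 1 ≤ (x : ℕ) then infoTerm (f x) else 0 := by
      refine Summable.of_nonneg_of_le (fun x => ?_) (fun x => ?_) hgs
      · split_ifs with h
        · exact infoTerm_nonneg (hf0 x) (hf1 x h)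
        · rfl
      · split_ifs with h h2 h2
        · rfl
        · omega
        · have := (summable_tail hf0 hs τ).le_tsum x (fun y _ => by split_ifs <;> simp)
          rw [if_pos h2] at this
          exact infoTerm_nonneg (hf0 x) (this.trans hτ)
        · rfl
    have hi0 : ∀ x : ℕ+, u + 1 ≤ (x : ℕ) → 0 ≤ infoTerm (f x) := fun x hx =>
      infoTerm_nonneg (hf0 x) (hf1 x hx)
    have hle : (∑' a : ℕ+, if u < (a : ℕ) then
        μ a * ENNReal.ofReal (Real.logb 2 (1 / θ a)) else 0) ≤
        ENNReal.ofReal (∑' x : ℕ+, ((if u + 1 ≤ (x : ℕ) then infoTerm (f x) else 0) +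
          if u + 1 ≤ (x : ℕ) then (f x : ℝ) else 0)) := by
      rw [ENNReal.ofReal_tsum_of_nonneg _ (hsi.add hsp)]
      · refine ENNReal.tsum_le_tsum fun a => ?_
        by_cases ha : u < (a : ℕ)
        · rw [if_pos ha, if_pos (show u + 1 ≤ (a : ℕ) from ha),
            if_pos (show u + 1 ≤ (a : ℕ) from ha)]
          rcases (hf0 a).eq_or_lt with h | h
          · have : f a = 0 := by exact_mod_cast h.symm
            have h3 : μ a = 0 := by simpa [this] using hμ a
            rw [h3, zero_mul]; exact zero_le
          · calc μ a * ENNReal.ofReal (Real.logb 2 (1 / θ a))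
                ≤ (f a : ℝ≥0∞) * ENNReal.ofReal (Real.logb 2 (1 / θ a)) := by gcongr; exact hμ a
              _ = ENNReal.ofReal ((f a : ℝ) * Real.logb 2 (1 / θ a)) := by
                rw [ENNReal.ofReal_mul (hf0 a), ENNReal.ofReal_coe_nnreal]
              _ ≤ _ := by
                apply ENNReal.ofReal_le_ofReal
                have hθa : (f a : ℝ) / 2 ≤ θ a := by
                  simp only [hθ]
                  rw [if_pos (huτ.trans ha)]
                  have : (0 : ℝ) < (1 / 2) ^ (a : ℕ) := by positivity
                  linarith
                have h4 : Real.logb 2 (1 / θ a) ≤ Real.logb 2 (1 / f a) + 1 := by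
                  have h5 : Real.logb 2 (1 / f a) + 1 = Real.logb 2 (1 / (f a / 2)) := by
                    rw [show (1 / ((f a : ℝ) / 2)) = 1 / f a * 2 by field_simp,
                      Real.logb_mul (by positivity) (by norm_num), Real.logb_self_eq_one (by norm_num)]
                  rw [h5]
                  apply Real.logb_le_logb_of_le (by norm_num) (by have := hθ0 a; positivity)
                  exact one_div_le_one_div_of_le (by positivity) hθa
                unfold infoTerm
                nlinarith
        · rw [if_neg ha]; exact zero_le
      · intro x
        split_ifs with h
        · exact add_nonneg (hi0 x h) (hf0 x)
        · simp
    rw [Summable.tsum_add hsi hsp, ← hpe] at hle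
    set g : ℝ := ∑' x : ℕ+, if u + 1 ≤ (x : ℕ) then infoTerm (f x) else 0 with hgdef
    calc (n : ℝ≥0∞) * _ ≤ n * ENNReal.ofReal (g + p) := by gcongr
      _ = ENNReal.ofReal (n * (g + p)) := by
        rw [ENNReal.ofReal_mul hn0.le, ENNReal.ofReal_natCast]
      _ ≤ _ := by
        apply ENNReal.ofReal_le_ofReal
        have hl := mul_infoTerm_le hn hp0 hu2
        have hl0 : 0 ≤ Real.logb 2 (n : ℝ) := Real.logb_nonneg (by norm_num) (by exact_mod_cast hn)
        have : (n : ℝ) * g ≤ C * (Real.logb 2 n + 3) := by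
          calc _ ≤ (n : ℝ) * (C * (infoTerm p + p)) := mul_le_mul_of_nonneg_left hCu hn0.le
            _ = C * (n * infoTerm p + n * p) := by ring
            _ ≤ _ := mul_le_mul_of_nonneg_left (by linarith) hC0
        rw [mul_add]
        nlinarith

/-! ### Type classes -/

/-- The type of a block: the multiset of its letters. -/
def typ {n : ℕ} (x : Block n) : Multiset ℕ+ := (Finset.univ : Finset (Fin n)).val.map x

/-- The type class of a block: its rearrangements. -/
def typeClass {n : ℕ} (x : Block n) : Finset (Block n) :=
  open Classical in Finset.univ.image fun σ : Equiv.Perm (Fin n) => x ∘ σ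

theorem typ_comp {n : ℕ} (x : Block n) (σ : Equiv.Perm (Fin n)) : typ (x ∘ σ) = typ x := by
  unfold typ
  rw [← Multiset.map_map]
  congr 1
  simp

theorem exists_perm_of_typ_eq {n : ℕ} {x y : Block n} (h : typ y = typ x) :
    ∃ σ : Equiv.Perm (Fin n), y = x ∘ σ := by
  classical
  have hc : ∀ a, Fintype.card {i // y i = a} = Fintype.card {i // x i = a} := by
    intro a
    have := congrArg (Multiset.count a) h
    simp only [typ, Multiset.count_map] at this
    rw [Fintype.card_subtype, Fintype.card_subtype]
    simpa [Finset.card, Finset.filter, eq_comm] using this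
  refine ⟨Equiv.ofFiberEquiv fun a => Fintype.equivOfCardEq (hc a), ?_⟩
  funext i
  exact (Equiv.ofFiberEquiv_map _ i).symm

theorem mem_typeClass {n : ℕ} {x y : Block n} : y ∈ typeClass x ↔ typ y = typ x := by
  classical
  constructor
  · intro h
    obtain ⟨σ, -, rfl⟩ := Finset.mem_image.1 h
    exact typ_comp x σ
  · intro h
    obtain ⟨σ, rfl⟩ := exists_perm_of_typ_eq h
    exact Finset.mem_image.2 ⟨σ, Finset.mem_univ _, rfl⟩

theorem self_mem_typeClass {n : ℕ} (x : Block n) : x ∈ typeClass x := mem_typeClass.2 rfl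

theorem typeClass_eq {n : ℕ} {x y : Block n} (h : typ y = typ x) : typeClass y = typeClass x := by
  ext z; simp [mem_typeClass, h]

theorem comp_mem_typeClass {n : ℕ} {x y : Block n} (σ : Equiv.Perm (Fin n)) :
    y ∘ σ ∈ typeClass x ↔ y ∈ typeClass x := by simp [mem_typeClass, typ_comp]

theorem typeClass_card_le {n : ℕ} (x : Block n) : (typeClass x).card ≤ n.factorial := by
  classical
  refine Finset.card_image_le.trans ?_
  simp [Fintype.card_perm]

/-- Group the sum by types: `P` is constant on each class and factors out. Classes of probability
zero need no hypothesis. -/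
theorem tsum_mul_le_of_typeClass {n : ℕ} {P F G : Block n → ℝ≥0∞}
    (hP : ∀ x y, typ x = typ y → P x = P y)
    (h : ∀ x₀, P x₀ ≠ 0 → ∑ x ∈ typeClass x₀, F x ≤ ∑ x ∈ typeClass x₀, G x) :
    ∑' x, P x * F x ≤ ∑' x, P x * G x := by
  classical
  rw [← (Equiv.sigmaFiberEquiv (typ (n := n))).tsum_eq (fun x => P x * F x),
    ← (Equiv.sigmaFiberEquiv (typ (n := n))).tsum_eq (fun x => P x * G x),
    ENNReal.tsum_sigma', ENNReal.tsum_sigma']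
  refine ENNReal.tsum_le_tsum fun T => ?_
  simp only [Equiv.sigmaFiberEquiv_apply]
  by_cases hT : ∃ x₀ : Block n, typ x₀ = T
  · obtain ⟨x₀, rfl⟩ := hT
    have key : ∀ H : Block n → ℝ≥0∞, ∑' b : {x : Block n // typ x = typ x₀}, P b.1 * H b.1 =
        P x₀ * ∑ x ∈ typeClass x₀, H x := by
      intro H
      rw [Finset.mul_sum, ← Finset.tsum_subtype (typeClass x₀)]
      rw [← (Equiv.subtypeEquivRight fun x => mem_typeClass (x := x₀)).tsum_eq]
      refine tsum_congr fun b => ?_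
      rw [Equiv.subtypeEquivRight_apply_coe, hP _ _ (mem_typeClass.1 b.2)]
    rw [key, key]
    by_cases h0 : P x₀ = 0
    · simp [h0]
    · exact mul_le_mul' le_rfl (h x₀ h0)
  · have : IsEmpty {x : Block n // typ x = T} := ⟨fun x => hT ⟨x.1, x.2⟩⟩
    simp

/-! ### The law of a memoryless source -/

theorem iidLaw_singleton (μ : PMF ℕ+) {n : ℕ} (x : Block n) :
    iidLaw μ n {x} = ∏ i, μ (x i) := by
  rw [iidLaw, Measure.pi_singleton]
  exact Finset.prod_congr rfl fun i _ => PMF.toMeasure_apply_singleton _ _ (measurableSet_singleton _)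

instance instIsProbabilityMeasureIidLaw (μ : PMF ℕ+) (n : ℕ) : IsProbabilityMeasure (iidLaw μ n) := by
  unfold iidLaw; infer_instance

theorem iidLaw_singleton_eq_of_typ (μ : PMF ℕ+) {n : ℕ} (x y : Block n) (h : typ x = typ y) :
    iidLaw μ n {x} = iidLaw μ n {y} := by
  obtain ⟨σ, rfl⟩ := exists_perm_of_typ_eq h
  rw [iidLaw_singleton, iidLaw_singleton]
  exact Equiv.prod_comp σ fun i => μ (y i)

theorem lintegral_iidLaw (μ : PMF ℕ+) {n : ℕ} (F : Block n → ℝ≥0∞) :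
    ∫⁻ x, F x ∂(iidLaw μ n) = ∑' x, iidLaw μ n {x} * F x := by
  rw [lintegral_countable']
  exact tsum_congr fun x => mul_comm _ _

theorem lintegral_sum_iidLaw (μ : PMF ℕ+) (n : ℕ) (g : ℕ+ → ℝ≥0∞) :
    ∫⁻ x, ∑ i, g (x i) ∂(iidLaw μ n) = n * ∑' a, μ a * g a := by
  have hm : ∀ i : Fin n, Measurable fun x : Block n => g (x i) := fun i =>
    (Measurable.of_discrete (f := g)).comp (measurable_pi_apply i)
  rw [lintegral_finsetSum _ fun i _ => hm i]
  have : ∀ i : Fin n, ∫⁻ x, g (x i) ∂(iidLaw μ n) = ∑' a, μ a * g a := by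
    intro i
    have h := (measurePreserving_eval (fun _ : Fin n => μ.toMeasure) i).lintegral_comp
      (f := g) Measurable.of_discrete
    rw [iidLaw]
    simp only [Function.eval] at h
    rw [h, lintegral_countable']
    refine tsum_congr fun a => ?_
    rw [mul_comm, PMF.toMeasure_apply_singleton _ _ (measurableSet_singleton _)]
  simp [this]

/-! ### Entropy within a type class -/

/-- The members of the type class of `x` with the same image under `ψ`. -/
noncomputable def classCell {n : ℕ} {β : Type*} (ψ : Block n → β) (x : Block n) : Finset (Block n) :=
  open Classical in (typeClass x).filter fun y => ψ y = ψ x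

/-- The self-information, in bits, of `ψ` at `x` under the uniform law on the type class. -/
noncomputable def classInfo {n : ℕ} {β : Type*} (ψ : Block n → β) (x : Block n) : ℝ :=
  Real.logb 2 ((typeClass x).card / (classCell ψ x).card)

theorem self_mem_classCell {n : ℕ} {β : Type*} (ψ : Block n → β) (x : Block n) :
    x ∈ classCell ψ x := by
  classical
  exact Finset.mem_filter.2 ⟨self_mem_typeClass x, rfl⟩

theorem classCell_card_pos {n : ℕ} {β : Type*} (ψ : Block n → β) (x : Block n) :
    0 < (classCell ψ x).card := Finset.card_pos.2 ⟨x, self_mem_classCell ψ x⟩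

theorem classCell_card_le {n : ℕ} {β : Type*} (ψ : Block n → β) (x : Block n) :
    (classCell ψ x).card ≤ (typeClass x).card := by
  classical
  exact Finset.card_le_card (Finset.filter_subset _ _)

theorem classInfo_nonneg {n : ℕ} {β : Type*} (ψ : Block n → β) (x : Block n) :
    0 ≤ classInfo ψ x := by
  have h := classCell_card_pos ψ x
  have h' : (0 : ℝ) < (classCell ψ x).card := by exact_mod_cast h
  refine Real.logb_nonneg (by norm_num) ?_
  rw [le_div_iff₀ h', one_mul]
  exact_mod_cast classCell_card_le ψ x

theorem classInfo_congr {n : ℕ} {β : Type*} {ψ ψ' : Block n → β} {x : Block n}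
    (h : ∀ y ∈ typeClass x, ψ y = ψ' y) : classInfo ψ x = classInfo ψ' x := by
  classical
  have : classCell ψ x = classCell ψ' x := by
    refine Finset.filter_congr fun y hy => ?_
    rw [h y hy, h x (self_mem_typeClass x)]
  rw [classInfo, classInfo, this]

/-- Gibbs' inequality on a type class. -/
theorem sum_classInfo_le {n : ℕ} {β : Type*} (A : Block n → β) (q : β → ℝ) (x₀ : Block n)
    (hq : ∀ x ∈ typeClass x₀, 0 < q (A x))
    (hsum : open Classical in ∑ b ∈ (typeClass x₀).image A, q b ≤ 1) :
    ∑ x ∈ typeClass x₀, classInfo A x ≤ ∑ x ∈ typeClass x₀, Real.logb 2 (1 / q (A x)) := by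
  classical
  rw [← sub_nonpos, ← Finset.sum_sub_distrib]
  set N : ℝ := ((typeClass x₀).card : ℝ) with hN
  have hN0 : 0 < N := by
    rw [hN]; exact_mod_cast Finset.card_pos.2 ⟨x₀, self_mem_typeClass x₀⟩
  have hl2 : 0 < Real.log 2 := Real.log_pos (by norm_num)
  -- This is `log z ≤ z - 1`. Summed over a cell, the right side yields `N * q` of that cell, so the
  -- weights being a subprobability closes the estimate.
  have hpt : ∀ x ∈ typeClass x₀, classInfo A x - Real.logb 2 (1 / q (A x)) ≤
      (N * (q (A x) / (classCell A x).card) - 1) / Real.log 2 := by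
    intro x hx
    have hc : (0 : ℝ) < (classCell A x).card := by exact_mod_cast classCell_card_pos A x
    have hqx := hq x hx
    rw [classInfo, typeClass_eq (mem_typeClass.1 hx), ← hN, ← Real.logb_div (by positivity)
      (by positivity), Real.logb]
    apply div_le_div_of_nonneg_right _ hl2.le
    have := Real.log_le_sub_one_of_pos
      (show 0 < N / (classCell A x).card / (1 / q (A x)) by positivity)
    rw [show N * (q (A x) / (classCell A x).card) = N / (classCell A x).card / (1 / q (A x)) by
      rw [one_div, div_inv_eq_mul]; ring]
    exact this
  refine (Finset.sum_le_sum hpt).trans ?_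
  rw [← Finset.sum_div]
  apply div_nonpos_of_nonpos_of_nonneg _ hl2.le
  rw [Finset.sum_sub_distrib, ← Finset.mul_sum]
  have hcell : ∑ x ∈ typeClass x₀, q (A x) / (classCell A x).card =
      ∑ b ∈ (typeClass x₀).image A, q b := by
    rw [← Finset.sum_fiberwise_of_maps_to (g := A) (fun x hx => Finset.mem_image_of_mem A hx)]
    refine Finset.sum_congr rfl fun b hb => ?_
    obtain ⟨y, hy, rfl⟩ := Finset.mem_image.1 hb
    have : ∀ x ∈ (typeClass x₀).filter (fun x => A x = A y),
        q (A x) / (classCell A x).card = q (A y) / (classCell A y).card := by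
      intro x hx
      obtain ⟨hx1, hx2⟩ := Finset.mem_filter.1 hx
      have : classCell A x = classCell A y := by
        unfold classCell
        rw [hx2, typeClass_eq ((mem_typeClass.1 hx1).trans (mem_typeClass.1 hy).symm)]
      rw [hx2, this]
    rw [Finset.sum_congr rfl this, Finset.sum_const]
    have h2 : (typeClass x₀).filter (fun x => A x = A y) = classCell A y := by
      unfold classCell
      rw [typeClass_eq (mem_typeClass.1 hy)]
    rw [h2, nsmul_eq_mul]
    have hc : ((classCell A y).card : ℝ) ≠ 0 := by exact_mod_cast (classCell_card_pos A y).ne'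
    field_simp
  rw [hcell, Finset.sum_const, nsmul_eq_mul, mul_one, ← hN]
  nlinarith

/-- A selection of near-optimal coverings of the type classes. -/
theorem exists_near_optimal {n : ℕ} (adm : Block n → Block n → Prop) (hadm : ∀ x, adm x x) :
    ∃ ψ : Block n → Block n, (∀ x, adm x (ψ x)) ∧ ∀ g : Block n → Block n, (∀ x, adm x (g x)) →
      ∀ x₀, ∑ x ∈ typeClass x₀, classInfo ψ x ≤ ∑ x ∈ typeClass x₀, (classInfo g x + 1) := by
  have key : ∀ T : Multiset ℕ+, ∃ ψ : Block n → Block n, (∀ x, adm x (ψ x)) ∧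
      ∀ g : Block n → Block n, (∀ x, adm x (g x)) →
      ∀ x₀, typ x₀ = T →
        ∑ x ∈ typeClass x₀, classInfo ψ x ≤ ∑ x ∈ typeClass x₀, (classInfo g x + 1) := by
    intro T
    by_cases hT : ∃ x₁ : Block n, typ x₁ = T
    · obtain ⟨x₁, rfl⟩ := hT
      set S : Set ℝ := {s | ∃ g : Block n → Block n, (∀ x, adm x (g x)) ∧
        s = ∑ x ∈ typeClass x₁, classInfo g x} with hS
      have hne : S.Nonempty := ⟨_, id, hadm, rfl⟩
      have hbd : BddBelow S := ⟨0, by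
        rintro s ⟨g, -, rfl⟩; exact Finset.sum_nonneg fun x _ => classInfo_nonneg g x⟩
      -- A loss of one bit in the whole class sum suffices to come near the infimum; it is charged
      -- as one bit per member.
      obtain ⟨s, ⟨ψ, hψ, rfl⟩, hs⟩ := exists_lt_of_csInf_lt hne (lt_add_one (sInf S))
      refine ⟨ψ, hψ, fun g hg x₀ hx₀ => ?_⟩
      rw [typeClass_eq hx₀]
      have h1 : sInf S ≤ ∑ x ∈ typeClass x₁, classInfo g x := csInf_le hbd ⟨g, hg, rfl⟩
      rw [Finset.sum_add_distrib]
      have h2 : (1 : ℝ) ≤ ∑ x ∈ typeClass x₁, (1 : ℝ) := by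
        simp only [Finset.sum_const, nsmul_eq_mul, mul_one]
        exact_mod_cast Finset.card_pos.2 ⟨x₁, self_mem_typeClass x₁⟩
      linarith
    · exact ⟨id, hadm, fun g _ x₀ hx₀ => (hT ⟨x₀, hx₀⟩).elim⟩
  choose Ψ h1 h2 using key
  refine ⟨fun x => Ψ (typ x) x, fun x => h1 _ x, fun g hg x₀ => ?_⟩
  refine le_trans (le_of_eq (Finset.sum_congr rfl fun x hx => ?_)) (h2 (typ x₀) g hg x₀ rfl)
  refine classInfo_congr fun y hy => ?_
  rw [mem_typeClass.1 hy, mem_typeClass.1 hx]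

/-! ### The benchmark -/

/-- Inside a cell the masses of the points add up to the mass of the cell, which reproduces
`infoTerm`. An injection into pairs (cell, member) suffices since only one inequality is needed. -/
theorem tsum_cellInfo_le_partitionEntropy {n : ℕ} (P : Measure (Block n)) [IsProbabilityMeasure P]
    {π : Set (Set (Block n))} (cell : Block n → Set (Block n)) (hcell : ∀ x, cell x ∈ π)
    (hmem : ∀ x, x ∈ cell x) :
    ∑' x, P {x} * ENNReal.ofReal (Real.logb 2 (1 / P.real (cell x))) ≤ partitionEntropy P π := by
  classical
  set h : (Σ A : π, (A : Set (Block n))) → ℝ≥0∞ := fun q =>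
    P {(q.2 : Block n)} * ENNReal.ofReal (Real.logb 2 (1 / P.real (q.1 : Set (Block n)))) with hh
  have hinj : Function.Injective
      (fun x : Block n => (⟨⟨cell x, hcell x⟩, ⟨x, hmem x⟩⟩ : Σ A : π, (A : Set (Block n)))) := by
    intro x y hxy
    have := congrArg (fun q : (Σ A : π, (A : Set (Block n))) => (q.2 : Block n)) hxy
    exact this
  have := ENNReal.tsum_comp_le_tsum_of_injective hinj h
  refine this.trans ?_
  rw [ENNReal.tsum_sigma']
  unfold partitionEntropy
  refine ENNReal.tsum_le_tsum fun A => ?_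
  simp only [hh]
  rw [ENNReal.tsum_mul_right]
  have hPA : ∑' x : (A : Set (Block n)), P {(x : Block n)} = P (A : Set (Block n)) := by
    have := measure_biUnion (μ := P) (Set.to_countable (A : Set (Block n)))
      (f := fun x => {x}) (by
        intro x _ y _ hxy
        simpa using hxy) (fun x _ => measurableSet_singleton x)
    simpa using this.symm
  rw [hPA, infoTerm, ENNReal.ofReal_mul measureReal_nonneg]
  rw [ofReal_measureReal]

/-- A centre lies in its own cell, so the centre determines the cell, and the map to centres induces
the same partition. -/
theorem exists_cells {n : ℕ} {ρ : ℕ+ → ℕ+ → ℝ} {d : ℝ} {π : Set (Set (Block n))}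
    (hπ : π ∈ coveringPartitions ρ d n) :
    ∃ cell : Block n → Set (Block n), ∃ g : Block n → Block n, (∀ x, cell x ∈ π) ∧
      (∀ x, x ∈ cell x) ∧ (∀ x y, g x = g y ↔ cell x = cell y) ∧
      (∀ x y, cell x ≠ cell y → Disjoint (cell x) (cell y)) ∧
      ∀ x, blockDistortion ρ x (g x) ≤ d := by
  obtain ⟨⟨h0, h1⟩, h2⟩ := hπ
  choose cell hcell huniq using h1
  choose! c hc1 hc2 using h2
  have hdis : ∀ x A, A ∈ π → x ∈ A → A = cell x := fun x A hA hx => huniq x A ⟨hA, hx⟩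
  refine ⟨cell, fun x => c (cell x), fun x => (hcell x).1, fun x => (hcell x).2, fun x y => ?_,
    fun x y hxy => ?_, fun x => ?_⟩
  · constructor
    · intro h
      have a1 := hc1 _ (hcell x).1
      have a2 := hc1 _ (hcell y).1
      simp only at h
      rw [h] at a1
      exact (hdis _ _ (hcell x).1 a1).trans (hdis _ _ (hcell y).1 a2).symm
    · intro h; simp only [h]
  · rw [Set.disjoint_left]
    intro z hz1 hz2
    exact hxy ((hdis z _ (hcell x).1 hz1).trans (hdis z _ (hcell y).1 hz2).symm)
  · exact hc2 _ (hcell x).1 x (hcell x).2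

/-- A per-class comparison with all coverings yields a comparison with the benchmark. -/
theorem rate_le_of_class_bound {n : ℕ} {ρ : ℕ+ → ℕ+ → ℝ} {d : ℝ} (ξ : Code ρ d n)
    (c : Block n → ℝ) (hc : ∀ x, 0 ≤ c x)
    (h : ∀ g : Block n → Block n, (∀ x, blockDistortion ρ x (g x) ≤ d) → ∀ x₀,
      ∑ x ∈ typeClass x₀, (ξ.length x : ℝ) ≤ ∑ x ∈ typeClass x₀, (classInfo g x + c x))
    (μ : PMF ℕ+) :
    ξ.rate (iidLaw μ n) ≤ benchmarkRate ρ d (iidLaw μ n) +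
      (∫⁻ x, ENNReal.ofReal (c x) ∂(iidLaw μ n)) / n := by
  classical
  set P := iidLaw μ n with hP
  unfold Code.rate benchmarkRate
  rw [← ENNReal.add_div]
  apply ENNReal.div_le_div_right
  rw [ENNReal.iInf_add]
  refine le_iInf fun π => ?_
  rw [ENNReal.iInf_add]
  refine le_iInf fun hπ => ?_
  obtain ⟨cell, g, hc1, hc2, hc3, hc4, hc5⟩ := exists_cells hπ
  refine le_trans ?_ (add_le_add_left (tsum_cellInfo_le_partitionEntropy P cell hc1 hc2) _)
  rw [lintegral_iidLaw, lintegral_iidLaw, ← ENNReal.tsum_add]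
  simp_rw [← hP, ← mul_add]
  refine tsum_mul_le_of_typeClass (iidLaw_singleton_eq_of_typ μ) fun x₀ hx₀ => ?_
  have hpos : ∀ x ∈ typeClass x₀, 0 < P.real (cell x) := by
    intro x hx
    have h1 : P {x} ≠ 0 := by
      rw [hP, iidLaw_singleton_eq_of_typ μ x x₀ (mem_typeClass.1 hx)]; exact hx₀
    have h2 : P (cell x) ≠ 0 := fun h0 =>
      h1 (measure_mono_null (Set.singleton_subset_iff.2 (hc2 x)) h0)
    exact ENNReal.toReal_pos h2 (measure_ne_top _ _)
  have hinfo : ∀ x, classInfo g x = classInfo cell x := by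
    intro x
    have : classCell g x = classCell cell x := by
      ext y
      simp [classCell, hc3]
    rw [classInfo, classInfo, this]
  have hle : ∀ x ∈ typeClass x₀, 0 ≤ Real.logb 2 (1 / P.real (cell x)) := fun x hx =>
    Real.logb_nonneg (by norm_num) (by
      rw [le_div_iff₀ (hpos x hx), one_mul]; exact measureReal_le_one)
  -- The cells met by the class are disjoint, so their `P`-masses are admissible weights in Gibbs'
  -- inequality.
  have hgibbs := sum_classInfo_le cell (fun A => P.real A) x₀ hpos (by
    have hdisj : Set.PairwiseDisjoint (↑((typeClass x₀).image cell)) (id : Set (Block n) → _) := by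
      intro A hA B hB hAB
      obtain ⟨x, -, rfl⟩ := Finset.mem_image.1 (Finset.mem_coe.1 hA)
      obtain ⟨y, -, rfl⟩ := Finset.mem_image.1 (Finset.mem_coe.1 hB)
      exact hc4 x y hAB
    have := sum_measureReal_le_measureReal_univ (μ := P) (s := (typeClass x₀).image cell)
      (t := id) (fun A _ => (Set.to_countable A).measurableSet) hdisj
    simp only [id, probReal_univ] at this
    convert this)
  have h1 := h g hc5 x₀
  have h2 : ∑ x ∈ typeClass x₀, (ξ.length x : ℝ) ≤
      ∑ x ∈ typeClass x₀, (Real.logb 2 (1 / P.real (cell x)) + c x) := by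
    rw [Finset.sum_add_distrib] at h1 ⊢
    rw [Finset.sum_congr rfl fun x _ => hinfo x] at h1
    linarith
  have h3 := ENNReal.ofReal_le_ofReal h2
  rw [ENNReal.ofReal_sum_of_nonneg (fun x _ => by positivity),
    ENNReal.ofReal_sum_of_nonneg (fun x hx => add_nonneg (hle x hx) (hc x))] at h3
  simp only [ENNReal.ofReal_natCast] at h3
  refine h3.trans (le_of_eq (Finset.sum_congr rfl fun x hx => ?_))
  rw [ENNReal.ofReal_add (hle x hx) (hc x)]

/-! ### A position-dependent hash -/

/-- Nine `𝔽₂`-valued linear hashes of a block. A position belongs to at most one channel; it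
contributes a bit of its letter times a vector. Letters above `u` are identified. -/
structure PositionHash (n κ u : ℕ) where
  /-- the channel of a position -/
  channel : Fin n → Option (Fin 9)
  /-- the bit that a position extracts from its letter -/
  bit : Fin n → ℕ+ → ZMod 2
  /-- the vector of a position -/
  vec : Fin n → ℕ → ZMod 2
  /-- the vectors can be translated by permuting positions -/
  translate : ∀ c : Fin 9 → ℕ → ZMod 2, ∃ τ : Equiv.Perm (Fin n),
    (∀ p, channel (τ p) = channel p) ∧ (∀ p, bit (τ p) = bit p) ∧
      ∀ p l, channel p = some l → ∀ i < κ, vec (τ p) i = vec p i + c l i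
  /-- every pair of letters is separated at many positions of every channel and vector prefix -/
  count : ∀ k ≤ κ, ∀ (l : Fin 9) (r : Fin k → ZMod 2) (a b : ℕ+),
    min (a : ℕ) (u + 1) ≠ min (b : ℕ) (u + 1) →
      n ≤ 72 * 2 ^ k * (Finset.univ.filter fun p =>
        channel p = some l ∧ bit p a ≠ bit p b ∧ ∀ i : Fin k, vec p i = r i).card

theorem zmod_two_eq_add_one {a b : ZMod 2} (h : a ≠ b) : a = b + 1 := by
  revert a b; decide

theorem zmod_two_eq_zero_or_one (a : ZMod 2) : a = 0 ∨ a = 1 := by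
  revert a; decide

/-- Flipping a coordinate where `w` is 1 exchanges the zeros and the nonzeros of the linear form. -/
theorem two_mul_card_dotProduct_ne_zero {m : ℕ} {w : Fin m → ZMod 2} (hw : w ≠ 0) :
    2 ^ m = 2 * (Finset.univ.filter fun v : Fin m → ZMod 2 => dotProduct v w ≠ 0).card := by
  obtain ⟨j, hj⟩ := Function.ne_iff.1 hw
  have hj1 : w j = 1 := (zmod_two_eq_zero_or_one _).resolve_left hj
  have hflip : ∀ v : Fin m → ZMod 2, dotProduct (v + Pi.single j 1) w = dotProduct v w + 1 := by
    intro v; rw [add_dotProduct, single_dotProduct, hj1, one_mul]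
  have h2 : ∀ v : Fin m → ZMod 2, v + Pi.single j 1 + Pi.single j 1 = v := by
    intro v
    funext i
    rw [Pi.add_apply, Pi.add_apply, add_assoc, CharTwo.add_self_eq_zero, add_zero]
  have hcard : (Finset.univ.filter fun v : Fin m → ZMod 2 => ¬ dotProduct v w ≠ 0).card =
      (Finset.univ.filter fun v : Fin m → ZMod 2 => dotProduct v w ≠ 0).card := by
    refine Finset.card_bij' (fun v _ => v + Pi.single j 1) (fun v _ => v + Pi.single j 1) ?_ ?_
      (fun v _ => h2 v) (fun v _ => h2 v)
    · intro v hv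
      simp only [Finset.mem_filter, Finset.mem_univ, true_and, ne_eq, not_not] at hv ⊢
      rw [hflip, hv]; decide
    · intro v hv
      simp only [Finset.mem_filter, Finset.mem_univ, true_and, ne_eq, not_not] at hv ⊢
      rw [hflip, (zmod_two_eq_zero_or_one _).resolve_left hv]; decide
  have := Finset.card_filter_add_card_filter_not (s := (Finset.univ : Finset (Fin m → ZMod 2)))
    (fun v => dotProduct v w ≠ 0)
  rw [hcard, Finset.card_univ, Fintype.card_fun, ZMod.card, Fintype.card_fin] at this
  omega

/-- A vector is recovered from its prefix together with the vector whose prefix has been overwritten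
by `r`. -/
theorem two_pow_le_card_prefix {κ k : ℕ} (hk : k ≤ κ) (r : Fin k → ZMod 2) :
    2 ^ κ ≤ 2 ^ k * (Finset.univ.filter fun g : Fin κ → ZMod 2 =>
      ∀ i : Fin k, g (Fin.castLE hk i) = r i).card := by
  classical
  have : Fintype.card (Fin κ → ZMod 2) ≤ ((Finset.univ : Finset (Fin k → ZMod 2)) ×ˢ
      (Finset.univ.filter fun g : Fin κ → ZMod 2 =>
        ∀ i : Fin k, g (Fin.castLE hk i) = r i)).card := by
    rw [← Finset.card_univ]
    refine Finset.card_le_card_of_injOn (fun g => (fun i => g (Fin.castLE hk i),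
      fun j => if h : (j : ℕ) < k then r ⟨j, h⟩ else g j)) ?_ ?_
    · intro g _
      simp
    · intro g _ g' _ h
      simp only [Prod.mk.injEq] at h
      funext j
      by_cases hj : (j : ℕ) < k
      · exact congrFun h.1 ⟨j, hj⟩
      · have := congrFun h.2 j
        simpa [hj] using this
  rwa [Finset.card_product, Finset.card_univ, Fintype.card_fun, Fintype.card_fun, ZMod.card,
    Fintype.card_fin, Fintype.card_fin] at this

/-- Letters become pairs of vectors of length `m`, and a bit is a linear form of one member of the
pair. Distinct letters differ in one member, where half of the forms separate them, hence a quarter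
overall. Splitting into pairs keeps the number of forms near `√n` instead of `n`. -/
theorem exists_letter_code {n m : ℕ} (h : n < 2 ^ (m * 2)) (u : ℕ) (hu : u + 1 ≤ n) :
    ∃ (E : Type) (_ : Fintype E) (bit : E → ℕ+ → ZMod 2), Fintype.card E = 2 * 2 ^ m ∧
      ∀ a b : ℕ+, min (a : ℕ) (u + 1) ≠ min (b : ℕ) (u + 1) →
        Fintype.card E ≤ 4 * (Finset.univ.filter fun e => bit e a ≠ bit e b).card := by
  classical
  obtain ⟨ι⟩ : Nonempty (Fin (n + 1) ↪ (Fin 2 → Fin m → ZMod 2)) := by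
    apply Function.Embedding.nonempty_of_card_le
    simp only [Fintype.card_fin, Fintype.card_fun, ZMod.card]
    rw [← pow_mul]; omega
  set φ : ℕ+ → Fin 2 → Fin m → ZMod 2 := fun a => ι ⟨min (a : ℕ) (u + 1), by omega⟩ with hφ
  refine ⟨Fin 2 × (Fin m → ZMod 2), inferInstance, fun e a => dotProduct e.2 (φ a e.1), by simp,
    fun a b hab => ?_⟩
  have hne : φ a ≠ φ b := fun h => hab (by simpa using ι.injective h)
  obtain ⟨s, hs⟩ := Function.ne_iff.1 hne
  have h1 := two_mul_card_dotProduct_ne_zero (sub_ne_zero.2 hs)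
  have h2 : (Finset.univ.filter fun v : Fin m → ZMod 2 =>
      dotProduct v (φ a s - φ b s) ≠ 0).card ≤ (Finset.univ.filter fun e : Fin 2 × (Fin m → ZMod 2) =>
        dotProduct e.2 (φ a e.1) ≠ dotProduct e.2 (φ b e.1)).card := by
    refine Finset.card_le_card_of_injOn (fun v => (s, v)) ?_ ?_
    · intro v hv
      simp only [Finset.coe_filter, Finset.mem_univ, true_and, Set.mem_ofPred_eq] at hv ⊢
      rwa [dotProduct_sub, sub_ne_zero] at hv
    · intro v _ v' _ h
      simpa using h
  simp only [Fintype.card_prod, Fintype.card_fin, Fintype.card_fun, ZMod.card]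
  omega

/-- Positions are indexed by channel, letter form, hash vector and a copy number, with `n % M`
positions left idle. The factor 72 is 9 channels times 4 for the letter code times 2 for the idle
positions. The room `5 + m + κ ≤ L` is exactly used up at `L = 24`, whence the lower bound on `n`.
-/
theorem exists_positionHash {n u : ℕ} (hn : 2 ^ 24 ≤ n) (hu : u + 1 ≤ n) :
    Nonempty (PositionHash n (Nat.log 2 n / 4) u) := by
  classical
  set L := Nat.log 2 n with hL
  have hL24 : 24 ≤ L := Nat.le_log_of_pow_le (by norm_num) hn
  have hLn : 2 ^ L ≤ n := Nat.pow_log_le_self 2 (by omega)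
  have hLn' : n < 2 ^ (L + 1) := Nat.lt_pow_succ_log_self (by norm_num) n
  set κ := L / 4 with hκ
  set m := L / 2 + 1 with hm
  obtain ⟨E, _, bitE, hEcard, hbit⟩ := exists_letter_code (n := n) (m := m)
    (hLn'.trans_le (Nat.pow_le_pow_right (by norm_num) (by omega))) u hu
  set M := 9 * (Fintype.card E * 2 ^ κ) with hM
  have hM0 : 0 < M := by rw [hM, hEcard]; positivity
  have hMn : M ≤ n := by
    calc M = 9 * (2 * (2 ^ m * 2 ^ κ)) := by rw [hM, hEcard]; ring
      _ = 18 * 2 ^ (m + κ) := by rw [pow_add 2 m κ]; ring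
      _ ≤ 2 ^ 5 * 2 ^ (m + κ) := Nat.mul_le_mul_right _ (by norm_num)
      _ = 2 ^ (5 + (m + κ)) := (pow_add 2 5 (m + κ)).symm
      _ ≤ 2 ^ L := Nat.pow_le_pow_right (by norm_num) (by omega)
      _ ≤ n := hLn
  set a := n / M with ha
  have hab : M * a + n % M = n := Nat.div_add_mod n M
  have ha1 : 1 ≤ a := Nat.div_pos hMn hM0
  have hn2 : n ≤ 2 * (M * a) := by
    have h1 := Nat.mod_lt n hM0
    have h2 : M * 1 ≤ M * a := Nat.mul_le_mul_left M ha1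
    omega
  have hcardeq : Fintype.card (Fin n) =
      Fintype.card ((Fin 9 × E × (Fin κ → ZMod 2) × Fin a) ⊕ Fin (n % M)) := by
    rw [Fintype.card_sum, Fintype.card_prod, Fintype.card_prod, Fintype.card_prod, Fintype.card_fun,
      ZMod.card]
    simp only [Fintype.card_fin]
    refine hab.symm.trans ?_
    congr 1
    rw [hM]; ring
  set η := Fintype.equivOfCardEq hcardeq with hη
  refine ⟨{
    channel := fun p => Sum.elim (fun q => some q.1) (fun _ => none) (η p)
    bit := fun p => Sum.elim (fun q => bitE q.2.1) (fun _ _ => 0) (η p)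
    vec := fun p i => Sum.elim (fun q => if h : i < κ then q.2.2.1 ⟨i, h⟩ else 0) (fun _ => 0) (η p)
    translate := ?_
    count := ?_ }⟩
  · intro c
    set t : Equiv.Perm (Fin 9 × E × (Fin κ → ZMod 2) × Fin a) :=
      { toFun := fun q => (q.1, q.2.1, (fun i => q.2.2.1 i + c q.1 i), q.2.2.2)
        invFun := fun q => (q.1, q.2.1, (fun i => q.2.2.1 i - c q.1 i), q.2.2.2)
        left_inv := fun q => by simp
        right_inv := fun q => by simp } with ht
    refine ⟨(η.trans (Equiv.sumCongr t (Equiv.refl _))).trans η.symm, fun p => ?_, fun p => ?_,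
      fun p l hl i hi => ?_⟩
    · simp only [Equiv.trans_apply, Equiv.apply_symm_apply]
      rcases η p with q | q <;> simp [ht]
    · simp only [Equiv.trans_apply, Equiv.apply_symm_apply]
      rcases η p with q | q <;> simp [ht]
    · simp only [Equiv.trans_apply, Equiv.apply_symm_apply]
      rcases hq : η p with q | q
      · rw [hq] at hl
        simp only [Sum.elim_inl, Option.some.injEq] at hl
        subst hl
        simp [ht, hi]
      · rw [hq] at hl
        simp at hl
  · intro k hk l r x y hxy
    have h1 := hbit x y hxy
    have h2 := two_pow_le_card_prefix hk r
    set SE := Finset.univ.filter fun e => bitE e x ≠ bitE e y with hSE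
    set SG := Finset.univ.filter fun g : Fin κ → ZMod 2 =>
      ∀ i : Fin k, g (Fin.castLE hk i) = r i with hSG
    have h3 : (SE ×ˢ SG ×ˢ (Finset.univ : Finset (Fin a))).card ≤ (Finset.univ.filter fun p =>
        Sum.elim (fun q : Fin 9 × E × (Fin κ → ZMod 2) × Fin a => some q.1)
          (fun _ => none) (η p) = some l ∧
        Sum.elim (fun q : Fin 9 × E × (Fin κ → ZMod 2) × Fin a => bitE q.2.1)
          (fun _ _ => 0) (η p) x ≠
        Sum.elim (fun q : Fin 9 × E × (Fin κ → ZMod 2) × Fin a => bitE q.2.1)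
          (fun _ _ => 0) (η p) y ∧
        ∀ i : Fin k, Sum.elim (fun q : Fin 9 × E × (Fin κ → ZMod 2) × Fin a =>
          if h : (i : ℕ) < κ then q.2.2.1 ⟨i, h⟩ else 0) (fun _ => 0) (η p) = r i).card := by
      refine Finset.card_le_card_of_injOn (fun q => η.symm (Sum.inl (l, q))) ?_ ?_
      · intro q hq
        simp only [hSE, hSG, Finset.coe_product, Set.mem_prod, Finset.mem_coe, Finset.mem_filter,
          Finset.mem_univ, true_and] at hq
        simp only [Finset.coe_filter, Finset.mem_univ, true_and, Set.mem_ofPred_eq,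
          Equiv.apply_symm_apply, Sum.elim_inl]
        refine ⟨hq.1, fun i => ?_⟩
        rw [dif_pos (i.2.trans_le hk)]
        exact hq.2.1 i
      · intro q _ q' _ h
        simpa using h
    rw [Finset.card_product, Finset.card_product, Finset.card_univ, Fintype.card_fin] at h3
    calc n ≤ 2 * (9 * (Fintype.card E * 2 ^ κ) * a) := hn2
      _ ≤ 2 * (9 * ((4 * SE.card) * (2 ^ k * SG.card)) * a) := by gcongr
      _ = 72 * 2 ^ k * (SE.card * (SG.card * a)) := by ring
      _ ≤ _ := Nat.mul_le_mul_left _ h3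

namespace PositionHash

variable {n κ u : ℕ} (𝓗 : PositionHash n κ u)

/-- The positions of a channel. -/
def positions (l : Fin 9) : Finset (Fin n) := Finset.univ.filter fun p => 𝓗.channel p = some l

/-- The number of one bits of a channel, modulo two. -/
def parity (l : Fin 9) (y : Block n) : ZMod 2 := ∑ p ∈ 𝓗.positions l, 𝓗.bit p (y p)

/-- The hash of a channel. -/
def hash (l : Fin 9) (y : Block n) (i : ℕ) : ZMod 2 :=
  ∑ p ∈ 𝓗.positions l, 𝓗.bit p (y p) * 𝓗.vec p i

/-- In every channel the parity is odd and the first `k` hash coordinates vanish. -/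
def Vanishes (k : ℕ) (y : Block n) : Prop :=
  ∀ l, 𝓗.parity l y = 1 ∧ ∀ i < k, 𝓗.hash l y i = 0

theorem Vanishes.mono {𝓗 : PositionHash n κ u} {k k' : ℕ} {y : Block n} (h : 𝓗.Vanishes k y)
    (hk : k' ≤ k) : 𝓗.Vanishes k' y := fun l => ⟨(h l).1, fun i hi => (h l).2 i (hi.trans_le hk)⟩

/-- Blocks with vanishing hash are rare in every type class. -/
theorem card_vanishes_le {k : ℕ} (hk : k ≤ κ) (x : Block n) :
    2 ^ (9 * k) * (open Classical in (typeClass x).filter (𝓗.Vanishes k)).card ≤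
      (typeClass x).card := by
  classical
  set ext : (Fin 9 → Fin k → ZMod 2) → Fin 9 → ℕ → ZMod 2 := fun c l i =>
    if h : i < k then c l ⟨i, h⟩ else 0 with hext
  choose τ h1 h2 h3 using fun c => 𝓗.translate (ext c)
  have hmemτ : ∀ c l p, τ c p ∈ 𝓗.positions l ↔ p ∈ 𝓗.positions l := by
    intro c l p; simp [positions, h1]
  have hpar : ∀ c l y, 𝓗.parity l (y ∘ τ c) = 𝓗.parity l y := by
    intro c l y
    unfold parity
    refine Finset.sum_equiv (τ c) (fun p => (hmemτ c l p).symm) fun p _ => ?_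
    rw [h2]; rfl
  -- Translating the vectors by `c` changes the hash by parity times `c`. Odd parity thus makes the
  -- translates of a vanishing block have all different hashes, so the map from pairs `(c, y)` into
  -- the class is injective.
  have hhash : ∀ c l y (i : Fin k), 𝓗.hash l (y ∘ τ c) i =
      𝓗.hash l y i + 𝓗.parity l y * c l i := by
    intro c l y i
    have : 𝓗.hash l y i + 𝓗.parity l y * c l i =
        ∑ p ∈ 𝓗.positions l, 𝓗.bit p (y p) * (𝓗.vec p i + c l i) := by
      simp only [hash, parity, mul_add, Finset.sum_add_distrib, Finset.sum_mul]
    rw [this]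
    unfold hash
    refine Finset.sum_equiv (τ c) (fun p => (hmemτ c l p).symm) fun p hp => ?_
    have hp' : 𝓗.channel p = some l := by simpa [positions] using hp
    rw [h2, h3 c p l hp' i (i.2.trans_le hk)]
    simp only [hext, i.2, dif_pos, Function.comp]
    rw [add_assoc, CharTwo.add_self_eq_zero, add_zero]
  have hle : ((Finset.univ : Finset (Fin 9 → Fin k → ZMod 2)) ×ˢ
      (typeClass x).filter (𝓗.Vanishes k)).card ≤ (typeClass x).card := by
    refine Finset.card_le_card_of_injOn (fun q => q.2 ∘ τ q.1) ?_ ?_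
    · rintro ⟨c, y⟩ hq
      simp only [Finset.coe_product, Set.mem_prod, Finset.mem_coe, Finset.mem_filter,
        Finset.mem_univ, true_and] at hq
      exact (comp_mem_typeClass _).2 hq.1
    · rintro ⟨c, y⟩ hq ⟨c', y'⟩ hq' h
      simp only [Finset.coe_product, Set.mem_prod, Finset.mem_coe, Finset.mem_filter,
        Finset.mem_univ, true_and] at hq hq' h
      have hc : c = c' := by
        funext l i
        have e1 := hhash c l y i
        have e2 := hhash c' l y' i
        rw [(hq.2 l).1, (hq.2 l).2 i i.2, zero_add, one_mul] at e1
        rw [(hq'.2 l).1, (hq'.2 l).2 i i.2, zero_add, one_mul] at e2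
        rw [← e1, ← e2, h]
      subst hc
      have : y = y' := by
        funext p
        have := congrFun h ((τ c).symm p)
        simpa using this
      rw [this]
  rw [Finset.card_product, Finset.card_univ, Fintype.card_fun, Fintype.card_fun, ZMod.card,
    Fintype.card_fin, Fintype.card_fin, ← pow_mul, mul_comm k 9] at hle
  exact hle

/-- Two unequal bits of `𝔽₂` differ by one, so every exchange in the channel adds exactly one, and
its vector to the hash. -/
theorem parity_piecewise (l : Fin 9) {J : Finset (Fin n)} {z z' : Block n}
    (h : ∀ p ∈ J, 𝓗.bit p (z p) ≠ 𝓗.bit p (z' p)) :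
    𝓗.parity l (J.piecewise z' z) = 𝓗.parity l z + ∑ _p ∈ J ∩ 𝓗.positions l, 1 := by
  classical
  unfold parity
  rw [Finset.inter_comm, ← Finset.filter_mem_eq_inter, Finset.sum_filter, ← Finset.sum_add_distrib]
  refine Finset.sum_congr rfl fun p _ => ?_
  by_cases hp : p ∈ J
  · rw [Finset.piecewise_eq_of_mem _ _ _ hp, if_pos hp]
    exact zmod_two_eq_add_one (h p hp).symm
  · rw [Finset.piecewise_eq_of_notMem _ _ _ hp, if_neg hp, add_zero]

theorem hash_piecewise (l : Fin 9) {J : Finset (Fin n)} {z z' : Block n}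
    (h : ∀ p ∈ J, 𝓗.bit p (z p) ≠ 𝓗.bit p (z' p)) (i : ℕ) :
    𝓗.hash l (J.piecewise z' z) i = 𝓗.hash l z i + ∑ p ∈ J ∩ 𝓗.positions l, 𝓗.vec p i := by
  classical
  unfold hash
  rw [Finset.inter_comm, ← Finset.filter_mem_eq_inter, Finset.sum_filter, ← Finset.sum_add_distrib]
  refine Finset.sum_congr rfl fun p _ => ?_
  by_cases hp : p ∈ J
  · rw [Finset.piecewise_eq_of_mem _ _ _ hp, if_pos hp, zmod_two_eq_add_one (h p hp).symm, add_mul,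
      one_mul]
  · rw [Finset.piecewise_eq_of_notMem _ _ _ hp, if_neg hp, add_zero]

/-- If every residue is available in `C` at least twice, then exchanging at most 18 letters makes
the hash vanish. -/
theorem exists_vanishes_piecewise {k : ℕ} {C : Finset (Fin n)} {z z' : Block n}
    (h : ∀ (l : Fin 9) (r : Fin k → ZMod 2) (X : Finset (Fin n)), X.card ≤ 1 → ∃ p ∈ C, p ∉ X ∧
      𝓗.channel p = some l ∧ 𝓗.bit p (z p) ≠ 𝓗.bit p (z' p) ∧ ∀ i : Fin k, 𝓗.vec p i = r i) :
    ∃ J ⊆ C, J.card ≤ 18 ∧ 𝓗.Vanishes k (J.piecewise z' z) := by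
  classical
  have key : ∀ l : Fin 9, ∃ J ⊆ C, J.card ≤ 2 ∧ (∀ p ∈ J, 𝓗.channel p = some l) ∧
      (∀ p ∈ J, 𝓗.bit p (z p) ≠ 𝓗.bit p (z' p)) ∧ 𝓗.parity l z + ∑ p ∈ J, (1 : ZMod 2) = 1 ∧
      ∀ i < k, 𝓗.hash l z i + ∑ p ∈ J, 𝓗.vec p i = 0 := by
    intro l
    -- One position whose vector equals the current hash cancels it but flips the parity. If the
    -- parity was already odd, a second position with zero vector restores it. Two exchanges in each
    -- of nine channels give the bound 18.
    obtain ⟨p, hpC, -, hp1, hp2, hp3⟩ := h l (fun i => 𝓗.hash l z i) ∅ (by simp)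
    rcases zmod_two_eq_zero_or_one (𝓗.parity l z) with h0 | h0
    · refine ⟨{p}, by simpa using hpC, by simp, by simpa using hp1, by simpa using hp2, by simp [h0],
        fun i hi => ?_⟩
      have := hp3 ⟨i, hi⟩
      simp only at this
      rw [Finset.sum_singleton, this, CharTwo.add_self_eq_zero]
    · obtain ⟨q, hqC, hqp, hq1, hq2, hq3⟩ := h l (fun _ => 0) {p} (by simp)
      have hqp' : q ≠ p := by simpa using hqp
      refine ⟨{q, p}, ?_, Finset.card_le_two, by simp [hp1, hq1], by simp [hp2, hq2], ?_,
        fun i hi => ?_⟩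
      · intro s hs
        simp only [Finset.mem_insert, Finset.mem_singleton] at hs
        rcases hs with rfl | rfl <;> assumption
      · rw [Finset.sum_pair hqp', h0]; decide
      · have e1 := hp3 ⟨i, hi⟩
        have e2 := hq3 ⟨i, hi⟩
        simp only at e1 e2
        rw [Finset.sum_pair hqp', e1, e2, zero_add, CharTwo.add_self_eq_zero]
  choose J hJC hJ2 hJl hJb hJp hJh using key
  have hint : ∀ l, (Finset.univ.biUnion J) ∩ 𝓗.positions l = J l := by
    intro l
    ext p
    simp only [Finset.mem_inter, Finset.mem_biUnion, Finset.mem_univ, true_and, positions,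
      Finset.mem_filter]
    constructor
    · rintro ⟨⟨l', hp⟩, hl⟩
      have := hJl l' p hp
      rw [hl, Option.some.injEq] at this
      rwa [this]
    · intro hp
      exact ⟨⟨l, hp⟩, hJl l p hp⟩
  have hb : ∀ p ∈ Finset.univ.biUnion J, 𝓗.bit p (z p) ≠ 𝓗.bit p (z' p) := by
    intro p hp
    obtain ⟨l, -, hl⟩ := Finset.mem_biUnion.1 hp
    exact hJb l p hl
  refine ⟨Finset.univ.biUnion J, Finset.biUnion_subset.2 fun l _ => hJC l, ?_, fun l => ⟨?_, ?_⟩⟩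
  · refine Finset.card_biUnion_le.trans ?_
    exact (Finset.sum_le_sum fun l _ => hJ2 l).trans (by simp)
  · rw [parity_piecewise 𝓗 l hb, hint]; exact hJp l
  · intro i hi
    rw [hash_piecewise 𝓗 l hb, hint]; exact hJh l i hi

end PositionHash

/-! ### Random rearrangements -/

open Classical in
/-- A random permutation avoids prescribed large target sets with exponentially small probability. -/
theorem card_perm_avoid_le {n s : ℕ} {γ : ℝ} (hγ : γ ≤ 1) (G : Fin n → Finset (Fin n))
    (S : Finset (Fin n)) (hS : S.card ≤ s) (hG : ∀ j ∈ S, γ * n + s ≤ ((G j).card : ℝ)) :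
    ((Finset.univ.filter fun σ : Equiv.Perm (Fin n) => ∀ j ∈ S, σ j ∉ G j).card : ℝ) ≤
      (1 - γ) ^ S.card * n.factorial := by
  induction S using Finset.induction_on with
  | empty => simp [Fintype.card_perm]
  | insert j S hj ih =>
    rw [Finset.card_insert_of_notMem hj] at hS ⊢
    have ih := ih (by omega) fun i hi => hG i (Finset.mem_insert_of_mem hi)
    set X := Finset.univ.filter fun σ : Equiv.Perm (Fin n) => ∀ j ∈ S, σ j ∉ G j with hX
    have hn : 0 < n := (Nat.zero_le _).trans_lt j.2
    have hsplit : Finset.univ.filter (fun σ : Equiv.Perm (Fin n) => ∀ i ∈ insert j S, σ i ∉ G i) =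
        X.filter fun σ => ¬ σ j ∈ G j := by
      ext σ
      simp [hX, and_comm]
    have hadd := Finset.card_filter_add_card_filter_not (s := X) (fun σ => σ j ∈ G j)
    -- A swap of `j` with an index outside `S` does not touch the conditions on `S`. Hence, given
    -- those conditions, the image of `j` is equidistributed with the images of all indices outside
    -- `S`, which still hit `G j` in a proportion of at least `γ`.
    have hswap : ∀ i ∈ Sᶜ, (X.filter fun σ => σ i ∈ G j).card = (X.filter fun σ => σ j ∈ G j).card := by
      intro i hi
      have hi' : i ∉ S := Finset.mem_compl.1 hi
      have hmem : ∀ σ ∈ X, σ * Equiv.swap i j ∈ X := by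
        intro σ hσ
        simp only [hX, Finset.mem_filter, Finset.mem_univ, true_and] at hσ ⊢
        intro q hq
        have h1 : q ≠ i := by rintro rfl; exact hi' hq
        have h2 : q ≠ j := by rintro rfl; exact hj hq
        rw [Equiv.Perm.mul_apply, Equiv.swap_apply_of_ne_of_ne h1 h2]
        exact hσ q hq
      refine Finset.card_bij' (fun σ _ => σ * Equiv.swap i j) (fun σ _ => σ * Equiv.swap i j)
        ?_ ?_ ?_ ?_
      · intro σ hσ
        rw [Finset.mem_filter] at hσ ⊢
        exact ⟨hmem σ hσ.1, by simpa using hσ.2⟩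
      · intro σ hσ
        rw [Finset.mem_filter] at hσ ⊢
        exact ⟨hmem σ hσ.1, by simpa using hσ.2⟩
      · intro σ _; simp [mul_assoc]
      · intro σ _; simp [mul_assoc]
    have hdouble : ∑ i ∈ Sᶜ, (X.filter fun σ => σ i ∈ G j).card =
        ∑ σ ∈ X, (Sᶜ.filter fun i => σ i ∈ G j).card := by
      simp only [Finset.card_filter]
      exact Finset.sum_comm
    have hlow : ∀ σ ∈ X, γ * n ≤ ((Sᶜ.filter fun i => σ i ∈ G j).card : ℝ) := by
      intro σ _
      have h1 := hG j (Finset.mem_insert_self _ _)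
      have h2 : (G j).card ≤ (Sᶜ.filter fun i => σ i ∈ G j).card + S.card := by
        have : (G j).card = (Finset.univ.filter fun i => σ i ∈ G j).card := by
          refine Finset.card_bij' (fun i _ => σ.symm i) (fun i _ => σ i) ?_ ?_ ?_ ?_ <;> simp
        rw [this]
        refine (Finset.card_le_card (t := (Sᶜ.filter fun i => σ i ∈ G j) ∪ S) ?_).trans
          (Finset.card_union_le _ _)
        intro i hi
        by_cases h : i ∈ S
        · exact Finset.mem_union_right _ h
        · refine Finset.mem_union_left _ ?_
          simp only [Finset.mem_filter, Finset.mem_univ, true_and, Finset.mem_compl] at hi ⊢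
          exact ⟨h, hi⟩
      have h3 : ((G j).card : ℝ) ≤ ((Sᶜ.filter fun i => σ i ∈ G j).card : ℝ) + S.card := by
        exact_mod_cast h2
      have h4 : (S.card : ℝ) + 1 ≤ s := by exact_mod_cast hS
      linarith
    have hhit : γ * X.card ≤ ((X.filter fun σ => σ j ∈ G j).card : ℝ) := by
      have h1 : (X.card : ℝ) * (γ * n) ≤ ∑ σ ∈ X, ((Sᶜ.filter fun i => σ i ∈ G j).card : ℝ) := by
        rw [← nsmul_eq_mul]
        exact Finset.card_nsmul_le_sum _ _ _ hlow
      have h2 : ∑ σ ∈ X, ((Sᶜ.filter fun i => σ i ∈ G j).card : ℝ) ≤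
          n * ((X.filter fun σ => σ j ∈ G j).card : ℝ) := by
        rw [← Nat.cast_sum, ← hdouble, Finset.sum_congr rfl hswap, Finset.sum_const, smul_eq_mul]
        push_cast
        refine mul_le_mul_of_nonneg_right ?_ (Nat.cast_nonneg _)
        exact_mod_cast (Finset.card_le_univ _).trans_eq (Fintype.card_fin n)
      have hn' : (0 : ℝ) < n := by exact_mod_cast hn
      refine le_of_mul_le_mul_left ?_ hn'
      linarith
    rw [hsplit]
    have hadd' : ((X.filter fun σ => σ j ∈ G j).card : ℝ) +
        ((X.filter fun σ => ¬ σ j ∈ G j).card : ℝ) = X.card := by exact_mod_cast hadd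
    calc ((X.filter fun σ => ¬ σ j ∈ G j).card : ℝ) ≤ (1 - γ) * X.card := by linarith
      _ ≤ (1 - γ) * ((1 - γ) ^ S.card * n.factorial) :=
        mul_le_mul_of_nonneg_left ih (by linarith)
      _ = _ := by ring

open Classical in
/-- A random permutation has at least `m` hits unless one of `m` disjoint groups is avoided. -/
theorem card_perm_few_hits_le {n s m : ℕ} {γ : ℝ} (hγ : γ ≤ 1) (G : Fin n → Finset (Fin n))
    (C : Finset (Fin n)) (hC : m * s ≤ C.card) (hG : ∀ j ∈ C, γ * n + s ≤ ((G j).card : ℝ)) :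
    ((Finset.univ.filter fun σ : Equiv.Perm (Fin n) =>
      (C.filter fun j => σ j ∈ G j).card < m).card : ℝ) ≤ m * ((1 - γ) ^ s * n.factorial) := by
  obtain ⟨e⟩ : Nonempty (Fin m × Fin s ↪ C) := by
    apply Function.Embedding.nonempty_of_card_le
    simpa using hC
  set S : Fin m → Finset (Fin n) := fun i => Finset.univ.image fun a => (e (i, a) : Fin n) with hS
  have hScard : ∀ i, (S i).card = s := by
    intro i
    rw [hS, Finset.card_image_of_injective _ fun a b h => by
      simpa using e.injective (Subtype.ext h)]
    simp
  have hSC : ∀ i, ∀ j ∈ S i, j ∈ C := by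
    intro i j hj
    obtain ⟨a, -, rfl⟩ := Finset.mem_image.1 hj
    exact (e (i, a)).2
  have hsub : (Finset.univ.filter fun σ : Equiv.Perm (Fin n) =>
      (C.filter fun j => σ j ∈ G j).card < m) ⊆
      Finset.univ.biUnion fun i : Fin m => Finset.univ.filter fun σ : Equiv.Perm (Fin n) =>
        ∀ j ∈ S i, σ j ∉ G j := by
    intro σ hσ
    simp only [Finset.mem_filter, Finset.mem_univ, true_and, Finset.mem_biUnion] at hσ ⊢
    by_contra! hcon
    choose j hjS hjG using hcon
    have : (Finset.univ : Finset (Fin m)).card ≤ (C.filter fun j => σ j ∈ G j).card := by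
      refine Finset.card_le_card_of_injOn j ?_ ?_
      · intro i _
        exact Finset.mem_filter.2 ⟨hSC i _ (hjS i), hjG i⟩
      · intro i _ i' _ h
        obtain ⟨a, -, ha⟩ := Finset.mem_image.1 (hjS i)
        obtain ⟨a', -, ha'⟩ := Finset.mem_image.1 (hjS i')
        have := e.injective (Subtype.ext (ha.trans (h.trans ha'.symm)))
        exact (Prod.mk.inj this).1
    simp at this
    omega
  have h1 := (Finset.card_le_card hsub).trans Finset.card_biUnion_le
  have h2 : ((Finset.univ.filter fun σ : Equiv.Perm (Fin n) =>
      (C.filter fun j => σ j ∈ G j).card < m).card : ℝ) ≤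
      ∑ i : Fin m, ((Finset.univ.filter fun σ : Equiv.Perm (Fin n) =>
        ∀ j ∈ S i, σ j ∉ G j).card : ℝ) := by exact_mod_cast h1
  refine h2.trans ?_
  calc _ ≤ ∑ _i : Fin m, (1 - γ) ^ s * (n.factorial : ℝ) := by
        refine Finset.sum_le_sum fun i _ => ?_
        have := card_perm_avoid_le hγ G (S i) (hScard i).le fun j hj => hG j (hSC i j hj)
        rwa [hScard] at this
    _ = _ := by simp

/-! ### Cheap positions and regular pairs -/

/-- The number of letters above `u`. -/
def tailCount {n : ℕ} (u : ℕ) (x : Block n) : ℕ := (Finset.univ.filter fun i => u < (x i : ℕ)).card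

theorem tailCount_comp {n : ℕ} (u : ℕ) (x : Block n) (σ : Equiv.Perm (Fin n)) :
    tailCount u (x ∘ σ) = tailCount u x := by
  refine Finset.card_bij' (fun i _ => σ i) (fun i _ => σ.symm i) ?_ ?_ ?_ ?_ <;> simp

theorem hammingDist_comp_perm {n : ℕ} (x y : Block n) (σ : Equiv.Perm (Fin n)) :
    hammingDist (x ∘ σ) (y ∘ σ) = hammingDist x y := by
  unfold hammingDist
  refine Finset.card_bij' (fun i _ => σ i) (fun i _ => σ.symm i) ?_ ?_ ?_ ?_ <;> simp

open Classical in
/-- The positions where `v` and `w` differ at no more than twice the average cost. -/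
noncomputable def cheap (ρ : ℕ+ → ℕ+ → ℝ) (t : ℝ) {n : ℕ} (v w : Block n) : Finset (Fin n) :=
  Finset.univ.filter fun j => v j ≠ w j ∧ ρ (v j) (w j) * hammingDist v w ≤ 2 * t

/-- Markov's inequality: more than half of the differences above twice the average would exceed the
total `t`. -/
theorem two_mul_card_cheap_ge {ρ : ℕ+ → ℕ+ → ℝ} (hρ : IsDistortion ρ) {t : ℝ} {n : ℕ}
    {v w : Block n} (h : ∑ i, ρ (v i) (w i) ≤ t) :
    hammingDist v w ≤ 2 * (cheap ρ t v w).card := by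
  classical
  by_contra! hcon
  set D := hammingDist v w with hD
  set E := Finset.univ.filter fun j => v j ≠ w j ∧ ¬ ρ (v j) (w j) * D ≤ 2 * t with hE
  have hadd : (cheap ρ t v w).card + E.card = D := by
    have := Finset.card_filter_add_card_filter_not (s := Finset.univ.filter fun j => v j ≠ w j)
      (fun j => ρ (v j) (w j) * D ≤ 2 * t)
    rw [Finset.filter_filter, Finset.filter_filter] at this
    exact this
  have hE' : D < 2 * E.card := by omega
  have hsum : ∑ j ∈ E, ρ (v j) (w j) ≤ t :=
    (Finset.sum_le_univ_sum_of_nonneg fun i => hρ.nonneg _ _).trans h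
  have ht : 0 ≤ t := (Finset.sum_nonneg fun i _ => hρ.nonneg _ _).trans h
  have h1' : ∑ j ∈ E, (2 * t) < ∑ j ∈ E, ρ (v j) (w j) * D := by
    refine Finset.sum_lt_sum_of_nonempty (Finset.card_pos.1 (by omega)) fun j hj =>
      (not_le.1 (Finset.mem_filter.1 hj).2.2)
  rw [Finset.sum_const, nsmul_eq_mul, ← Finset.sum_mul] at h1'
  have h2 : (D : ℝ) < 2 * E.card := by exact_mod_cast hE'
  have h3 : (∑ j ∈ E, ρ (v j) (w j)) * D ≤ t * D := mul_le_mul_of_nonneg_right hsum (Nat.cast_nonneg _)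
  nlinarith

open Classical in
/-- The positions of `C` where a swap between `v` and `w` flips the parity of the channel `l` and
adds a vector with prefix `r` to its hash. -/
noncomputable def PositionHash.options {n κ u : ℕ} (𝓗 : PositionHash n κ u) (C : Finset (Fin n)) (v w : Block n)
    {k : ℕ} (l : Fin 9) (r : Fin k → ZMod 2) : Finset (Fin n) :=
  C.filter fun p => 𝓗.channel p = some l ∧ 𝓗.bit p (v p) ≠ 𝓗.bit p (w p) ∧
    ∀ i : Fin k, 𝓗.vec p i = r i

/-- Every residue is available at many cheap positions. -/
def PositionHash.Regular {n κ u : ℕ} (𝓗 : PositionHash n κ u) (ρ : ℕ+ → ℕ+ → ℝ) (t : ℝ)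
    (v w : Block n) : Prop :=
  ∀ (l : Fin 9) (r : Fin (Nat.log 2 (hammingDist v w) / 4) → ZMod 2),
    2 * Nat.sqrt (hammingDist v w) < (𝓗.options (cheap ρ t v w) v w l r).card

/-- The exponential is traded for an eighth inverse power, enough to beat the polynomial factors in
`not_regular_numeric`. -/
theorem one_sub_pow_le {γ : ℝ} (h0 : 0 < γ) (h1 : γ ≤ 1) {s : ℕ} (hs : 0 < s) :
    (1 - γ) ^ s ≤ (Nat.factorial 8 : ℝ) / (γ * s) ^ 8 := by
  have hp : 0 < γ * s := by positivity
  have h2 : (1 - γ) ^ s ≤ Real.exp (-(γ * s)) := by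
    calc (1 - γ) ^ s ≤ Real.exp (-γ) ^ s :=
          pow_le_pow_left₀ (by linarith) (Real.one_sub_le_exp_neg γ) s
      _ = _ := by rw [← Real.exp_nat_mul]; ring_nf
  refine h2.trans ?_
  have h3 := Real.pow_div_factorial_le_exp (γ * s) hp.le 8
  rw [Real.exp_neg, inv_eq_one_div, div_le_div_iff₀ (Real.exp_pos _) (by positivity), one_mul]
  rwa [div_le_iff₀ (by positivity), mul_comm (Real.exp _)] at h3

/-- Two different letters are identified only if both exceed `u`, so the loss is at most the number
of tail letters of `v`. -/
theorem card_mergedDiff_ge {n u : ℕ} {v w : Block n} (C : Finset (Fin n)) (hC : ∀ j ∈ C, v j ≠ w j) :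
    C.card ≤ (C.filter fun j => min (v j : ℕ) (u + 1) ≠ min (w j : ℕ) (u + 1)).card +
      tailCount u v := by
  have h := Finset.card_filter_add_card_filter_not (s := C)
    (fun j => min (v j : ℕ) (u + 1) ≠ min (w j : ℕ) (u + 1))
  rw [← h]
  refine Nat.add_le_add_left (Finset.card_le_card fun j hj => ?_) _
  rw [Finset.mem_filter] at hj ⊢
  refine ⟨Finset.mem_univ _, ?_⟩
  by_contra hu
  have h1 : (v j : ℕ) ≠ (w j : ℕ) := fun h => hC j hj.1 (PNat.coe_injective h)
  have h2 := not_not.1 hj.2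
  omega

/-- Here `X` is the integer square root of `D` and `h = 2 ^ k` is at most the fourth root of `D`.
The product is of order `h ^ 9 / X ^ 5`, and `h ^ 2 ≤ 2 X` bounds it. -/
theorem not_regular_numeric {D X h s : ℝ} (hX : 16 ≤ X) (hXD : X ^ 2 ≤ D) (hDX : D ≤ 4 * X ^ 2)
    (hh : 1 ≤ h) (hhD : h ^ 4 ≤ D) (hs : X / 16 ≤ s) :
    9 * h * (2 * X + 1) * ((Nat.factorial 8 : ℝ) / (1 / (144 * h) * s) ^ 8) * D ≤
      3456 * Nat.factorial 8 * 2304 ^ 8 := by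
  have hX0 : 0 < X := by linarith
  have h1 : X / (2304 * h) ≤ 1 / (144 * h) * s := by
    rw [div_mul_eq_mul_div, one_mul, div_le_div_iff₀ (by positivity) (by positivity)]
    nlinarith
  have h2 : (X / (2304 * h)) ^ 8 ≤ (1 / (144 * h) * s) ^ 8 :=
    pow_le_pow_left₀ (by positivity) h1 8
  have h3 : (Nat.factorial 8 : ℝ) / (1 / (144 * h) * s) ^ 8 ≤
      (Nat.factorial 8 : ℝ) / (X / (2304 * h)) ^ 8 :=
    div_le_div_of_nonneg_left (by positivity) (by positivity) h2
  have hh4 : h ^ 4 ≤ 4 * X ^ 2 := hhD.trans hDX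
  have hh2 : h ^ 2 ≤ 2 * X := by
    by_contra! hcon
    nlinarith [mul_pos hX0 hX0]
  have hh9 : h ^ 9 ≤ 32 * X ^ 5 := by
    calc h ^ 9 = h * (h ^ 4 * h ^ 4) := by ring
      _ ≤ (2 * X) * ((4 * X ^ 2) * (4 * X ^ 2)) := by
        gcongr
        nlinarith
      _ = 32 * X ^ 5 := by ring
  calc _ ≤ 9 * h * (3 * X) * ((Nat.factorial 8 : ℝ) / (X / (2304 * h)) ^ 8) * (4 * X ^ 2) := by
        have : 0 ≤ D := le_trans (by positivity) hXD
        gcongr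
        linarith
    _ = 108 * Nat.factorial 8 * 2304 ^ 8 * (h ^ 9 / X ^ 5) := by
        rw [div_pow, div_div_eq_mul_div]
        field_simp
        ring
    _ ≤ 108 * Nat.factorial 8 * 2304 ^ 8 * 32 := by
        gcongr
        rw [div_le_iff₀ (by positivity)]
        linarith
    _ = _ := by ring

open Classical in
/-- A random rearrangement of a pair of blocks is regular with high probability. -/
theorem card_not_regular_mul_le {n u : ℕ} (hn : 2 ^ 24 ≤ n)
    (𝓗 : PositionHash n (Nat.log 2 n / 4) u) {ρ : ℕ+ → ℕ+ → ℝ} (hρ : IsDistortion ρ) {t : ℝ}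
    {v w : Block n} (ht : ∑ i, ρ (v i) (w i) ≤ t) (hD : 256 ≤ hammingDist v w)
    (htl : 8 * tailCount u v < hammingDist v w) :
    ((Finset.univ.filter fun σ : Equiv.Perm (Fin n) =>
      ¬ 𝓗.Regular ρ t (v ∘ σ) (w ∘ σ)).card : ℝ) * hammingDist v w ≤
      3456 * Nat.factorial 8 * 2304 ^ 8 * n.factorial := by
  set D := hammingDist v w with hDdef
  have hDn : D ≤ n := (hammingDist_le_card_fintype).trans_eq (Fintype.card_fin n)
  set X := Nat.sqrt D with hX
  set k := Nat.log 2 D / 4 with hk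
  have hkκ : k ≤ Nat.log 2 n / 4 := Nat.div_le_div_right (Nat.log_mono_right hDn)
  have hXX : X * X ≤ D := Nat.sqrt_le D
  have hX16 : 16 ≤ X := Nat.le_sqrt.2 (by omega)
  have hDX : D < (X + 1) * (X + 1) := Nat.lt_succ_sqrt D
  have h2k : (2 ^ k) ^ 4 ≤ D := by
    rw [← pow_mul]
    exact (Nat.pow_le_pow_right (by norm_num) (Nat.div_mul_le_self _ _)).trans
      (Nat.pow_log_le_self 2 (by omega))
  -- This is half the proportion guaranteed by `count`; the other half pays for the `s` images
  -- already used.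
  set γ : ℝ := 1 / (144 * 2 ^ k) with hγ
  have h2k1 : (1 : ℝ) ≤ 2 ^ k := one_le_pow₀ (by norm_num)
  have hγ0 : 0 < γ := by positivity
  have hγ1 : γ ≤ 1 := by
    rw [hγ, div_le_one (by positivity)]; linarith
  set s := X / 8 with hs
  have hs8 : 8 * s ≤ X := Nat.mul_div_le X 8
  set C := (cheap ρ t v w).filter fun j => min (v j : ℕ) (u + 1) ≠ min (w j : ℕ) (u + 1) with hC
  -- At least `D / 2` positions are cheap and fewer than `D / 8` are lost to identified letters,
  -- leaving `3 D / 8`. That holds `2 X + 1` disjoint groups of size `s ≤ X / 8`.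
  have hCcard : (2 * X + 1) * s ≤ C.card := by
    have h1 := two_mul_card_cheap_ge hρ ht
    have h2 : (cheap ρ t v w).card ≤ C.card + tailCount u v := by
      convert card_mergedDiff_ge (u := u) (v := v) (w := w) (cheap ρ t v w) fun j hj =>
        (Finset.mem_filter.1 hj).2.1
    have h3 : (2 * X + 1) * (8 * s) ≤ (3 * X) * X := Nat.mul_le_mul (by omega) hs8
    have h4 : (3 * X) * X = 3 * (X * X) := by ring
    have h5 : (2 * X + 1) * (8 * s) = 8 * ((2 * X + 1) * s) := by ring
    omega
  have hsn : (s : ℝ) ≤ γ * n := by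
    have h1 : 18 * (X * 2 ^ k) ≤ n := by
      refine le_of_not_gt fun hcon => ?_
      have h2 : n ^ 4 < (18 * (X * 2 ^ k)) ^ 4 := Nat.pow_lt_pow_left hcon (by norm_num)
      have h3 : (18 * (X * 2 ^ k)) ^ 4 ≤ 18 ^ 4 * n ^ 3 := by
        calc (18 * (X * 2 ^ k)) ^ 4 = 18 ^ 4 * ((X * X) * (X * X) * (2 ^ k) ^ 4) := by ring
          _ ≤ 18 ^ 4 * (n * n * n) := by
            gcongr <;> omega
          _ = _ := by ring
      have h4 : 18 ^ 4 * n ^ 3 ≤ n * n ^ 3 := Nat.mul_le_mul_right _ (by omega)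
      have h5 : n * n ^ 3 = n ^ 4 := by ring
      omega
    have h1' : (18 : ℝ) * (X * 2 ^ k) ≤ n := by exact_mod_cast h1
    have h2 : (8 : ℝ) * s ≤ X := by exact_mod_cast hs8
    rw [hγ, div_mul_eq_mul_div, one_mul, le_div_iff₀ (by positivity)]
    nlinarith
  set G : Fin 9 → (Fin k → ZMod 2) → Fin n → Finset (Fin n) := fun l r j =>
    Finset.univ.filter fun p => 𝓗.channel p = some l ∧ 𝓗.bit p (v j) ≠ 𝓗.bit p (w j) ∧
      ∀ i : Fin k, 𝓗.vec p i = r i with hG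
  have hGcard : ∀ l r, ∀ j ∈ C, γ * n + s ≤ ((G l r j).card : ℝ) := by
    intro l r j hj
    have h1 := 𝓗.count k hkκ l r (v j) (w j) (Finset.mem_filter.1 hj).2
    have h1' : (n : ℝ) ≤ 72 * 2 ^ k * ((G l r j).card : ℝ) := by exact_mod_cast h1
    have h2 : 2 * (γ * n) ≤ ((G l r j).card : ℝ) := by
      rw [hγ, div_mul_eq_mul_div, one_mul, mul_div_assoc', div_le_iff₀ (by positivity)]
      linarith
    linarith
  -- The letter pair at `j` of `(v, w)` sits at position `σ⁻¹ j` of the permuted pair, so the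
  -- permutation whose hits are counted is the inverse.
  have hsub : (Finset.univ.filter fun σ : Equiv.Perm (Fin n) =>
      ¬ 𝓗.Regular ρ t (v ∘ σ) (w ∘ σ)) ⊆
      (Finset.univ : Finset (Fin 9 × (Fin k → ZMod 2))).biUnion fun q =>
        (Finset.univ.filter fun σ : Equiv.Perm (Fin n) =>
          (C.filter fun j => σ j ∈ G q.1 q.2 j).card < 2 * X + 1).image fun σ => σ⁻¹ := by
    intro σ hσ
    simp only [PositionHash.Regular, Finset.mem_filter, Finset.mem_univ, true_and, not_forall,
      not_lt] at hσ
    rw [hammingDist_comp_perm] at hσ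
    obtain ⟨l, r, hlr⟩ := hσ
    refine Finset.mem_biUnion.2 ⟨(l, r), Finset.mem_univ _, Finset.mem_image.2 ⟨σ⁻¹, ?_, inv_inv σ⟩⟩
    rw [Finset.mem_filter]
    refine ⟨Finset.mem_univ _, lt_of_le_of_lt ?_ (Nat.lt_succ_of_le hlr)⟩
    refine Finset.card_le_card_of_injOn (fun j => σ⁻¹ j) ?_ ?_
    · intro j hj
      rw [Finset.mem_coe, Finset.mem_filter] at hj
      have h1 := (Finset.mem_filter.1 (Finset.mem_filter.1 hj.1).1).2
      have h2 := (Finset.mem_filter.1 hj.2).2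
      simp only [PositionHash.options, cheap, Finset.coe_filter, Finset.mem_filter,
        Finset.mem_univ, true_and, Set.mem_ofPred_eq, hammingDist_comp_perm, Function.comp_apply,
        Equiv.apply_symm_apply, Equiv.Perm.inv_def]
      exact ⟨h1, h2⟩
    · intro j _ j' _ h
      exact σ⁻¹.injective h
  have hcard : ((Finset.univ.filter fun σ : Equiv.Perm (Fin n) =>
      ¬ 𝓗.Regular ρ t (v ∘ σ) (w ∘ σ)).card : ℝ) ≤
      9 * 2 ^ k * (2 * X + 1) * ((1 - γ) ^ s * n.factorial) := by
    have h1 := (Finset.card_le_card hsub).trans Finset.card_biUnion_le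
    refine (Nat.cast_le (α := ℝ).2 h1).trans ?_
    rw [Nat.cast_sum]
    calc _ ≤ ∑ _q : Fin 9 × (Fin k → ZMod 2),
          ((2 * X + 1 : ℕ) : ℝ) * ((1 - γ) ^ s * n.factorial) := by
          refine Finset.sum_le_sum fun q _ => ?_
          refine (Nat.cast_le (α := ℝ).2 Finset.card_image_le).trans ?_
          exact card_perm_few_hits_le hγ1 (G q.1 q.2) C hCcard (hGcard q.1 q.2)
      _ = _ := by
          rw [Finset.sum_const, Finset.card_univ, Fintype.card_prod, Fintype.card_fun, ZMod.card,
            Fintype.card_fin, Fintype.card_fin, nsmul_eq_mul]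
          push_cast
          ring
  have hs0 : 0 < s := by omega
  have hpow := one_sub_pow_le hγ0 hγ1 hs0
  have hnum := not_regular_numeric (D := D) (X := X) (h := 2 ^ k) (s := s)
    (by exact_mod_cast hX16) (by rw [sq]; exact_mod_cast hXX)
    (by
      have h1 : D ≤ 4 * X ^ 2 := by nlinarith
      exact_mod_cast h1)
    h2k1 (by exact_mod_cast h2k)
    (by
      have h1 : X ≤ s * 16 := by omega
      rw [div_le_iff₀ (by norm_num)]
      exact_mod_cast h1)
  calc _ ≤ 9 * 2 ^ k * (2 * X + 1) * ((1 - γ) ^ s * n.factorial) * (D : ℝ) :=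
        mul_le_mul_of_nonneg_right hcard (Nat.cast_nonneg _)
    _ ≤ 9 * 2 ^ k * (2 * X + 1) * ((Nat.factorial 8 : ℝ) / (γ * s) ^ 8 * n.factorial) * (D : ℝ) := by
        gcongr
    _ = (9 * 2 ^ k * (2 * X + 1) * ((Nat.factorial 8 : ℝ) / (γ * s) ^ 8) * D) * n.factorial := by
        ring
    _ ≤ _ := mul_le_mul_of_nonneg_right hnum (Nat.cast_nonneg _)

/-! ### A near-optimal quantizer whose pairs are regular -/

/-- The total distortion between two blocks. -/
def totalDistortion (ρ : ℕ+ → ℕ+ → ℝ) {n : ℕ} (x y : Block n) : ℝ := ∑ i, ρ (x i) (y i)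

theorem totalDistortion_nonneg {ρ : ℕ+ → ℕ+ → ℝ} (hρ : IsDistortion ρ) {n : ℕ} (x y : Block n) :
    0 ≤ totalDistortion ρ x y := Finset.sum_nonneg fun _ _ => hρ.nonneg _ _

theorem totalDistortion_self {ρ : ℕ+ → ℕ+ → ℝ} (hρ : IsDistortion ρ) {n : ℕ} (x : Block n) :
    totalDistortion ρ x x = 0 := Finset.sum_eq_zero fun _ _ => hρ.self _

theorem totalDistortion_comp (ρ : ℕ+ → ℕ+ → ℝ) {n : ℕ} (x y : Block n) (σ : Equiv.Perm (Fin n)) :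
    totalDistortion ρ (x ∘ σ) (y ∘ σ) = totalDistortion ρ x y :=
  Equiv.sum_comp σ fun i => ρ (x i) (y i)

/-- Permuting positions is a bijection of the type class that carries the cells of one map to those
of the other. -/
theorem classInfo_conj {n : ℕ} (ψ : Block n → Block n) (σ : Equiv.Perm (Fin n)) (x : Block n) :
    classInfo (fun y => ψ (y ∘ σ) ∘ σ.symm) x = classInfo ψ (x ∘ σ) := by
  classical
  have h1 : typeClass (x ∘ σ) = typeClass x := typeClass_eq (typ_comp x σ)
  have h2 : (classCell (fun y => ψ (y ∘ σ) ∘ σ.symm) x).card = (classCell ψ (x ∘ σ)).card := by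
    refine Finset.card_bij' (fun y _ => y ∘ σ) (fun y _ => y ∘ σ.symm) ?_ ?_ ?_ ?_
    · intro y hy
      simp only [classCell, Finset.mem_filter, h1] at hy ⊢
      refine ⟨(comp_mem_typeClass σ).2 hy.1, ?_⟩
      have := congrArg (· ∘ σ) hy.2
      simpa [Function.comp_assoc] using this
    · intro y hy
      simp only [classCell, Finset.mem_filter, h1] at hy ⊢
      refine ⟨(comp_mem_typeClass σ.symm).2 hy.1, ?_⟩
      simp [Function.comp_assoc, hy.2]
    · intro y _; simp [Function.comp_assoc]
    · intro y _; simp [Function.comp_assoc]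
  rw [classInfo, classInfo, h1, h2]

theorem sum_typeClass_comp {n : ℕ} (F : Block n → ℝ) (σ : Equiv.Perm (Fin n)) (x₀ : Block n) :
    ∑ x ∈ typeClass x₀, F (x ∘ σ) = ∑ x ∈ typeClass x₀, F x := by
  refine Finset.sum_bij' (fun y _ => y ∘ σ) (fun y _ => y ∘ σ.symm) ?_ ?_ ?_ ?_ ?_
  · intro y hy; exact (comp_mem_typeClass σ).2 hy
  · intro y hy; exact (comp_mem_typeClass σ.symm).2 hy
  · intro y _; simp [Function.comp_assoc]
  · intro y _; simp [Function.comp_assoc]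
  · intro y _; rfl

open Classical in
/-- The Hamming distance if the pair is irregular although it is not close, and zero otherwise. -/
noncomputable def irregularity {n κ u : ℕ} (𝓗 : PositionHash n κ u) (ρ : ℕ+ → ℕ+ → ℝ) (t : ℝ)
    (v w : Block n) : ℝ :=
  if 256 ≤ hammingDist v w ∧ 8 * tailCount u v < hammingDist v w ∧ ¬ 𝓗.Regular ρ t v w
  then hammingDist v w else 0

theorem sum_irregularity_le {n u : ℕ} (hn : 2 ^ 24 ≤ n)
    (𝓗 : PositionHash n (Nat.log 2 n / 4) u) {ρ : ℕ+ → ℕ+ → ℝ} (hρ : IsDistortion ρ) {t : ℝ}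
    {v w : Block n} (ht : totalDistortion ρ v w ≤ t) :
    ∑ σ : Equiv.Perm (Fin n), irregularity 𝓗 ρ t (v ∘ σ) (w ∘ σ) ≤
      3456 * Nat.factorial 8 * 2304 ^ 8 * n.factorial := by
  classical
  simp only [irregularity, hammingDist_comp_perm, tailCount_comp]
  by_cases h : 256 ≤ hammingDist v w ∧ 8 * tailCount u v < hammingDist v w
  · refine le_trans (le_of_eq ?_) (card_not_regular_mul_le hn 𝓗 hρ ht h.1 h.2)
    rw [Finset.card_filter, Nat.cast_sum, Finset.sum_mul]
    refine Finset.sum_congr rfl fun σ _ => ?_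
    by_cases hσ : 𝓗.Regular ρ t (v ∘ σ) (w ∘ σ) <;> simp [h, hσ]
  · rw [Finset.sum_eq_zero]
    · positivity
    · intro σ _
      rw [if_neg fun h' => h ⟨h'.1, h'.2.1⟩]

/-- For each pair the average irregularity over all permutations is bounded, so on every class some
permutation achieves the bound for the sum. Conjugating a near-optimal covering by it, separately
for each type, affects neither distortion nor class information. -/
theorem exists_regular_quantizer {n u : ℕ} (hn : 2 ^ 24 ≤ n)
    (𝓗 : PositionHash n (Nat.log 2 n / 4) u) {ρ : ℕ+ → ℕ+ → ℝ} (hρ : IsDistortion ρ) {t : ℝ}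
    (ht : 0 ≤ t) :
    ∃ φ : Block n → Block n, (∀ x, totalDistortion ρ x (φ x) ≤ t) ∧
      (∀ g : Block n → Block n, (∀ x, totalDistortion ρ x (g x) ≤ t) → ∀ x₀,
        ∑ x ∈ typeClass x₀, classInfo φ x ≤ ∑ x ∈ typeClass x₀, (classInfo g x + 1)) ∧
      ∀ x₀, ∑ x ∈ typeClass x₀, irregularity 𝓗 ρ t x (φ x) ≤
        3456 * Nat.factorial 8 * 2304 ^ 8 * (typeClass x₀).card := by
  classical
  obtain ⟨ψ, hψ1, hψ2⟩ := exists_near_optimal (n := n) (fun x y => totalDistortion ρ x y ≤ t)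
    fun x => by rw [totalDistortion_self hρ]; exact ht
  have key : ∀ T : Multiset ℕ+, ∃ σ : Equiv.Perm (Fin n), ∀ x₀ : Block n, typ x₀ = T →
      ∑ x ∈ typeClass x₀, irregularity 𝓗 ρ t (x ∘ σ) (ψ x ∘ σ) ≤
        3456 * Nat.factorial 8 * 2304 ^ 8 * (typeClass x₀).card := by
    intro T
    by_cases hT : ∃ x₁ : Block n, typ x₁ = T
    · obtain ⟨x₁, rfl⟩ := hT
      obtain ⟨σ, -, hσ⟩ := Finset.exists_le_of_sum_le
        (s := (Finset.univ : Finset (Equiv.Perm (Fin n))))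
        (f := fun σ : Equiv.Perm (Fin n) => ∑ x ∈ typeClass x₁, irregularity 𝓗 ρ t (x ∘ σ) (ψ x ∘ σ))
        (g := fun _ => 3456 * Nat.factorial 8 * 2304 ^ 8 * (typeClass x₁).card)
        Finset.univ_nonempty (by
          rw [Finset.sum_comm]
          refine (Finset.sum_le_sum fun x _ => sum_irregularity_le hn 𝓗 hρ (hψ1 x)).trans ?_
          rw [Finset.sum_const, Finset.sum_const, Finset.card_univ, Fintype.card_perm,
            Fintype.card_fin, nsmul_eq_mul, nsmul_eq_mul]
          apply le_of_eq; ring)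
      refine ⟨σ, fun x₀ hx₀ => ?_⟩
      rw [typeClass_eq hx₀]
      exact hσ
    · exact ⟨1, fun x₀ h => absurd ⟨x₀, h⟩ hT⟩
  choose σ hσ using key
  have hclass : ∀ x₀ : Block n, ∀ x ∈ typeClass x₀, typ x = typ x₀ := fun x₀ x hx => mem_typeClass.1 hx
  refine ⟨fun x => ψ (x ∘ (σ (typ x)).symm) ∘ σ (typ x), fun x => ?_, fun g hg x₀ => ?_, fun x₀ => ?_⟩
  · have := hψ1 (x ∘ (σ (typ x)).symm)
    rw [← totalDistortion_comp ρ _ _ (σ (typ x))] at this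
    simpa [Function.comp_assoc] using this
  · refine le_trans (le_of_eq ?_) (hψ2 g hg x₀)
    rw [← sum_typeClass_comp (fun x => classInfo ψ x) (σ (typ x₀)).symm]
    refine Finset.sum_congr rfl fun x hx => ?_
    rw [← classInfo_conj]
    refine classInfo_congr fun y hy => ?_
    simp only [hclass _ _ hy, hclass _ _ hx, Equiv.symm_symm]
  · rw [← sum_typeClass_comp _ (σ (typ x₀))]
    refine le_trans (le_of_eq ?_) (hσ (typ x₀) x₀ rfl)
    refine Finset.sum_congr rfl fun x hx => ?_
    simp only [typ_comp, hclass _ _ hx]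
    simp [Function.comp_assoc]

/-! ### Edits of a block -/

/-- The blocks obtained from `y` by at most `r` single-letter changes from the list `P`. -/
def edits {n : ℕ} (P : Finset (Fin n × ℕ+)) (y : Block n) : ℕ → Finset (Block n)
  | 0 => {y}
  | r + 1 => edits P y r ∪
      open Classical in (edits P y r ×ˢ P).image fun q => Function.update q.1 q.2.1 q.2.2

theorem card_edits_le {n : ℕ} (P : Finset (Fin n × ℕ+)) (y : Block n) (r : ℕ) :
    (edits P y r).card ≤ (P.card + 1) ^ r := by
  classical
  induction r with
  | zero => simp [edits]
  | succ r ih =>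
    rw [edits]
    refine (Finset.card_union_le _ _).trans ?_
    calc _ ≤ (edits P y r).card + (edits P y r).card * P.card := by
          refine Nat.add_le_add_left (Finset.card_image_le.trans ?_) _
          rw [Finset.card_product]
      _ = (edits P y r).card * (P.card + 1) := by ring
      _ ≤ _ := by rw [pow_succ]; exact Nat.mul_le_mul_right _ ih

/-- Undo the edit at one position where `b` and `y` differ and apply induction to the distance. -/
theorem mem_edits {n : ℕ} {P : Finset (Fin n × ℕ+)} {y : Block n} :
    ∀ {r : ℕ} {b : Block n}, hammingDist b y ≤ r → (∀ p, b p ≠ y p → (p, b p) ∈ P) → b ∈ edits P y r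
  | 0, b, h, _ => by
    have := hammingDist_eq_zero.1 (Nat.le_zero.1 h)
    simp [edits, this]
  | r + 1, b, h, hP => by
    classical
    rw [edits]
    by_cases hb : hammingDist b y ≤ r
    · exact Finset.mem_union_left _ (mem_edits hb hP)
    · have hne : b ≠ y := by rintro rfl; simp at hb
      obtain ⟨p, hp⟩ := Function.ne_iff.1 hne
      refine Finset.mem_union_right _ (Finset.mem_image.2
        ⟨(Function.update b p (y p), (p, b p)), ?_, by simp⟩)
      refine Finset.mem_product.2 ⟨mem_edits ?_ ?_, hP p hp⟩
      · unfold hammingDist at h ⊢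
        refine Nat.le_of_lt_succ (lt_of_lt_of_le (Finset.card_lt_card ?_) h)
        refine (Finset.ssubset_iff_of_subset fun q hq => ?_).2 ⟨p, by simpa using hp, by simp⟩
        simp only [Finset.mem_filter, Finset.mem_univ, true_and] at hq ⊢
        by_cases hqp : q = p
        · subst hqp; simp at hq
        · rwa [Function.update_of_ne hqp] at hq
      · intro q hq
        by_cases hqp : q = p
        · subst hqp; simp at hq
        · simp only [Function.update_of_ne hqp] at hq ⊢
          exact hP q hq

/-! ### Paths to prototypes -/

section Paths

variable {n κ u : ℕ} (𝓗 : PositionHash n κ u) (ρ : ℕ+ → ℕ+ → ℝ) (t : ℝ) (φ : Block n → Block n)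

/-- The blocks that become prototypes. -/
def IsPrototype (v : Block n) : Prop :=
  hammingDist v (φ v) < 256 ∨ hammingDist v (φ v) ≤ 8 * tailCount u v ∨
    ¬ 𝓗.Regular ρ t v (φ v) ∨ 𝓗.Vanishes (Nat.log 2 (hammingDist v (φ v)) / 8) v

/-- The blocks obtained from `v` by replacing at most 18 letters by those of `φ v`. -/
def exchanges (v : Block n) : Finset (Block n) :=
  open Classical in
  edits ((Finset.univ.filter fun p => v p ≠ φ v p).image fun p => (p, φ v p)) v 18

/-- The blocks reached by exchanges that square the distance to the image under `φ`. -/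
def reach : ℕ → Block n → Finset (Block n)
  | 0, v => {v}
  | s + 1, v => open Classical in
    if 2 ≤ hammingDist v (φ v) then
      insert v ((exchanges φ v).biUnion fun v' =>
        if hammingDist v (φ v) ^ 2 < hammingDist v' (φ v') then reach s v' else {v'})
    else {v}

theorem card_exchanges_le (v : Block n) : (exchanges φ v).card ≤ (hammingDist v (φ v) + 1) ^ 18 := by
  classical
  refine (card_edits_le _ _ _).trans (Nat.pow_le_pow_left (Nat.add_le_add_right ?_ 1) _)
  exact Finset.card_image_le

theorem hammingDist_le {n : ℕ} (v w : Block n) : hammingDist v w ≤ n :=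
  hammingDist_le_card_fintype.trans_eq (Fintype.card_fin n)

/-- The power of the distance makes the induction close. The branching at distance `D` is at most `D
^ 36`, and each further branch starts at a distance above `D ^ 2`, which gains the factor `D ^ 74`.
-/
theorem card_reach_mul_le (s : ℕ) : ∀ v : Block n, 2 ≤ hammingDist v (φ v) →
    (reach φ s v).card * hammingDist v (φ v) ^ 37 ≤ n ^ 74 := by
  classical
  induction s with
  | zero =>
    intro v hv
    rw [reach, Finset.card_singleton, one_mul]
    have h1 := hammingDist_le v (φ v)
    exact (Nat.pow_le_pow_left h1 37).trans (Nat.pow_le_pow_right (by omega) (by norm_num))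
  | succ s ih =>
    intro v hv
    set D := hammingDist v (φ v) with hD
    have hDn : D ≤ n := hammingDist_le v (φ v)
    have hsum : (reach φ (s + 1) v).card ≤ 1 + ∑ v' ∈ exchanges φ v,
        (if D ^ 2 < hammingDist v' (φ v') then reach φ s v' else {v'}).card := by
      rw [reach, if_pos hv, add_comm]
      exact (Finset.card_insert_le _ _).trans (Nat.add_le_add_right Finset.card_biUnion_le 1)
    have hterm : ∀ v' ∈ exchanges φ v,
        (if D ^ 2 < hammingDist v' (φ v') then reach φ s v' else {v'}).card * D ^ 74 ≤ n ^ 74 := by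
      intro v' _
      split_ifs with h
      · refine le_trans ?_ (ih v' (by nlinarith))
        refine Nat.mul_le_mul_left _ ?_
        calc D ^ 74 = (D ^ 2) ^ 37 := by rw [← pow_mul]
          _ ≤ _ := Nat.pow_le_pow_left h.le 37
      · rw [Finset.card_singleton, one_mul]
        exact Nat.pow_le_pow_left hDn _
    have hexch : (exchanges φ v).card ≤ D ^ 36 := by
      refine (card_exchanges_le φ v).trans ?_
      calc (D + 1) ^ 18 ≤ (D ^ 2) ^ 18 := Nat.pow_le_pow_left (by nlinarith) 18
        _ = D ^ 36 := by rw [← pow_mul]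
    have h36 : 1 ≤ D ^ 36 := Nat.one_le_pow _ _ (by omega)
    have hmul : (reach φ (s + 1) v).card * D ^ 74 ≤ D ^ 37 * n ^ 74 := by
      calc _ ≤ (1 + ∑ v' ∈ exchanges φ v,
            (if D ^ 2 < hammingDist v' (φ v') then reach φ s v' else {v'}).card) * D ^ 74 :=
            Nat.mul_le_mul_right _ hsum
        _ = D ^ 74 + ∑ v' ∈ exchanges φ v,
            (if D ^ 2 < hammingDist v' (φ v') then reach φ s v' else {v'}).card * D ^ 74 := by
            rw [add_mul, one_mul, Finset.sum_mul]
        _ ≤ n ^ 74 + ∑ v' ∈ exchanges φ v, n ^ 74 :=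
            Nat.add_le_add (Nat.pow_le_pow_left hDn _) (Finset.sum_le_sum hterm)
        _ = (1 + (exchanges φ v).card) * n ^ 74 := by
            rw [Finset.sum_const, smul_eq_mul]; ring
        _ ≤ (2 * D ^ 36) * n ^ 74 := Nat.mul_le_mul_right _ (by omega)
        _ ≤ (D * D ^ 36) * n ^ 74 := by gcongr
        _ = _ := by ring
    refine le_of_mul_le_mul_left (a := D ^ 37) ?_ (by positivity)
    calc _ = (reach φ (s + 1) v).card * D ^ 74 := by ring
      _ ≤ _ := hmul

theorem card_reach_le (hn : 1 ≤ n) (s : ℕ) (v : Block n) : (reach φ s v).card ≤ n ^ 74 := by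
  classical
  have h1 : 1 ≤ n ^ 74 := Nat.one_le_pow _ _ hn
  by_cases h : 2 ≤ hammingDist v (φ v)
  · refine le_trans ?_ (card_reach_mul_le φ s v h)
    exact Nat.le_mul_of_pos_right _ (by positivity)
  · cases s with
    | zero => simpa [reach] using h1
    | succ s => rw [reach, if_neg h]; simpa using h1

variable {ρ t φ}

/-- This explains the two levels: exchanges create a vanishing hash to level `log D / 4`, while
membership tests only `log D' / 8`, so the test is met whenever the distance has not more than
squared. -/
theorem log_sq_div_eight_le {D D' : ℕ} (h : D' ≤ D ^ 2) :
    Nat.log 2 D' / 8 ≤ Nat.log 2 D / 4 := by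
  have h1 : D' < 2 ^ (2 * (Nat.log 2 D + 1)) := by
    calc D' ≤ D ^ 2 := h
      _ < (2 ^ (Nat.log 2 D + 1)) ^ 2 :=
        Nat.pow_lt_pow_left (Nat.lt_pow_succ_log_self (by norm_num) D) (by norm_num)
      _ = _ := by rw [← pow_mul, mul_comm]
  have h2 : Nat.log 2 D' < 2 * (Nat.log 2 D + 1) := by
    rcases Nat.eq_zero_or_pos D' with rfl | h0
    · simp
    · exact Nat.log_lt_of_lt_pow (by omega) h1
  omega

theorem hammingDist_piecewise_le (J : Finset (Fin n)) (w v : Block n) :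
    open Classical in hammingDist (J.piecewise w v) v ≤ J.card := by
  classical
  refine Finset.card_le_card fun p hp => ?_
  by_contra h
  simp [Finset.piecewise_eq_of_notMem _ _ _ h] at hp

theorem isPrototype_of_vanishes {v v' : Block n}
    (hv' : 𝓗.Vanishes (Nat.log 2 (hammingDist v (φ v)) / 4) v')
    (h : hammingDist v' (φ v') ≤ hammingDist v (φ v) ^ 2) : IsPrototype 𝓗 ρ t φ v' :=
  Or.inr (Or.inr (Or.inr (hv'.mono (log_sq_div_eight_le h))))

theorem exists_option {v : Block n} (hreg : 𝓗.Regular ρ t v (φ v)) (X : Finset (Fin n))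
    (hX : X.card ≤ 2 * Nat.sqrt (hammingDist v (φ v))) (l : Fin 9)
    (r : Fin (Nat.log 2 (hammingDist v (φ v)) / 4) → ZMod 2) :
    ∃ p ∈ cheap ρ t v (φ v), p ∉ X ∧ 𝓗.channel p = some l ∧ 𝓗.bit p (v p) ≠ 𝓗.bit p (φ v p) ∧
      ∀ i : Fin (Nat.log 2 (hammingDist v (φ v)) / 4), 𝓗.vec p i = r i := by
  classical
  obtain ⟨p, hp, hpX⟩ := Finset.exists_mem_notMem_of_card_lt_card (hX.trans_lt (hreg l r))
  obtain ⟨hp1, hp2⟩ := Finset.mem_filter.1 hp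
  exact ⟨p, hp1, hpX, hp2⟩

/-- From a block with some slack in the distortion a prototype can be reached. -/
theorem exists_prototype_of_slack (hρ : IsDistortion ρ) (ht : 0 ≤ t) (x : Block n) (s : ℕ) :
    ∀ v : Block n, n < hammingDist v (φ v) + s → 256 ≤ hammingDist v (φ v) →
      hammingDist x v ^ 2 ≤ hammingDist v (φ v) →
      totalDistortion ρ x v * hammingDist v (φ v) ≤ t * (hammingDist v (φ v) - 72) →
      ∃ b ∈ reach φ s v, IsPrototype 𝓗 ρ t φ b ∧ totalDistortion ρ x b ≤ t := by
  classical
  induction s with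
  | zero =>
    intro v hv
    have := hammingDist_le v (φ v)
    omega
  | succ s ih =>
    intro v hv hD256 hxv hslack
    set D := hammingDist v (φ v) with hD
    have hD0 : (256 : ℝ) ≤ D := by exact_mod_cast hD256
    have hle_t : ∀ {z : ℝ}, z * D ≤ t * D → z ≤ t := fun h => le_of_mul_le_mul_right h (by linarith)
    rw [reach, if_pos (by omega)]
    by_cases hproto : IsPrototype 𝓗 ρ t φ v
    · exact ⟨v, Finset.mem_insert_self _ _, hproto, hle_t (by nlinarith)⟩
    have hreg : 𝓗.Regular ρ t v (φ v) := by
      by_contra h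
      exact hproto (Or.inr (Or.inr (Or.inl h)))
    -- Exchanges avoid the positions where `x` and `v` already differ. There the new letter would
    -- have to be compared with `x`, while elsewhere its cost is that of a cheap pair. Regularity
    -- leaves options since `X` has at most `√D` elements.
    set X := Finset.univ.filter fun i => x i ≠ v i with hX
    have hXcard : X.card = hammingDist x v := rfl
    have hXs : X.card ≤ Nat.sqrt D := by
      rw [hXcard, Nat.le_sqrt']; exact hxv
    have hsq16 : 16 ≤ Nat.sqrt D := Nat.le_sqrt.2 (by omega)
    obtain ⟨J, hJ, hJcard, hJv⟩ := 𝓗.exists_vanishes_piecewise (k := Nat.log 2 D / 4)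
      (C := cheap ρ t v (φ v) \ X) (z := v) (z' := φ v) (by
        intro l r Y hY
        obtain ⟨p, hp, hpX, hp2⟩ := exists_option 𝓗 hreg (X ∪ Y)
          ((Finset.card_union_le _ _).trans (by rw [← hD]; omega)) l r
        rw [Finset.mem_union, not_or] at hpX
        exact ⟨p, Finset.mem_sdiff.2 ⟨hp, hpX.1⟩, hpX.2, hp2⟩)
    set v' := J.piecewise (φ v) v with hv'
    have hmem : v' ∈ exchanges φ v := by
      refine mem_edits ((hammingDist_piecewise_le J (φ v) v).trans hJcard) fun p hp => ?_
      have hpJ : p ∈ J := by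
        by_contra h
        exact hp (Finset.piecewise_eq_of_notMem _ _ _ h)
      have hp' : v' p = φ v p := Finset.piecewise_eq_of_mem _ _ _ hpJ
      rw [hp'] at hp ⊢
      exact Finset.mem_image.2 ⟨p, Finset.mem_filter.2 ⟨Finset.mem_univ _, fun h => hp h.symm⟩, rfl⟩
    -- Eighteen exchanges at no more than `2 t / D` each use `36 t / D`, half of the available
    -- slack.
    have hcost : totalDistortion ρ x v' * D ≤ t * (D - 36) := by
      have h1 : totalDistortion ρ x v' ≤ totalDistortion ρ x v + ∑ p ∈ J, ρ (v p) (φ v p) := by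
        rw [totalDistortion, totalDistortion, ← Finset.sum_filter_add_sum_filter_not _ (· ∈ J),
          ← Finset.sum_filter_add_sum_filter_not Finset.univ (· ∈ J) fun i => ρ (x i) (v i)]
        have e1 : ∑ i with i ∉ J, ρ (x i) (v' i) = ∑ i with i ∉ J, ρ (x i) (v i) := by
          refine Finset.sum_congr rfl fun i hi => ?_
          rw [hv', Finset.piecewise_eq_of_notMem _ _ _ (Finset.mem_filter.1 hi).2]
        have e2 : ∑ i with i ∈ J, ρ (x i) (v' i) = ∑ p ∈ J, ρ (v p) (φ v p) := by
          rw [Finset.filter_mem_eq_inter, Finset.univ_inter]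
          refine Finset.sum_congr rfl fun i hi => ?_
          have hiX : i ∉ X := (Finset.mem_sdiff.1 (hJ hi)).2
          have : x i = v i := by simpa [hX] using hiX
          rw [hv', Finset.piecewise_eq_of_mem _ _ _ hi, this]
        have e3 : 0 ≤ ∑ i with i ∈ J, ρ (x i) (v i) := Finset.sum_nonneg fun _ _ => hρ.nonneg _ _
        linarith
      have h2 : (∑ p ∈ J, ρ (v p) (φ v p)) * D ≤ 36 * t := by
        rw [Finset.sum_mul]
        calc _ ≤ ∑ _p ∈ J, 2 * t := Finset.sum_le_sum fun p hp =>
              (Finset.mem_filter.1 (Finset.mem_sdiff.1 (hJ hp)).1).2.2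
          _ = J.card * (2 * t) := by rw [Finset.sum_const, nsmul_eq_mul]
          _ ≤ 18 * (2 * t) := by
            refine mul_le_mul_of_nonneg_right ?_ (by linarith)
            exact_mod_cast hJcard
          _ = _ := by ring
      nlinarith
    by_cases hsq : D ^ 2 < hammingDist v' (φ v')
    · have hD' : (D : ℝ) ^ 2 < hammingDist v' (φ v') := by exact_mod_cast hsq
      have hDD : D * 256 ≤ D ^ 2 := by rw [sq]; exact Nat.mul_le_mul_left _ hD256
      obtain ⟨b, hb, hb1, hb2⟩ := ih v' (by omega) (by omega) (by
        have h1 : hammingDist x v' ≤ Nat.sqrt D + 18 := by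
          refine (hammingDist_triangle x v v').trans ?_
          have := hammingDist_piecewise_le J (φ v) v
          rw [hammingDist_comm] at this
          exact Nat.add_le_add (hXcard ▸ hXs) (this.trans hJcard)
        have h2 : Nat.sqrt D * Nat.sqrt D ≤ D := Nat.sqrt_le D
        refine le_trans ?_ hsq.le
        exact Nat.pow_le_pow_left (h1.trans (by nlinarith)) 2) (by
        have h3 : totalDistortion ρ x v' * D * hammingDist v' (φ v') ≤
            t * (D - 36) * hammingDist v' (φ v') :=
          mul_le_mul_of_nonneg_right hcost (Nat.cast_nonneg _)
        refine le_of_mul_le_mul_right ?_ (show (0 : ℝ) < D by linarith)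
        -- The remaining slack `36 t / D` exceeds the `72 t / D'` required at the new distance `D' >
        -- D ^ 2`.
        have h4 : 72 * (D : ℝ) ≤ 36 * hammingDist v' (φ v') := by nlinarith
        nlinarith [mul_le_mul_of_nonneg_left h4 ht])
      refine ⟨b, Finset.mem_insert_of_mem (Finset.mem_biUnion.2 ⟨v', hmem, ?_⟩), hb1, hb2⟩
      rw [if_pos hsq]; exact hb
    · refine ⟨v', Finset.mem_insert_of_mem (Finset.mem_biUnion.2 ⟨v', hmem, ?_⟩),
        isPrototype_of_vanishes 𝓗 hJv (not_lt.1 hsq), hle_t (hcost.trans (by nlinarith))⟩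
      rw [if_neg hsq]; exact Finset.mem_singleton_self _

variable (φ) in
/-- The blocks that serve as prototypes for `x`; they depend on `x` only through `φ x` and the
letters of `x`. -/
def candidates (x : Block n) : Finset (Block n) :=
  open Classical in
  (edits (Finset.univ ×ˢ (typ x).toFinset) (φ x) 19).biUnion (reach φ n)

theorem card_candidates_le (hn : 1 ≤ n) (x : Block n) :
    (candidates φ x).card ≤ (n * n + 1) ^ 19 * n ^ 74 := by
  classical
  refine Finset.card_biUnion_le.trans ((Finset.sum_le_sum fun z _ => card_reach_le φ hn n z).trans ?_)
  rw [Finset.sum_const, smul_eq_mul]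
  refine Nat.mul_le_mul_right _ ((card_edits_le _ _ _).trans ?_)
  refine Nat.pow_le_pow_left (Nat.add_le_add_right ?_ 1) _
  rw [Finset.card_product, Finset.card_univ, Fintype.card_fin]
  refine Nat.mul_le_mul_left _ ((Multiset.toFinset_card_le _).trans_eq ?_)
  simp [typ]

/-- This lets the candidate list serve as a kernel that is constant on the cells of `φ` within a
class. -/
theorem candidates_congr {x x' : Block n} (h : typ x = typ x') (h' : φ x = φ x') :
    candidates φ x = candidates φ x' := by rw [candidates, candidates, h, h']

theorem mem_typ {n : ℕ} (x : Block n) (p : Fin n) : x p ∈ (typ x).toFinset := by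
  rw [Multiset.mem_toFinset, typ, Multiset.mem_map]
  exact ⟨p, Finset.mem_univ_val p, rfl⟩

/-- Every block that is not a prototype has a prototype among its candidates. -/
theorem exists_prototype (hρ : IsDistortion ρ) (hφ : ∀ x, totalDistortion ρ x (φ x) ≤ t)
    {x : Block n} (hx : ¬ IsPrototype 𝓗 ρ t φ x) :
    ∃ b ∈ candidates φ x, IsPrototype 𝓗 ρ t φ b ∧ totalDistortion ρ x b ≤ t := by
  classical
  have ht : 0 ≤ t := (totalDistortion_nonneg hρ _ _).trans (hφ x)
  set D := hammingDist x (φ x) with hD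
  have hD256 : 256 ≤ D := by
    by_contra h
    exact hx (Or.inl (not_le.1 h))
  have hreg : 𝓗.Regular ρ t x (φ x) := by
    by_contra h
    exact hx (Or.inr (Or.inr (Or.inl h)))
  have hsq16 : 16 ≤ Nat.sqrt D := Nat.le_sqrt.2 (by omega)
  set S := Finset.univ.filter fun i => x i ≠ φ x i with hS
  have hScard : S.card = D := rfl
  -- Restoring the costliest letter saves at least a fraction `1 / D` of the distortion, which is
  -- the slack that starts the walk.
  obtain ⟨p₀, hp₀, hmax⟩ := S.exists_max_image (fun i => ρ (x i) (φ x i))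
    (Finset.card_pos.1 (by omega))
  set z := Function.update (φ x) p₀ (x p₀) with hz
  -- These exchanges go towards `x`, so they only lower the distortion. They avoid `p₀`, whose
  -- letter has been restored already.
  obtain ⟨J, hJ, hJcard, hJv⟩ := 𝓗.exists_vanishes_piecewise (k := Nat.log 2 D / 4)
    (C := cheap ρ t x (φ x) \ {p₀}) (z := z) (z' := x) (by
      intro l r Y hY
      obtain ⟨p, hp, hpX, hp1, hp2, hp3⟩ := exists_option 𝓗 hreg ({p₀} ∪ Y)
        ((Finset.card_union_le _ _).trans (by rw [Finset.card_singleton, ← hD]; omega)) l r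
      rw [Finset.mem_union, not_or] at hpX
      refine ⟨p, Finset.mem_sdiff.2 ⟨hp, hpX.1⟩, hpX.2, hp1, ?_, hp3⟩
      rw [hz, Function.update_of_ne (by simpa using hpX.1)]
      exact hp2.symm)
  set v := J.piecewise x z with hv
  have hvp : ∀ p, v p = x p ∨ (p ≠ p₀ ∧ v p = φ x p) := by
    intro p
    by_cases hp : p ∈ J
    · exact Or.inl (Finset.piecewise_eq_of_mem _ _ _ hp)
    · rw [hv, Finset.piecewise_eq_of_notMem _ _ _ hp]
      by_cases hpp : p = p₀
      · subst hpp; simp [hz]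
      · exact Or.inr ⟨hpp, by rw [hz, Function.update_of_ne hpp]⟩
  have hvp₀ : v p₀ = x p₀ := (hvp p₀).resolve_right fun h => h.1 rfl
  have hmem : v ∈ edits (Finset.univ ×ˢ (typ x).toFinset) (φ x) 19 := by
    refine mem_edits ?_ fun p hp => ?_
    · refine (hammingDist_triangle v z (φ x)).trans ?_
      refine (Nat.add_le_add ((hammingDist_piecewise_le J x z).trans hJcard) ?_ : _ ≤ 18 + 1)
      refine (Finset.card_le_card (t := {p₀}) fun p hp => ?_).trans_eq (Finset.card_singleton p₀)
      by_contra h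
      simp only [Finset.mem_filter, Finset.mem_univ, true_and] at hp
      exact hp (Function.update_of_ne (by simpa using h) _ _)
    · refine Finset.mem_product.2 ⟨Finset.mem_univ _, ?_⟩
      rcases hvp p with h | h
      · simp only [h]; exact mem_typ x p
      · exact absurd h.2 hp
  have hcost0 : totalDistortion ρ x v + ρ (x p₀) (φ x p₀) ≤ totalDistortion ρ x (φ x) := by
    rw [totalDistortion, totalDistortion, ← Finset.add_sum_erase _ _ (Finset.mem_univ p₀),
      ← Finset.add_sum_erase (a := p₀) _ (fun i => ρ (x i) (φ x i)) (Finset.mem_univ p₀), hvp₀, hρ.self]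
    have : ∑ i ∈ Finset.univ.erase p₀, ρ (x i) (v i) ≤ ∑ i ∈ Finset.univ.erase p₀, ρ (x i) (φ x i) := by
      refine Finset.sum_le_sum fun i _ => ?_
      rcases hvp i with h | h
      · rw [h, hρ.self]; exact hρ.nonneg _ _
      · rw [h.2]
    linarith
  have hmaxcost : totalDistortion ρ x (φ x) ≤ D * ρ (x p₀) (φ x p₀) := by
    rw [totalDistortion, ← hScard, ← nsmul_eq_mul]
    calc _ = ∑ i ∈ S, ρ (x i) (φ x i) := by
          rw [hS, Finset.sum_filter]
          refine Finset.sum_congr rfl fun i _ => ?_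
          by_cases h : x i = φ x i
          · rw [if_neg (not_not.2 h), h, hρ.self]
          · rw [if_pos h]
      _ ≤ _ := Finset.sum_le_card_nsmul _ _ _ hmax
  have hρ0 := hρ.nonneg (x p₀) (φ x p₀)
  by_cases hsq : D ^ 2 < hammingDist v (φ v)
  · have hDD : D * 256 ≤ D ^ 2 := by rw [sq]; exact Nat.mul_le_mul_left _ hD256
    have hslack : totalDistortion ρ x v * D ≤ t * (D - 1) := by
      have h1 := hφ x
      have h2 : (256 : ℝ) ≤ D := by exact_mod_cast hD256
      nlinarith
    -- The slack `t / D` covers the required `72 t / D'`, because the new distance `D'` exceeds `D ^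
    -- 2 ≥ 256 D`.
    obtain ⟨b, hb, hb1, hb2⟩ := exists_prototype_of_slack 𝓗 (φ := φ) hρ ht x n v (by omega) (by omega) (by
      refine le_trans (Nat.pow_le_pow_left ?_ 2) hsq.le
      refine Finset.card_le_card fun p hp => ?_
      simp only [Finset.mem_filter, Finset.mem_univ, true_and] at hp ⊢
      rcases hvp p with h | h
      · exact absurd h.symm hp
      · rwa [h.2] at hp) (by
      have h2 : (256 : ℝ) ≤ D := by exact_mod_cast hD256
      have h3 : (D : ℝ) * 256 ≤ hammingDist v (φ v) := by
        exact_mod_cast hDD.trans hsq.le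
      have h4 : totalDistortion ρ x v * D * hammingDist v (φ v) ≤ t * (D - 1) * hammingDist v (φ v) :=
        mul_le_mul_of_nonneg_right hslack (Nat.cast_nonneg _)
      refine le_of_mul_le_mul_right ?_ (show (0 : ℝ) < D by linarith)
      nlinarith [mul_le_mul_of_nonneg_left h3 ht])
    exact ⟨b, Finset.mem_biUnion.2 ⟨v, hmem, hb⟩, hb1, hb2⟩
  · refine ⟨v, Finset.mem_biUnion.2 ⟨v, hmem, ?_⟩, isPrototype_of_vanishes 𝓗 hJv (not_lt.1 hsq), ?_⟩
    · cases n with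
      | zero => exact absurd p₀.2 (by omega)
      | succ n =>
        rw [reach]
        split_ifs
        · exact Finset.mem_insert_self _ _
        · exact Finset.mem_singleton_self _
    · linarith [hφ x]

end Paths

/-! ### Codes from weights on the prototypes -/

theorem blockDistortion_le_iff {ρ : ℕ+ → ℕ+ → ℝ} {n : ℕ} (hn : 1 ≤ n) {d : ℝ} {x y : Block n} :
    blockDistortion ρ x y ≤ d ↔ totalDistortion ρ x y ≤ n * d := by
  have h : (0 : ℝ) < n := by exact_mod_cast hn
  rw [blockDistortion, one_div, inv_mul_le_iff₀ h, totalDistortion]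

theorem exists_code_of_weight {ρ : ℕ+ → ℕ+ → ℝ} {d : ℝ} {n : ℕ} (Q : Block n → Block n)
    (hQ : ∀ x, blockDistortion ρ x (Q x) ≤ d) (hQQ : ∀ x, Q (Q x) = Q x) (W : Block n → ℝ≥0∞)
    (hW : ∑' b, W b ≤ 1) (hpos : ∀ x, W (Q x) ≠ 0) :
    ∃ ξ : Code ρ d n, ∀ x, (ξ.length x : ℝ) ≤ Real.logb 2 (1 / (W (Q x)).toReal) + 2 := by
  have hsum : ∑' b : Set.range Q, W b ≤ 1 := (ENNReal.tsum_comp_le_tsum_of_injective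
    Subtype.val_injective W).trans hW
  have hsum' : ∑' b : Set.range Q, W b ≠ ∞ := ne_top_of_le_ne_top ENNReal.one_ne_top hsum
  have hne : ∀ b : Set.range Q, W b ≠ ∞ := fun b => ENNReal.ne_top_of_tsum_ne_top hsum' b
  obtain ⟨enc, h1, h2, h3⟩ := exists_prefix_code (fun b : Set.range Q => (W b).toReal)
    (fun b => by
      obtain ⟨_, x, rfl⟩ := b
      exact ENNReal.toReal_pos (hpos x) (hne ⟨Q x, x, rfl⟩))
    (ENNReal.summable_toReal hsum')
    (by
      rw [← ENNReal.tsum_toReal_eq hne]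
      exact ENNReal.toReal_le_of_le_ofReal zero_le_one (by simpa using hsum))
  have hinj : Function.Injective enc := fun b b' h => h2 b b' (h ▸ List.prefix_rfl)
  have : Nonempty (Set.range Q) := ⟨⟨Q fun _ => 1, Set.mem_range_self _⟩⟩
  refine ⟨{ quantizer := Q, encode := enc, decode := Function.invFun enc, distortion_le := hQ,
            quantizer_prototype := ?_, encode_ne_nil := h1, prefix_free := h2,
            decode_encode := Function.leftInverse_invFun hinj }, fun x => h3 _⟩
  rintro _ ⟨x, rfl⟩
  exact hQQ x

/-- A mixture over types of kernels that depend on a block only through its type and its image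
under `φ`: the code spends the self-information of `φ` given the type, and the cost of the type
and of the kernel. -/
theorem exists_code_of_kernel {ρ : ℕ+ → ℕ+ → ℝ} {d : ℝ} {n : ℕ} (Q φ : Block n → Block n)
    (hQ : ∀ x, blockDistortion ρ x (Q x) ≤ d) (hQQ : ∀ x, Q (Q x) = Q x)
    (w : Multiset ℕ+ → ℝ) (hw : ∀ T, 0 < w T)
    (hw1 : ∑' x : Block n, ENNReal.ofReal (w (typ x)) / (typeClass x).card ≤ 1)
    (K : Block n → Block n → ℝ≥0∞) (hK : ∀ x, ∑' b, K x b ≤ 1)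
    (hKφ : ∀ x x' b, typ x = typ x' → φ x = φ x' → K x b = K x' b)
    (c : Block n → ℝ) (hc : ∀ x, 0 < c x) (hKc : ∀ x, ENNReal.ofReal (c x) ≤ K x (Q x)) :
    ∃ ξ : Code ρ d n, ∀ x, (ξ.length x : ℝ) ≤
      Real.logb 2 (1 / w (typ x)) + classInfo φ x + Real.logb 2 (1 / c x) + 2 := by
  classical
  set q : Block n → ℝ≥0∞ := fun x => ENNReal.ofReal (w (typ x)) / (typeClass x).card with hq
  set W : Block n → ℝ≥0∞ := fun b => ∑' x, q x * K x b with hWdef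
  have hW : ∑' b, W b ≤ 1 := by
    rw [hWdef, ENNReal.tsum_comm]
    refine le_trans (ENNReal.tsum_le_tsum fun x => ?_) hw1
    rw [ENNReal.tsum_mul_left]
    exact mul_le_of_le_one_right' (hK x)
  have hcard : ∀ x : Block n, (0 : ℝ) < (typeClass x).card := fun x => by
    exact_mod_cast Finset.card_pos.2 ⟨x, self_mem_typeClass x⟩
  have hcell : ∀ x : Block n, (0 : ℝ) < (classCell φ x).card := fun x => by
    exact_mod_cast classCell_card_pos φ x
  -- All members of the cell of `x` send the same kernel weight to `Q x`. Their number divided by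
  -- the class size is the weight whose logarithm is `classInfo φ x`.
  have hlow : ∀ x, ENNReal.ofReal ((classCell φ x).card * (w (typ x) / (typeClass x).card * c x)) ≤
      W (Q x) := by
    intro x
    calc _ = ∑ x' ∈ classCell φ x, ENNReal.ofReal (w (typ x) / (typeClass x).card * c x) := by
          rw [Finset.sum_const, nsmul_eq_mul, ENNReal.ofReal_mul (Nat.cast_nonneg _),
            ENNReal.ofReal_natCast]
      _ ≤ ∑ x' ∈ classCell φ x, q x' * K x' (Q x) := by
          refine Finset.sum_le_sum fun x' hx' => ?_
          obtain ⟨h1, h2⟩ : typ x' = typ x ∧ φ x' = φ x := by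
            simpa [classCell, mem_typeClass] using hx'
          rw [hKφ x' x _ h1 h2, hq]
          simp only
          rw [h1, typeClass_eq h1, ENNReal.ofReal_mul (div_nonneg (hw _).le (Nat.cast_nonneg _)),
            ENNReal.ofReal_div_of_pos (hcard x), ENNReal.ofReal_natCast]
          exact mul_le_mul' le_rfl (hKc x)
      _ ≤ _ := ENNReal.sum_le_tsum _
  have hlow0 : ∀ x, 0 < (classCell φ x).card * (w (typ x) / (typeClass x).card * c x) := fun x =>
    mul_pos (hcell x) (mul_pos (div_pos (hw _) (hcard x)) (hc x))
  have hWne : ∀ x, W (Q x) ≠ ∞ := fun x =>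
    ENNReal.ne_top_of_tsum_ne_top (ne_top_of_le_ne_top ENNReal.one_ne_top hW) _
  obtain ⟨ξ, hξ⟩ := exists_code_of_weight Q hQ hQQ W hW fun x =>
    ((ENNReal.ofReal_pos.2 (hlow0 x)).trans_le (hlow x)).ne'
  refine ⟨ξ, fun x => (hξ x).trans ?_⟩
  have h1 := (ENNReal.ofReal_le_iff_le_toReal (hWne x)).1 (hlow x)
  have h2 : Real.logb 2 (1 / (W (Q x)).toReal) ≤ Real.logb 2
      (1 / ((classCell φ x).card * (w (typ x) / (typeClass x).card * c x))) :=
    Real.logb_le_logb_of_le (by norm_num) (by have := (hlow0 x).trans_le h1; positivity)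
      (one_div_le_one_div_of_le (hlow0 x) h1)
  have h3 : 1 / ((classCell φ x).card * (w (typ x) / (typeClass x).card * c x)) =
      1 / w (typ x) * ((typeClass x).card / (classCell φ x).card) * (1 / c x) := by
    have := hcard x; have := hcell x; have := hw (typ x); have := hc x
    field_simp
  rw [h3, Real.logb_mul, Real.logb_mul] at h2
  · rw [classInfo]; linarith
  · exact (one_div_pos.2 (hw _)).ne'
  · exact (div_pos (hcard x) (hcell x)).ne'
  · exact (mul_pos (one_div_pos.2 (hw _)) (div_pos (hcard x) (hcell x))).ne'
  · exact (one_div_pos.2 (hc x)).ne'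

/-! ### The cost of the prototypes -/

section Prototypes

variable {n κ u : ℕ} (𝓗 : PositionHash n κ u) {ρ : ℕ+ → ℕ+ → ℝ} {t : ℝ} (φ : Block n → Block n)

-- A vanishing block counted at level `k` has distance below `2 ^ (8k + 8)`, and level `k` has
-- density at most `2 ^ (-9k)`. The result is the geometric series `256 * ∑ 2 ^ (-k)`.
open Classical in
theorem sum_vanishes_le (hκ : Nat.log 2 n / 8 ≤ κ) (x₀ : Block n) :
    ∑ x ∈ typeClass x₀, (if 𝓗.Vanishes (Nat.log 2 (hammingDist x (φ x)) / 8) x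
      then (hammingDist x (φ x) : ℝ) else 0) ≤ 512 * (typeClass x₀).card := by
  set N : ℕ → ℝ := fun k => (((typeClass x₀).filter (𝓗.Vanishes k)).card : ℝ) with hN
  have hNk : ∀ k ∈ Finset.range (κ + 1), 2 ^ (8 * k + 8) * N k ≤
      256 * (1 / 2) ^ k * (typeClass x₀).card := by
    intro k hk
    have h1 := 𝓗.card_vanishes_le (Nat.lt_succ_iff.1 (Finset.mem_range.1 hk)) x₀
    have h2 : (2 : ℝ) ^ (9 * k) * N k ≤ (typeClass x₀).card := by
      have := (Nat.cast_le (α := ℝ)).2 h1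
      simpa using this
    have h3 : (2 : ℝ) ^ (8 * k + 8) = 256 * (1 / 2) ^ k * 2 ^ (9 * k) := by
      rw [show 9 * k = k + 8 * k by ring, pow_add, pow_add]
      have : (1 / 2 : ℝ) ^ k * 2 ^ k = 1 := by rw [← mul_pow]; norm_num
      linear_combination (-(256 : ℝ) * 2 ^ (8 * k)) * this
    rw [h3, mul_assoc]
    exact mul_le_mul_of_nonneg_left h2 (by positivity)
  calc _ ≤ ∑ x ∈ typeClass x₀, ∑ k ∈ Finset.range (κ + 1),
        (if 𝓗.Vanishes k x then (2 : ℝ) ^ (8 * k + 8) else 0) := by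
        refine Finset.sum_le_sum fun x _ => ?_
        set D := hammingDist x (φ x) with hD
        have hnn : ∀ k ∈ Finset.range (κ + 1),
            (0 : ℝ) ≤ (if 𝓗.Vanishes k x then (2 : ℝ) ^ (8 * k + 8) else 0) := by
          intro k _; split_ifs <;> positivity
        split_ifs with h
        · have hk : Nat.log 2 D / 8 ∈ Finset.range (κ + 1) := by
            have : Nat.log 2 D ≤ Nat.log 2 n := Nat.log_mono_right (hammingDist_le _ _)
            rw [Finset.mem_range]; omega
          refine le_trans ?_ (Finset.single_le_sum hnn hk)
          rw [if_pos h]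
          have h1 : D < 2 ^ (Nat.log 2 D + 1) := Nat.lt_pow_succ_log_self (by norm_num) D
          have h2 : 2 ^ (Nat.log 2 D + 1) ≤ 2 ^ (8 * (Nat.log 2 D / 8) + 8) :=
            Nat.pow_le_pow_right (by norm_num) (by omega)
          exact_mod_cast h1.le.trans h2
        · exact Finset.sum_nonneg hnn
    _ = ∑ k ∈ Finset.range (κ + 1), 2 ^ (8 * k + 8) * N k := by
        rw [Finset.sum_comm]
        refine Finset.sum_congr rfl fun k _ => ?_
        rw [← Finset.sum_filter, Finset.sum_const, nsmul_eq_mul, mul_comm]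
    _ ≤ ∑ k ∈ Finset.range (κ + 1), 256 * (1 / 2) ^ k * ((typeClass x₀).card : ℝ) :=
        Finset.sum_le_sum hNk
    _ = 256 * (∑ k ∈ Finset.range (κ + 1), (1 / 2 : ℝ) ^ k) * (typeClass x₀).card := by
        rw [← Finset.sum_mul, Finset.mul_sum]
    _ ≤ 256 * 2 * (typeClass x₀).card := by
        have : ∑ k ∈ Finset.range (κ + 1), (1 / 2 : ℝ) ^ k ≤ 2 := sum_geometric_two_le _
        gcongr
    _ = _ := by ring

-- The four reasons for being a prototype contribute 256, eight times the tail count, the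
-- irregularity, and the 512 of the vanishing blocks.
open Classical in
theorem sum_prototype_le (hκ : Nat.log 2 n / 8 ≤ κ) (x₀ : Block n) {C : ℝ}
    (hC : ∑ x ∈ typeClass x₀, irregularity 𝓗 ρ t x (φ x) ≤ C * (typeClass x₀).card) :
    ∑ x ∈ typeClass x₀, (if IsPrototype 𝓗 ρ t φ x then (hammingDist x (φ x) : ℝ) else 0) ≤
      ∑ x ∈ typeClass x₀, (768 + C + 8 * tailCount u x) := by
  have hpt : ∀ x, (if IsPrototype 𝓗 ρ t φ x then (hammingDist x (φ x) : ℝ) else 0) ≤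
      256 + 8 * tailCount u x + irregularity 𝓗 ρ t x (φ x) +
      (if 𝓗.Vanishes (Nat.log 2 (hammingDist x (φ x)) / 8) x
        then (hammingDist x (φ x) : ℝ) else 0) := by
    intro x
    set D := hammingDist x (φ x) with hD
    have hD0 : (0 : ℝ) ≤ D := Nat.cast_nonneg _
    have ht0 : (0 : ℝ) ≤ tailCount u x := Nat.cast_nonneg _
    have hi0 : 0 ≤ irregularity 𝓗 ρ t x (φ x) := by unfold irregularity; split_ifs <;> positivity
    have hv0 : (0 : ℝ) ≤ (if 𝓗.Vanishes (Nat.log 2 D / 8) x then (D : ℝ) else 0) := by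
      split_ifs <;> positivity
    split_ifs with h h'
    · linarith
    · by_cases h1 : D < 256
      · have : (D : ℝ) < 256 := by exact_mod_cast h1
        linarith
      by_cases h2 : D ≤ 8 * tailCount u x
      · have : (D : ℝ) ≤ 8 * tailCount u x := by exact_mod_cast h2
        linarith
      have h3 : ¬ 𝓗.Regular ρ t x (φ x) := by
        rcases h with h | h | h | h
        · exact absurd h h1
        · exact absurd h h2
        · exact h
        · exact absurd h h'
      have : irregularity 𝓗 ρ t x (φ x) = D := by
        rw [irregularity, if_pos ⟨not_lt.1 h1, not_le.1 h2, h3⟩]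
      linarith
    · linarith
    · linarith
  refine (Finset.sum_le_sum fun x _ => hpt x).trans ?_
  rw [Finset.sum_add_distrib, Finset.sum_add_distrib]
  have h1 := sum_vanishes_le 𝓗 φ hκ x₀
  have h2 : ∑ x ∈ typeClass x₀, (768 + C + 8 * (tailCount u x : ℝ)) =
      ∑ x ∈ typeClass x₀, (256 + 8 * (tailCount u x : ℝ)) + (C + 512) * (typeClass x₀).card := by
    rw [mul_comm, ← nsmul_eq_mul, ← Finset.sum_const, ← Finset.sum_add_distrib]
    exact Finset.sum_congr rfl fun x _ => by ring
  rw [h2]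
  linarith

open Classical in
/-- Given its type and its image under `φ`, a block is described by its differences from the image. -/
theorem sum_selfCode_le (hn : 1 ≤ n) (x : Block n) :
    ∑' b, (if typ b = typ x ∧ φ b = φ x then
      (((n + 1) * (n * n + 1) ^ hammingDist b (φ b) : ℕ) : ℝ≥0∞)⁻¹ else 0) ≤ 1 := by
  set P : Finset (Fin n × ℕ+) := Finset.univ ×ˢ (typ x).toFinset with hP
  have hPcard : P.card ≤ n * n := by
    rw [hP, Finset.card_product, Finset.card_univ, Fintype.card_fin]
    refine Nat.mul_le_mul_left _ ((Multiset.toFinset_card_le _).trans_eq ?_)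
    simp [typ]
  have hpt : ∀ b, (if typ b = typ x ∧ φ b = φ x then
      (((n + 1) * (n * n + 1) ^ hammingDist b (φ b) : ℕ) : ℝ≥0∞)⁻¹ else 0) ≤
      ∑ r ∈ Finset.range (n + 1), if b ∈ edits P (φ x) r then
        (((n + 1) * (n * n + 1) ^ r : ℕ) : ℝ≥0∞)⁻¹ else 0 := by
    intro b
    split_ifs with h
    · have hr : hammingDist b (φ b) ∈ Finset.range (n + 1) := by
        rw [Finset.mem_range]; exact Nat.lt_succ_of_le (hammingDist_le _ _)
      refine le_trans ?_ (Finset.single_le_sum (fun _ _ => zero_le) hr)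
      rw [if_pos]
      rw [← h.2]
      refine mem_edits le_rfl fun p _ => Finset.mem_product.2 ⟨Finset.mem_univ _, ?_⟩
      rw [← h.1]
      exact mem_typ b p
    · exact zero_le
  refine (ENNReal.tsum_le_tsum hpt).trans ?_
  rw [Summable.tsum_finsetSum fun _ _ => ENNReal.summable]
  -- At most `(n * n + 1) ^ r` blocks are within `r` edits of `φ x` using letters of the type; the
  -- distance `r` itself is uniform on `n + 1` values.
  calc _ ≤ ∑ r ∈ Finset.range (n + 1), ((n + 1 : ℕ) : ℝ≥0∞)⁻¹ := by
        refine Finset.sum_le_sum fun r _ => ?_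
        rw [tsum_eq_sum (s := edits P (φ x) r) fun b hb => if_neg hb, Finset.sum_ite_mem,
          Finset.inter_self, Finset.sum_const, nsmul_eq_mul]
        have h1 : (edits P (φ x) r).card ≤ (n * n + 1) ^ r :=
          (card_edits_le _ _ _).trans (Nat.pow_le_pow_left (Nat.add_le_add_right hPcard 1) r)
        have h2 : (((n * n + 1) ^ r : ℕ) : ℝ≥0∞) ≠ 0 := by
          rw [Nat.cast_ne_zero]; positivity
        calc _ ≤ (((n * n + 1) ^ r : ℕ) : ℝ≥0∞) * (((n + 1) * (n * n + 1) ^ r : ℕ) : ℝ≥0∞)⁻¹ :=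
              mul_le_mul' (Nat.cast_le.2 h1) le_rfl
          _ = _ := by
              rw [Nat.cast_mul, ENNReal.mul_inv (Or.inr (ENNReal.natCast_ne_top _)) (Or.inr h2),
                mul_left_comm, ENNReal.mul_inv_cancel h2 (ENNReal.natCast_ne_top _), mul_one]
    _ = 1 := by
        rw [Finset.sum_const, Finset.card_range, nsmul_eq_mul]
        exact ENNReal.mul_inv_cancel (by rw [Nat.cast_ne_zero]; omega) (ENNReal.natCast_ne_top _)

end Prototypes

/-! ### Assembling the prototype code -/

/-- The bound for the mean irregularity of a suitably rearranged quantizer. -/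
noncomputable def irregularityBound : ℝ := 3456 * Nat.factorial 8 * 2304 ^ 8

theorem irregularityBound_pos : 0 < irregularityBound := by unfold irregularityBound; positivity

theorem logb_natCast_le_mul {n N k : ℕ} (hN : 0 < N) (h : N ≤ n ^ k) :
    Real.logb 2 N ≤ k * Real.logb 2 n := by
  rw [← Real.logb_pow]
  exact Real.logb_le_logb_of_le (by norm_num) (by exact_mod_cast hN) (by exact_mod_cast h)

open Classical in
theorem exists_prototype_code {n u : ℕ} (hn : 2 ^ 24 ≤ n) (hu : u + 1 ≤ n) {ρ : ℕ+ → ℕ+ → ℝ}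
    (hρ : IsDistortion ρ) {d : ℝ} (hd : 0 ≤ d) (w : Multiset ℕ+ → ℝ) (hw : ∀ T, 0 < w T)
    (hw1 : ∑' x : Block n, ENNReal.ofReal (w (typ x)) / (typeClass x).card ≤ 1) :
    ∃ ξ : Code ρ d n, ∀ g : Block n → Block n, (∀ x, blockDistortion ρ x (g x) ≤ d) → ∀ x₀,
      ∑ x ∈ typeClass x₀, (ξ.length x : ℝ) ≤ ∑ x ∈ typeClass x₀, (classInfo g x +
        (Real.logb 2 (1 / w (typ x)) + (2463 + 3 * irregularityBound) * (Real.logb 2 n + 1) *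
          (1 + tailCount u x))) := by
  have hn1 : 1 ≤ n := by omega
  have hn32 : 32 ≤ n := by omega
  obtain ⟨𝓗⟩ := exists_positionHash hn hu
  set t : ℝ := n * d with ht
  obtain ⟨φ, hφ1, hφ2, hφ3⟩ := exists_regular_quantizer hn 𝓗 hρ (t := t) (by positivity)
  -- Prototypes are sent to themselves and every other block to a prototype, which makes the
  -- quantizer idempotent.
  have hQex : ∀ x, ∃ b, IsPrototype 𝓗 ρ t φ b ∧ totalDistortion ρ x b ≤ t ∧
      (IsPrototype 𝓗 ρ t φ x → b = x) ∧ (¬ IsPrototype 𝓗 ρ t φ x → b ∈ candidates φ x) := by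
    intro x
    by_cases hx : IsPrototype 𝓗 ρ t φ x
    · refine ⟨x, hx, ?_, fun _ => rfl, fun h => absurd hx h⟩
      rw [totalDistortion_self hρ]; positivity
    · obtain ⟨b, h1, h2, h3⟩ := exists_prototype 𝓗 hρ hφ1 hx
      exact ⟨b, h2, h3, fun h => absurd h hx, fun _ => h1⟩
  choose Q hQ1 hQ2 hQ3 hQ4 using hQex
  obtain ⟨N, hN⟩ : ∃ N, N = (n * n + 1) ^ 19 * n ^ 74 := ⟨_, rfl⟩
  set M : Block n → ℕ := fun x => (n + 1) * (n * n + 1) ^ hammingDist x (φ x) with hM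
  have hN0 : 0 < N := by rw [hN]; positivity
  have hM0 : ∀ x, 0 < M x := fun x => by positivity
  -- Half of the mass is reserved for naming a candidate, half for a prototype that describes itself
  -- by its differences from `φ`.
  set K : Block n → Block n → ℝ≥0∞ := fun x b =>
    (if b ∈ candidates φ x then ((2 * N : ℕ) : ℝ≥0∞)⁻¹ else 0) +
      2⁻¹ * (if typ b = typ x ∧ φ b = φ x then ((M b : ℕ) : ℝ≥0∞)⁻¹ else 0) with hK
  have hK1 : ∀ x, ∑' b, K x b ≤ 1 := by
    intro x
    rw [hK, ENNReal.tsum_add, ENNReal.tsum_mul_left]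
    have h1 : ∑' b, (if b ∈ candidates φ x then ((2 * N : ℕ) : ℝ≥0∞)⁻¹ else 0) ≤ 2⁻¹ := by
      rw [tsum_eq_sum (s := candidates φ x) fun b hb => if_neg hb, Finset.sum_ite_mem,
          Finset.inter_self, Finset.sum_const, nsmul_eq_mul]
      have h2 : ((N : ℕ) : ℝ≥0∞) ≠ 0 := by rw [Nat.cast_ne_zero]; exact hN0.ne'
      calc _ ≤ ((N : ℕ) : ℝ≥0∞) * ((2 * N : ℕ) : ℝ≥0∞)⁻¹ :=
            mul_le_mul' (Nat.cast_le.2 (hN ▸ card_candidates_le hn1 x)) le_rfl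
        _ = _ := by
            rw [Nat.cast_mul, ENNReal.mul_inv (Or.inr (ENNReal.natCast_ne_top _)) (Or.inr h2),
              mul_left_comm, ENNReal.mul_inv_cancel h2 (ENNReal.natCast_ne_top _), mul_one]
            rfl
    have h2 := sum_selfCode_le φ hn1 x
    calc _ ≤ (2⁻¹ : ℝ≥0∞) + 2⁻¹ * 1 := add_le_add h1 (mul_le_mul' le_rfl h2)
      _ = 1 := by rw [mul_one, ENNReal.inv_two_add_inv_two]
  set c : Block n → ℝ := fun x => if IsPrototype 𝓗 ρ t φ x then ((2 * M x : ℕ) : ℝ)⁻¹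
    else ((2 * N : ℕ) : ℝ)⁻¹ with hc
  have hc0 : ∀ x, 0 < c x := by
    intro x
    have := hM0 x
    simp only [hc]
    split_ifs <;> positivity
  have hof : ∀ m : ℕ, 0 < m → ENNReal.ofReal ((m : ℝ)⁻¹) = (m : ℝ≥0∞)⁻¹ := fun m hm => by
    rw [ENNReal.ofReal_inv_of_pos (by exact_mod_cast hm), ENNReal.ofReal_natCast]
  obtain ⟨ξ, hξ⟩ := exists_code_of_kernel Q φ (fun x => (blockDistortion_le_iff hn1).2 (hQ2 x))
    (fun x => hQ3 (Q x) (hQ1 x)) w hw hw1 K hK1 (fun x x' b h1 h2 => by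
      simp only [hK, candidates_congr h1 h2, h1, h2]) c hc0 (fun x => by
      simp only [hc, hK]
      by_cases h : IsPrototype 𝓗 ρ t φ x
      · rw [if_pos h, hof _ (by have := hM0 x; omega), hQ3 x h, if_pos (c := typ x = typ x ∧ φ x = φ x) ⟨rfl, rfl⟩]
        refine le_trans (le_of_eq ?_) le_add_self
        rw [Nat.cast_mul 2 (M x), ENNReal.mul_inv (Or.inl (by simp)) (Or.inl (by simp))]
        rfl
      · rw [if_neg h, hof _ (by omega), if_pos (hQ4 x h)]
        exact le_self_add)
  set L := Real.logb 2 n with hL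
  have hL0 : 0 ≤ L := Real.logb_nonneg (by norm_num) (by exact_mod_cast hn1)
  have hnn : n * n + 1 ≤ n ^ 3 := by
    calc n * n + 1 ≤ 2 * (n * n) := by nlinarith
      _ ≤ n * (n * n) := Nat.mul_le_mul_right _ (by omega)
      _ = n ^ 3 := by ring
  have hcL : ∀ x, Real.logb 2 (1 / c x) ≤ 132 * L +
      3 * L * (if IsPrototype 𝓗 ρ t φ x then (hammingDist x (φ x) : ℝ) else 0) := by
    intro x
    simp only [hc]
    split_ifs with h
    · have h1 : 2 * M x ≤ n ^ (3 + 3 * hammingDist x (φ x)) := by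
        calc 2 * M x = (2 * (n + 1)) * (n * n + 1) ^ hammingDist x (φ x) := by rw [hM]; ring
          _ ≤ n ^ 3 * (n ^ 3) ^ hammingDist x (φ x) := by
            refine Nat.mul_le_mul (le_trans ?_ hnn) (Nat.pow_le_pow_left hnn _)
            nlinarith
          _ = _ := by rw [← pow_mul, ← pow_add]
      have h2 := logb_natCast_le_mul (by have := hM0 x; omega) h1
      rw [one_div, inv_inv]
      refine h2.trans ?_
      push_cast
      rw [← hL]
      nlinarith
    · have h1 : 2 * N ≤ n ^ 132 := by
        calc 2 * N ≤ n * ((n ^ 3) ^ 19 * n ^ 74) := by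
              rw [hN]
              exact Nat.mul_le_mul (by omega) (Nat.mul_le_mul_right _ (Nat.pow_le_pow_left hnn _))
          _ = n ^ 132 := by ring
      have h2 := logb_natCast_le_mul (by omega) h1
      rw [one_div, inv_inv]
      refine h2.trans (le_of_eq ?_)
      push_cast
      ring
  refine ⟨ξ, fun g hg x₀ => ?_⟩
  have hκ : Nat.log 2 n / 8 ≤ Nat.log 2 n / 4 := Nat.div_le_div_left (by norm_num) (by norm_num)
  have h1 := hφ2 g (fun x => (blockDistortion_le_iff hn1).1 (hg x)) x₀
  have h2 := sum_prototype_le 𝓗 φ hκ x₀ (hφ3 x₀)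
  rw [← irregularityBound] at h2
  have hB := irregularityBound_pos
  calc ∑ x ∈ typeClass x₀, (ξ.length x : ℝ)
      ≤ ∑ x ∈ typeClass x₀, (Real.logb 2 (1 / w (typ x)) + classInfo φ x + (132 * L +
        3 * L * (if IsPrototype 𝓗 ρ t φ x then (hammingDist x (φ x) : ℝ) else 0)) + 2) :=
        Finset.sum_le_sum fun x _ => (hξ x).trans (by linarith [hcL x])
    _ = ∑ x ∈ typeClass x₀, classInfo φ x + 3 * L * (∑ x ∈ typeClass x₀,
          (if IsPrototype 𝓗 ρ t φ x then (hammingDist x (φ x) : ℝ) else 0)) +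
        ∑ x ∈ typeClass x₀, (Real.logb 2 (1 / w (typ x)) + 132 * L + 2) := by
        rw [Finset.mul_sum, ← Finset.sum_add_distrib, ← Finset.sum_add_distrib]
        exact Finset.sum_congr rfl fun x _ => by ring
    _ ≤ ∑ x ∈ typeClass x₀, (classInfo g x + 1) + 3 * L * (∑ x ∈ typeClass x₀,
          (768 + irregularityBound + 8 * (tailCount u x : ℝ))) +
        ∑ x ∈ typeClass x₀, (Real.logb 2 (1 / w (typ x)) + 132 * L + 2) := by
        gcongr
    _ = ∑ x ∈ typeClass x₀, (classInfo g x + (Real.logb 2 (1 / w (typ x)) + (3 + 132 * L +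
          3 * L * (768 + irregularityBound + 8 * (tailCount u x : ℝ))))) := by
        rw [Finset.mul_sum, ← Finset.sum_add_distrib, ← Finset.sum_add_distrib]
        exact Finset.sum_congr rfl fun x _ => by ring
    _ ≤ _ := by
        refine Finset.sum_le_sum fun x _ => ?_
        have hτ : (0 : ℝ) ≤ tailCount u x := Nat.cast_nonneg _
        have h3 := mul_nonneg hL0 hτ
        have h4 := mul_nonneg hB.le (mul_nonneg hL0 hτ)
        have h5 := mul_nonneg hB.le hτ
        nlinarith

/-! ### Weights of types -/

/-- The weight of a type: the counts of the letters up to `u` are described uniformly, and so is the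
number of larger letters, which are then listed with the weights `θ`. -/
noncomputable def typeWeight (n u : ℕ) (θ : ℕ+ → ℝ) (T : Multiset ℕ+) : ℝ :=
  (((n : ℝ) + 1) ^ (u + 1))⁻¹ * ((T.filter fun a : ℕ+ => u < (a : ℕ)).map θ).prod

theorem typeWeight_pos {n u : ℕ} {θ : ℕ+ → ℝ} (hθ : ∀ a, 0 < θ a) (T : Multiset ℕ+) :
    0 < typeWeight n u θ T := by
  refine mul_pos (by positivity) ?_
  refine Multiset.induction_on (T.filter fun a : ℕ+ => u < (a : ℕ)) (by simp) fun a s ih => ?_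
  rw [Multiset.map_cons, Multiset.prod_cons]
  exact mul_pos (hθ a) ih

theorem logb_typeWeight {n u : ℕ} {θ : ℕ+ → ℝ} (hθ : ∀ a, 0 < θ a) {m : ℕ} (x : Block m) :
    Real.logb 2 (1 / typeWeight n u θ (typ x)) = (u + 1) * Real.logb 2 (n + 1) +
      ∑ i, if u < (x i : ℕ) then Real.logb 2 (1 / θ (x i)) else 0 := by
  have h1 : ((typ x).filter fun a : ℕ+ => u < (a : ℕ)) =
      (Finset.univ.filter fun i => u < (x i : ℕ)).val.map x := by
    rw [typ, Multiset.filter_map]; rfl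
  have h2 : (((typ x).filter fun a : ℕ+ => u < (a : ℕ)).map θ).prod =
      ∏ i ∈ Finset.univ.filter fun i => u < (x i : ℕ), θ (x i) := by
    rw [h1, Multiset.map_map]; rfl
  rw [typeWeight, h2, one_div, Real.logb_inv, Real.logb_mul (by positivity)
    (Finset.prod_pos fun i _ => hθ _).ne', Real.logb_inv, Real.logb_pow,
    Real.logb_prod _ _ fun i _ => (hθ _).ne', ← Finset.sum_filter]
  simp only [one_div, Real.logb_inv, Finset.sum_neg_distrib]
  push_cast
  ring

theorem tsum_prod_eq_pow (a : ℕ+ → ℝ≥0∞) (k : ℕ) :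
    ∑' f : Fin k → ℕ+, ∏ i, a (f i) = (∑' x, a x) ^ k := by
  induction k with
  | zero => simp
  | succ k ih =>
    rw [← (Fin.consEquiv fun _ : Fin (k + 1) => ℕ+).tsum_eq, ENNReal.tsum_prod', pow_succ', ← ih,
      ← ENNReal.tsum_mul_right]
    refine tsum_congr fun x => ?_
    rw [← ENNReal.tsum_mul_left]
    refine tsum_congr fun f => ?_
    simp [Fin.consEquiv, Fin.prod_univ_succ]

/-- Lists of a fixed length have total weight at most one, and there are `n + 1` lengths. -/
theorem tsum_list_le {a : ℕ+ → ℝ≥0∞} (ha : ∑' x, a x ≤ 1) (n : ℕ) :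
    ∑' l : List ℕ+, (if l.length ≤ n then (l.map a).prod else 0) ≤ n + 1 := by
  rw [← List.equivSigmaTuple.symm.tsum_eq, ENNReal.tsum_sigma']
  have h : ∀ k : ℕ, ∑' f : Fin k → ℕ+, (if (List.equivSigmaTuple.symm ⟨k, f⟩).length ≤ n then
      ((List.equivSigmaTuple.symm ⟨k, f⟩).map a).prod else 0) ≤ if k < n + 1 then 1 else 0 := by
    intro k
    simp only [List.equivSigmaTuple, Equiv.coe_fn_symm_mk, List.length_ofFn, List.map_ofFn,
      List.prod_ofFn, Function.comp_apply, Nat.lt_succ_iff]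
    split_ifs with hk
    · rw [tsum_prod_eq_pow]; exact pow_le_one' ha k
    · simp
  refine (ENNReal.tsum_le_tsum h).trans ?_
  rw [tsum_eq_sum (s := Finset.range (n + 1)) fun k hk => if_neg (by simpa using hk)]
  rw [Finset.sum_congr rfl fun k hk => if_pos (Finset.mem_range.1 hk)]
  simp

theorem tsum_div_typeClass_card_le {n : ℕ} (g : Multiset ℕ+ → ℝ≥0∞) :
    ∑' x : Block n, g (typ x) / (typeClass x).card ≤ ∑' T : Set.range (typ (n := n)), g T := by
  classical
  rw [← (Equiv.sigmaFiberEquiv (Set.rangeFactorization (typ (n := n)))).tsum_eq, ENNReal.tsum_sigma']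
  refine ENNReal.tsum_le_tsum fun T => ?_
  obtain ⟨_, x₀, rfl⟩ := T
  have h : ∀ x : {x : Block n // Set.rangeFactorization typ x = ⟨typ x₀, x₀, rfl⟩}, typ (x : Block n) = typ x₀ :=
    fun x => congrArg Subtype.val x.2
  have h0 : ((typeClass x₀).card : ℝ≥0∞) ≠ 0 := by
    rw [Nat.cast_ne_zero]; exact (Finset.card_pos.2 ⟨x₀, self_mem_typeClass x₀⟩).ne'
  calc _ = ∑' x : {x : Block n // Set.rangeFactorization typ x = ⟨typ x₀, x₀, rfl⟩},
        g (typ x₀) / (typeClass x₀).card := by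
        refine tsum_congr fun x => ?_
        simp only [Equiv.sigmaFiberEquiv, Equiv.coe_fn_mk]
        rw [h x, typeClass_eq (h x)]
    _ ≤ ∑' x : typeClass x₀, g (typ x₀) / (typeClass x₀).card :=
        ENNReal.tsum_comp_le_tsum_of_injective
          (f := fun x : {x : Block n // Set.rangeFactorization typ x = ⟨typ x₀, x₀, rfl⟩} =>
            (⟨x, mem_typeClass.2 (h x)⟩ : typeClass x₀))
          (fun x y hxy => Subtype.ext (Subtype.mk.inj hxy))
          (fun _ => g (typ x₀) / (typeClass x₀).card)
    _ = (typeClass x₀).card * (g (typ x₀) / (typeClass x₀).card) := by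
        rw [tsum_fintype, Finset.sum_const, Finset.card_univ, Fintype.card_coe, nsmul_eq_mul]
    _ ≤ g (typ x₀) := (ENNReal.mul_div_cancel h0 (ENNReal.natCast_ne_top _)).le

theorem tsum_typeWeight_le {n u : ℕ} {θ : ℕ+ → ℝ} (hθ : ∀ a, 0 < θ a) (hs : Summable θ)
    (h1 : ∑' a, θ a ≤ 1) :
    ∑' x : Block n, ENNReal.ofReal (typeWeight n u θ (typ x)) / (typeClass x).card ≤ 1 := by
  classical
  refine (tsum_div_typeClass_card_le fun T => ENNReal.ofReal (typeWeight n u θ T)).trans ?_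
  set a : ℕ+ → ℝ≥0∞ := fun x => ENNReal.ofReal (θ x) with ha
  have ha1 : ∑' x, a x ≤ 1 := by
    rw [ha, ← ENNReal.ofReal_tsum_of_nonneg (fun x => (hθ x).le) hs]
    exact ENNReal.ofReal_le_one.2 h1
  set G : (Fin u → Fin (n + 1)) × List ℕ+ → ℝ≥0∞ := fun q =>
    (((n + 1 : ℕ) : ℝ≥0∞) ^ (u + 1))⁻¹ * (if q.2.length ≤ n then (q.2.map a).prod else 0) with hG
  -- Reduction modulo `n + 1` loses nothing since counts are at most `n`. With the list of large
  -- letters, the counts up to `u` determine the type.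
  set Φ : Set.range (typ (n := n)) → (Fin u → Fin (n + 1)) × List ℕ+ := fun T =>
    (fun i => Fin.ofNat (n + 1) ((T : Multiset ℕ+).count ⟨i + 1, Nat.succ_pos _⟩),
      ((T : Multiset ℕ+).filter fun a : ℕ+ => u < (a : ℕ)).toList) with hΦ
  have hcard : ∀ T : Set.range (typ (n := n)), Multiset.card (T : Multiset ℕ+) = n := by
    rintro ⟨_, x, rfl⟩
    simp [typ]
  have hinj : Function.Injective Φ := by
    intro T T' h
    obtain ⟨h2, h3⟩ := Prod.mk.inj h
    have h3' : (T : Multiset ℕ+).filter (fun a : ℕ+ => u < (a : ℕ)) =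
        (T' : Multiset ℕ+).filter (fun a : ℕ+ => u < (a : ℕ)) := by
      rw [← Multiset.coe_toList ((T : Multiset ℕ+).filter _), h3, Multiset.coe_toList]
    refine Subtype.ext (Multiset.ext.2 fun b => ?_)
    by_cases hb : u < (b : ℕ)
    · have := congrArg (Multiset.count b) h3'
      rwa [Multiset.count_filter, Multiset.count_filter, if_pos hb, if_pos hb] at this
    · have hb0 := b.pos
      have h4 := congrFun h2 ⟨(b : ℕ) - 1, by omega⟩
      have h5 : (⟨(b : ℕ) - 1 + 1, Nat.succ_pos _⟩ : ℕ+) = b := PNat.eq (Nat.sub_add_cancel hb0)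
      simp only [h5] at h4
      have h6 := congrArg Fin.val h4
      simp only [Fin.val_ofNat] at h6
      have e1 := (Multiset.count_le_card b (T : Multiset ℕ+)).trans_eq (hcard T)
      have e2 := (Multiset.count_le_card b (T' : Multiset ℕ+)).trans_eq (hcard T')
      rwa [Nat.mod_eq_of_lt (by omega), Nat.mod_eq_of_lt (by omega)] at h6
  have hlist : ∀ l : List ℕ+, ENNReal.ofReal (l.map θ).prod = (l.map a).prod := by
    intro l
    induction l with
    | nil => simp
    | cons b l ih =>
      rw [List.map_cons, List.prod_cons, ENNReal.ofReal_mul (hθ b).le, ih, List.map_cons,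
        List.prod_cons]
  have hval : ∀ T : Set.range (typ (n := n)), ENNReal.ofReal (typeWeight n u θ T) = G (Φ T) := by
    intro T
    have hlen : (Φ T).2.length ≤ n := by
      simp only [hΦ, Multiset.length_toList]
      exact (Multiset.card_le_card (Multiset.filter_le _ _)).trans_eq (hcard T)
    simp only [hG]
    rw [if_pos hlen, typeWeight, ENNReal.ofReal_mul (by positivity),
      ENNReal.ofReal_inv_of_pos (by positivity)]
    congr 1
    · rw [ENNReal.ofReal_pow (by positivity)]
      congr 2
      rw [← Nat.cast_succ, ENNReal.ofReal_natCast]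
    · simp only [hΦ]
      rw [← hlist, Multiset.prod_map_toList]
  calc _ = ∑' T, G (Φ T) := tsum_congr hval
    _ ≤ ∑' q, G q := ENNReal.tsum_comp_le_tsum_of_injective hinj G
    _ = (((n + 1 : ℕ) : ℝ≥0∞) ^ (u + 1))⁻¹ * (∑' _c : Fin u → Fin (n + 1),
          ∑' l : List ℕ+, (if l.length ≤ n then (l.map a).prod else 0)) := by
        rw [ENNReal.tsum_mul_left, ENNReal.tsum_prod']
    _ ≤ (((n + 1 : ℕ) : ℝ≥0∞) ^ (u + 1))⁻¹ * (∑' _c : Fin u → Fin (n + 1), ((n + 1 : ℕ) : ℝ≥0∞)) := by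
        gcongr
        push_cast
        exact tsum_list_le ha1 n
    _ = 1 := by
        rw [tsum_fintype, Finset.sum_const, Finset.card_univ, Fintype.card_fun, Fintype.card_fin,
          Fintype.card_fin, nsmul_eq_mul, Nat.cast_pow, ← pow_succ]
        exact ENNReal.inv_mul_cancel (pow_ne_zero _ (by rw [Nat.cast_ne_zero]; omega))
          (ENNReal.pow_ne_top (ENNReal.natCast_ne_top _))

/-! ### Lossless codes and the bound for every block length -/

theorem blockDistortion_self {ρ : ℕ+ → ℕ+ → ℝ} (hρ : IsDistortion ρ) {n : ℕ} (x : Block n) :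
    blockDistortion ρ x x = 0 := by simp [blockDistortion, hρ.self]

/-- A lossless code that describes the type and then the block. -/
theorem exists_lossless_code {n : ℕ} {ρ : ℕ+ → ℕ+ → ℝ} (hρ : IsDistortion ρ) {d : ℝ} (hd : 0 ≤ d)
    (w : Multiset ℕ+ → ℝ) (hw : ∀ T, 0 < w T)
    (hw1 : ∑' x : Block n, ENNReal.ofReal (w (typ x)) / (typeClass x).card ≤ 1) :
    ∃ ξ : Code ρ d n, ∀ x, (ξ.length x : ℝ) ≤
      Real.logb 2 (1 / w (typ x)) + n * Real.logb 2 n + 2 := by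
  classical
  obtain ⟨ξ, hξ⟩ := exists_code_of_kernel (ρ := ρ) (d := d) (n := n) id id
    (fun x => by rw [id, blockDistortion_self hρ]; exact hd) (fun _ => rfl) w hw hw1
    (fun x b => if b = x then 1 else 0) (fun x => by simp)
    (fun x x' b _ h => by rw [id, id] at h; rw [h]) (fun _ => 1) (fun _ => one_pos) (fun x => by simp)
  refine ⟨ξ, fun x => (hξ x).trans ?_⟩
  have h1 : classInfo id x ≤ n * Real.logb 2 n := by
    have hc : (0 : ℝ) < (classCell id x).card := by exact_mod_cast classCell_card_pos id x
    have hc1 : (1 : ℝ) ≤ (classCell id x).card := by exact_mod_cast classCell_card_pos id x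
    have ht : (0 : ℝ) < (typeClass x).card := by
      exact_mod_cast Finset.card_pos.2 ⟨x, self_mem_typeClass x⟩
    have h2 : ((typeClass x).card : ℝ) ≤ (n : ℝ) ^ n := by
      exact_mod_cast (typeClass_card_le x).trans (Nat.factorial_le_pow n)
    rw [classInfo, ← Real.logb_pow]
    refine Real.logb_le_logb_of_le (by norm_num) (div_pos ht hc) (le_trans ?_ h2)
    exact div_le_self ht.le hc1
  simp only [div_one, Real.logb_one]
  linarith

theorem nonempty_code {ρ : ℕ+ → ℕ+ → ℝ} (hρ : IsDistortion ρ) {d : ℝ} (hd : 0 ≤ d) (n : ℕ) :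
    Nonempty (Code ρ d n) := by
  obtain ⟨θ, hpos, h⟩ : ∃ θ : ℕ+ → ℝ, (∀ a, 0 < θ a) ∧ HasSum θ 1 :=
    ⟨_, fun a => by positivity, hasSum_two_inv_pow_pnat⟩
  have hw := tsum_typeWeight_le (n := n) (u := 0) hpos h.summable h.tsum_eq.le
  obtain ⟨ξ, -⟩ := exists_lossless_code hρ hd (typeWeight n 0 θ) (fun T => typeWeight_pos hpos T) hw
  exact ⟨ξ⟩

theorem tailCount_eq_sum {n : ℕ} (u : ℕ) (x : Block n) :
    (tailCount u x : ℝ) = ∑ i, if u < (x i : ℕ) then (1 : ℝ) else 0 := by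
  rw [tailCount, Finset.card_filter]; push_cast; rfl

/-- For every block length there is a code whose redundancy on every type class is bounded by the
cost of the alphabet up to `u` and of the letters above `u`. -/
theorem exists_code_of_letter_weights {ρ : ℕ+ → ℕ+ → ℝ} (hρ : IsDistortion ρ) {θ : ℕ+ → ℝ}
    (hθ : ∀ a, 0 < θ a) (hs : Summable θ) (h1 : ∑' a, θ a ≤ 1) {n : ℕ} (hn : 1 ≤ n) (u : ℕ)
    {d : ℝ} (hd : 0 ≤ d) :
    ∃ ξ : Code ρ d n, ∀ g : Block n → Block n, (∀ x, blockDistortion ρ x (g x) ≤ d) → ∀ x₀,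
      ∑ x ∈ typeClass x₀, (ξ.length x : ℝ) ≤ ∑ x ∈ typeClass x₀, (classInfo g x +
        ((2 ^ 25 + 3 * irregularityBound) * (Real.logb 2 n + 1) * (u + 1) +
          ∑ i, if u < (x i : ℕ) then Real.logb 2 (1 / θ (x i)) +
            (2 ^ 25 + 3 * irregularityBound) * (Real.logb 2 n + 1) else 0)) := by
  set L := Real.logb 2 n with hL
  have hn' : (1 : ℝ) ≤ n := by exact_mod_cast hn
  have hL0 : 0 ≤ L := Real.logb_nonneg (by norm_num) hn'
  have hu0 : (0 : ℝ) ≤ u := Nat.cast_nonneg u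
  have huL := mul_nonneg hu0 hL0
  have hI := irregularityBound_pos
  have hIL := mul_nonneg hI.le hL0
  have hIu := mul_nonneg hI.le hu0
  have hIuL := mul_nonneg hI.le huL
  have hlog : Real.logb 2 ((n : ℝ) + 1) ≤ L + 1 := by
    calc Real.logb 2 ((n : ℝ) + 1) ≤ Real.logb 2 (n * 2) :=
          Real.logb_le_logb_of_le (by norm_num) (by positivity) (by linarith)
      _ = L + 1 := by
          rw [Real.logb_mul (by positivity) (by norm_num), Real.logb_self_eq_one (by norm_num)]
  have hwlog : ∀ x : Block n, Real.logb 2 (1 / typeWeight n u θ (typ x)) ≤ (u + 1) * (L + 1) +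
      ∑ i, if u < (x i : ℕ) then Real.logb 2 (1 / θ (x i)) else 0 := by
    intro x
    rw [logb_typeWeight hθ]
    gcongr
  have hsplit : ∀ x : Block n, (∑ i, if u < (x i : ℕ) then Real.logb 2 (1 / θ (x i)) +
      (2 ^ 25 + 3 * irregularityBound) * (L + 1) else 0) =
      (∑ i, if u < (x i : ℕ) then Real.logb 2 (1 / θ (x i)) else 0) +
      (2 ^ 25 + 3 * irregularityBound) * (L + 1) * tailCount u x := by
    intro x
    rw [tailCount_eq_sum, Finset.mul_sum, ← Finset.sum_add_distrib]
    refine Finset.sum_congr rfl fun i _ => ?_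
    split_ifs <;> ring
  have hw1 := tsum_typeWeight_le (n := n) (u := u) hθ hs h1
  -- Otherwise `n < 2 ^ 24` or `n ≤ u`. The `n log n` bits of a lossless description then fit into
  -- the allowed multiple of `(u + 1) * (log n + 1)`.
  by_cases hcase : 2 ^ 24 ≤ n ∧ u + 1 ≤ n
  · obtain ⟨ξ, hξ⟩ := exists_prototype_code hcase.1 hcase.2 hρ hd _
      (fun T => typeWeight_pos hθ T) hw1
    refine ⟨ξ, fun g hg x₀ => (hξ g hg x₀).trans (Finset.sum_le_sum fun x _ => ?_)⟩
    rw [hsplit]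
    have hτ : (0 : ℝ) ≤ tailCount u x := Nat.cast_nonneg _
    have := hwlog x
    have h2 := mul_nonneg hL0 hτ
    nlinarith
  · obtain ⟨ξ, hξ⟩ := exists_lossless_code hρ hd _ (fun T => typeWeight_pos hθ T) hw1
    refine ⟨ξ, fun g hg x₀ => Finset.sum_le_sum fun x _ => (hξ x).trans ?_⟩
    rw [hsplit]
    have hτ : (0 : ℝ) ≤ (2 ^ 25 + 3 * irregularityBound) * (L + 1) * tailCount u x := by positivity
    have h2 := classInfo_nonneg g x
    have h3 : (n : ℝ) * L ≤ 2 ^ 24 * L + u * L := by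
      by_cases hn24 : 2 ^ 24 ≤ n
      · have : n ≤ u := by
          by_contra h
          exact hcase ⟨hn24, by omega⟩
        have : (n : ℝ) ≤ u := by exact_mod_cast this
        nlinarith
      · have : (n : ℝ) ≤ 2 ^ 24 := by exact_mod_cast (not_le.1 hn24).le
        nlinarith
    have := hwlog x
    nlinarith

/-! ### Averaging over the source -/

/-- The class overhead is a constant plus a sum over letters, so its expectation is `n` times a
one-letter series. The hypotheses bound the description part of that series by `C` and the tail
probability part by `B₂`. -/
theorem rate_le_add {ρ : ℕ+ → ℕ+ → ℝ} {d : ℝ} {n u : ℕ} (hn : 1 ≤ n)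
    {θ : ℕ+ → ℝ} {C B₁ B₂ : ℝ} (hθ : ∀ a, θ a ≤ 1) (hθ0 : ∀ a, 0 < θ a) (hB₁ : 0 ≤ B₁) (hB₂ : 0 ≤ B₂)
    (hC : 0 ≤ C) (μ : PMF ℕ+)
    (h1 : n * (∑' a : ℕ+, if u < (a : ℕ) then μ a else 0) ≤ 1)
    (h2 : n * (∑' a : ℕ+, if u < (a : ℕ) then
      μ a * ENNReal.ofReal (Real.logb 2 (1 / θ a)) else 0) ≤ ENNReal.ofReal C)
    (ξ : Code ρ d n) (hξ : ∀ g : Block n → Block n, (∀ x, blockDistortion ρ x (g x) ≤ d) → ∀ x₀,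
      ∑ x ∈ typeClass x₀, (ξ.length x : ℝ) ≤ ∑ x ∈ typeClass x₀, (classInfo g x +
        (B₁ + ∑ i, if u < (x i : ℕ) then Real.logb 2 (1 / θ (x i)) + B₂ else 0))) :
    ξ.rate (iidLaw μ n) ≤ benchmarkRate ρ d (iidLaw μ n) + ENNReal.ofReal ((B₁ + C + B₂) / n) := by
  have hlog : ∀ a, 0 ≤ Real.logb 2 (1 / θ a) := fun a =>
    Real.logb_nonneg (by norm_num) ((one_le_div (hθ0 a)).2 (hθ a))
  set h : ℕ+ → ℝ := fun a => if u < (a : ℕ) then Real.logb 2 (1 / θ a) + B₂ else 0 with hh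
  have hh0 : ∀ a, 0 ≤ h a := fun a => by
    simp only [hh]
    split_ifs
    · exact add_nonneg (hlog a) hB₂
    · exact le_rfl
  have key := rate_le_of_class_bound ξ (fun x => B₁ + ∑ i, h (x i))
    (fun x => add_nonneg hB₁ (Finset.sum_nonneg fun i _ => hh0 _)) hξ μ
  refine key.trans (add_le_add le_rfl ?_)
  rw [ENNReal.ofReal_div_of_pos (by exact_mod_cast hn), ENNReal.ofReal_natCast]
  refine ENNReal.div_le_div_right ?_ _
  have e1 : ∀ x : Block n, ENNReal.ofReal (B₁ + ∑ i, h (x i)) =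
      ENNReal.ofReal B₁ + ∑ i, ENNReal.ofReal (h (x i)) := fun x => by
    rw [ENNReal.ofReal_add hB₁ (Finset.sum_nonneg fun i _ => hh0 _),
      ENNReal.ofReal_sum_of_nonneg fun i _ => hh0 _]
  simp only [e1]
  rw [lintegral_add_left measurable_const, lintegral_const, measure_univ, mul_one,
    lintegral_sum_iidLaw μ n fun a => ENNReal.ofReal (h a), add_assoc B₁,
    ENNReal.ofReal_add hB₁ (add_nonneg hC hB₂), ENNReal.ofReal_add hC hB₂]
  refine add_le_add le_rfl ?_
  have e2 : ∀ a, μ a * ENNReal.ofReal (h a) =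
      (if u < (a : ℕ) then μ a * ENNReal.ofReal (Real.logb 2 (1 / θ a)) else 0) +
      ENNReal.ofReal B₂ * (if u < (a : ℕ) then μ a else 0) := fun a => by
    simp only [hh]
    split_ifs
    · rw [ENNReal.ofReal_add (hlog a) hB₂, mul_add, mul_comm (ENNReal.ofReal B₂)]
    · simp
  rw [tsum_congr e2, ENNReal.tsum_add, ENNReal.tsum_mul_left, mul_add]
  refine add_le_add h2 ?_
  rw [mul_left_comm]
  exact mul_le_of_le_one_right' h1

theorem exists_codes {f : ℕ+ → ℝ≥0} {ρ : ℕ+ → ℕ+ → ℝ} (hρ : IsDistortion ρ)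
    (hne : (envelopeFamily f).Nonempty) (hent : envelopeFamily f ⊆ finiteEntropy)
    (htail : TailRegular f) :
    ∃ C₀ C₁ C₂ : ℝ, ∀ d : ℝ, 0 < d → ∀ n : ℕ, 1 ≤ n → ∃ ξ : Code ρ d n,
      worstRedundancy ξ (envelopeFamily f) ≤
        ((C₀ * ((envelopeQuantile f n : ℝ) * Real.logb 2 n / n) + C₁ * (Real.logb 2 n / n) +
          C₂ * (1 / n) : ℝ) : EReal) := by
  obtain ⟨θ, C, hC0, hθ0, hθs, hθ1, hθ⟩ := exists_tail_weights hne hent htail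
  set A : ℝ := 2 ^ 25 + 3 * irregularityBound with hA
  have hA0 : 0 ≤ A := by have := irregularityBound_pos; positivity
  refine ⟨2 * A, 2 * A + C, 2 * A + C + A * envelopeQuantile f 1, fun d hd n hn => ?_⟩
  obtain ⟨ξ, hξ⟩ := exists_code_of_letter_weights hρ hθ0 hθs hθ1 hn (envelopeQuantile f n) hd.le
  refine ⟨ξ, iSup₂_le fun μ hμ => ?_⟩
  obtain ⟨-, hq⟩ := hθ n hn
  obtain ⟨hq1, hq2⟩ := hq μ hμ
  set u := envelopeQuantile f n with hu
  set L := Real.logb 2 n with hL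
  have hn' : (1 : ℝ) ≤ n := by exact_mod_cast hn
  have hn0 : (0 : ℝ) < n := by linarith
  have hL0 : 0 ≤ L := Real.logb_nonneg (by norm_num) hn'
  have hu0 : (0 : ℝ) ≤ u := Nat.cast_nonneg u
  have hrate := rate_le_add hn (B₁ := A * (L + 1) * (u + 1)) (B₂ := A * (L + 1))
    (fun a => (hθs.le_tsum a fun b _ => (hθ0 b).le).trans hθ1) hθ0 (by positivity) (by positivity)
    (by positivity) μ hq1 hq2 ξ hξ
  -- The overhead contains a bare multiple of `u`. It is at most `u log n` once `n ≥ 2`; at `n = 1`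
  -- the logarithm vanishes and `u = envelopeQuantile f 1` is charged to the constant `C₂`.
  have hu1 : (u : ℝ) ≤ u * L + envelopeQuantile f 1 := by
    rcases Nat.eq_or_lt_of_le hn with h | h
    · have : (envelopeQuantile f 1 : ℝ) = u := by rw [hu, ← h]
      rw [this]
      nlinarith
    · have h2 : (1 : ℝ) ≤ L := by
        rw [hL, Real.le_logb_iff_rpow_le (by norm_num) hn0, Real.rpow_one]
        exact_mod_cast h
      have : (0 : ℝ) ≤ envelopeQuantile f 1 := Nat.cast_nonneg _
      nlinarith
  have hbound : (A * (L + 1) * (u + 1) + C * (L + 1) + A * (L + 1)) / n ≤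
      2 * A * (u * L / n) + (2 * A + C) * (L / n) + (2 * A + C + A * envelopeQuantile f 1) * (1 / n) := by
    rw [mul_div_assoc', mul_div_assoc', mul_div_assoc', ← add_div, ← add_div]
    refine div_le_div_of_nonneg_right ?_ hn0.le
    nlinarith [mul_le_mul_of_nonneg_left hu1 hA0]
  have hX0 : 0 ≤ (A * (L + 1) * (u + 1) + C * (L + 1) + A * (L + 1)) / n := by positivity
  refine EReal.sub_le_of_le_add' ?_
  refine (EReal.coe_ennreal_le_coe_ennreal_iff.2 hrate).trans ?_
  rw [EReal.coe_ennreal_add, EReal.coe_ennreal_ofReal, max_eq_left hX0]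
  exact add_le_add le_rfl (EReal.coe_le_coe_iff.2 hbound)

end Semifaithful

theorem theorem4 (f : ℕ+ → ℝ≥0) (ρ : ℕ+ → ℕ+ → ℝ)
    (hρ : Semifaithful.IsDistortion ρ)
    (hcons : Semifaithful.IsUnboundedConsistent ρ)
    (hent : Semifaithful.envelopeFamily f ⊆ Semifaithful.finiteEntropy)
    (htail : Semifaithful.TailRegular f) :
    ∃ C₀ C₁ C₂ : ℝ, ∀ d : ℝ, 0 < d →
      ∃ ξ : (n : ℕ) → Semifaithful.Code ρ d n, ∀ n : ℕ, 1 ≤ n →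
        Semifaithful.worstRedundancy (ξ n) (Semifaithful.envelopeFamily f) ≤
          ((C₀ * ((Semifaithful.envelopeQuantile f n : ℝ) * Real.logb 2 n / n)
            + C₁ * (Real.logb 2 n / n) + C₂ * (1 / n) : ℝ) : EReal) := by
  have hcode : ∀ d : ℝ, 0 < d → ∀ n, Nonempty (Semifaithful.Code ρ d n) := fun d hd n =>
    Semifaithful.nonempty_code hρ hd.le n
  by_cases hne : (Semifaithful.envelopeFamily f).Nonempty
  · obtain ⟨C₀, C₁, C₂, h⟩ := Semifaithful.exists_codes hρ hne hent htail
    refine ⟨C₀, C₁, C₂, fun d hd => ?_⟩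
    have hex : ∀ n : ℕ, ∃ ξ : Semifaithful.Code ρ d n, 1 ≤ n →
        Semifaithful.worstRedundancy ξ (Semifaithful.envelopeFamily f) ≤
          ((C₀ * ((Semifaithful.envelopeQuantile f n : ℝ) * Real.logb 2 n / n)
            + C₁ * (Real.logb 2 n / n) + C₂ * (1 / n) : ℝ) : EReal) := by
      intro n
      by_cases hn : 1 ≤ n
      · obtain ⟨ξ, hξ⟩ := h d hd n hn
        exact ⟨ξ, fun _ => hξ⟩
      · obtain ⟨ξ⟩ := hcode d hd n
        exact ⟨ξ, fun h => absurd h hn⟩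
    choose ξ hξ using hex
    exact ⟨ξ, hξ⟩
  -- An empty family has supremum `⊥`, so any code will do.
  · refine ⟨0, 0, 0, fun d hd => ⟨fun n => (hcode d hd n).some, fun n _ => ?_⟩⟩
    rw [Set.not_nonempty_iff_eq_empty.1 hne, Semifaithful.worstRedundancy]
    simp
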